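/- Let $k>0$. For $\beta\in\mathbb R$ let $$\Psi^{(+)}_{k\beta}(\xi,\eta)=C^{(+)}_{k\beta}\,e^{-ik\frac{\xi^2+\eta^2}{2}}\,{}_1F_1\!\left(\tfrac14+\tfrac{i\beta}{2k};\tfrac12;ik\xi^2\right){}_1F_1\!\left(\tfrac14-\tfrac{i\beta}{2k};\tfrac12;ik\eta^2\right),\qquad C^{(+)}_{k\beta}=\frac{|\Gamma(\frac14+\frac{i\beta}{2k})|^2}{2\sqrt2\,\pi^2},$$ $$\Psi^{(-)}_{k\beta}(\xi,\eta)=C^{(-)}_{k\beta}\,\xi\eta\,e^{-ik\frac{\xi^2+\eta^2}{2}}\,{}_1F_1\!\left(\tfrac34+\tfrac{i\beta}{2k};\tfrac32;ik\xi^2\right){}_1F_1\!\left(\tfrac34-\tfrac{i\beta}{2k};\tfrac32;ik\eta^2\right),\qquad C^{(-)}_{k\beta}=\frac{\sqrt2\,k\,|\Gamma(\frac34+\frac{i\beta}{2k})|^2}{\pi^2},$$ be the parabolic wave functions of the Helmholtz equation in the plane, and for $m\in\mathbb Z$ let $\Psi_{km}(r,\varphi)=\sqrt k\,J_{|m|}(kr)\,e^{im\varphi}/\sqrt{2\pi}$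 be the polar ones, where $r\cos\varphi=(\xi^2-\eta^2)/2$, $r\sin\varphi=\xi\eta$ with $\xi\ge0$, $\eta\in\mathbb R$, $r>0$, $\varphi\in[0,2\pi)$. Then there are unique coefficients $\mathcal W^{(\pm)}_{k\beta m}$ such that $\Psi^{(\pm)}_{k\beta}(\xi,\eta)=\sum_{m\in\mathbb Z}\mathcal W^{(\pm)}_{k\beta m}\Psi_{km}(r,\varphi)$ at all such points, and they have the following properties. (1) For all $\beta\in\mathbb R$, $m\in\mathbb Z$, $$\mathcal W^{(+)}_{k\beta m}=\frac{(-i)^{|m|}}{\pi\sqrt{2k}}\int_0^\pi(1+\cos\varphi)^{-\frac14-\frac{i\beta}{2k}}(1-\cos\varphi)^{-\frac14+\frac{i\beta}{2k}}\cos(m\varphi)\,d\varphi,$$ $$\mathcal W^{(-)}_{k\beta m}=\frac{(-i)^{|m|}}{\pi\sqrt{2k}}\int_0^\pi(1+\cos\varphi)^{-\frac14-\frac{i\beta}{2k}}(1-\cos\varphi)^{-\frac14+\frac{i\beta}{2k}}\sin(m\varphi)\,d\varphi,$$ the integrals being absolutely convergent. (2) For all $m,m'\in\mathbb Z$, with absolutely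 convergent integrals, $$\int_{-\infty}^\infty\mathcal W^{(+)}_{k\beta m}\mathcal W^{(+)*}_{k\beta m'}\,d\beta=\frac{\delta_{m,m'}+\delta_{m,-m'}}{2},\qquad \int_{-\infty}^\infty\mathcal W^{(-)}_{k\beta m}\mathcal W^{(-)*}_{k\beta m'}\,d\beta=\operatorname{sign}(mm')\,\frac{\delta_{|m||m'|}}{2}.$$ (So the first integral is $\tfrac12\delta_{|m||m'|}$ unless $m=m'=0$, when it is $1$.) (3) In the sense of distributions in $\beta$, for every fixed $\beta'\in\mathbb R$, $$\sum_{m\in\mathbb Z}\mathcal W^{(\pm)}_{k\beta m}\mathcal W^{(\pm)*}_{k\beta'm}=\delta(\beta-\beta'),\qquad \sum_{m\in\mathbb Z}\mathcal W^{(\pm)}_{k\beta m}\mathcal W^{(\mp)*}_{k\beta'm}=0;$$ that is, for every Schwartz function $f:\mathbb R\to\mathbb C$ the series $\sum_{m}\int_{-\infty}^\infty f(\beta)\,\mathcal W^{(\pm)}_{k\beta m}\mathcal W^{(\pm)*}_{k\beta'm}\,d\beta$ converges absolutely to $f(\beta')$, and the corresponding series with $\mathcal W^{(\pm)}\mathcal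 W^{(\mp)*}$ converges absolutely to $0$. Moreover, for all $\beta,\beta'$ and $N\ge 0$, $\sum_{m=-N}^{N}\mathcal W^{(\pm)}_{k\beta m}\mathcal W^{(\mp)*}_{k\beta'm}=0$. -/

import Mathlib

/-- Kummer's confluent hypergeometric series `₁F₁(a; b; z) = ∑ (a)_n / (b)_n * z^n / n!`. -/
noncomputable def kummerF (a b z : ℂ) : ℂ :=
  ∑' n : ℕ, (ascPochhammer ℂ n).eval a / ((ascPochhammer ℂ n).eval b * (n.factorial : ℂ)) * z ^ n

/-- The Bessel function `J_n(x)` of the first kind, of integer order `n ≥ 0`. -/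
noncomputable def besselJ (n : ℕ) (x : ℝ) : ℝ :=
  ∑' j : ℕ, (-1) ^ j / ((j.factorial : ℝ) * ((j + n).factorial : ℝ)) * (x / 2) ^ (2 * j + n)

/-- The polar wave function `Ψ_{km}(r, φ) = √k J_{|m|}(k r) e^{imφ} / √(2π)`. -/
noncomputable def polarWave (k : ℝ) (m : ℤ) (r φ : ℝ) : ℂ :=
  (Real.sqrt k : ℂ) * (besselJ m.natAbs (k * r) : ℂ) *
    (Complex.exp (Complex.I * (m : ℂ) * (φ : ℂ)) / (Real.sqrt (2 * Real.pi) : ℂ))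

/-- The number `iβ / (2k)`. -/
noncomputable def sepParam (k β : ℝ) : ℂ := Complex.I * (β : ℂ) / (2 * (k : ℂ))

/-- The normalization constant `C⁽⁺⁾_{kβ}`. -/
noncomputable def normConstPlus (k β : ℝ) : ℝ :=
  ‖Complex.Gamma (1 / 4 + sepParam k β)‖ ^ 2 / (2 * Real.sqrt 2 * Real.pi ^ 2)

/-- The normalization constant `C⁽⁻⁾_{kβ}`. -/
noncomputable def normConstMinus (k β : ℝ) : ℝ :=
  Real.sqrt 2 * k * (‖Complex.Gamma (3 / 4 + sepParam k β)‖ ^ 2 / Real.pi ^ 2)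

/-- The even parabolic wave function `Ψ⁽⁺⁾_{kβ}(ξ, η)`. -/
noncomputable def parabolicWavePlus (k β ξ η : ℝ) : ℂ :=
  (normConstPlus k β : ℂ) *
    Complex.exp (-(Complex.I * (k : ℂ) * (((ξ : ℂ) ^ 2 + (η : ℂ) ^ 2) / 2))) *
    kummerF (1 / 4 + sepParam k β) (1 / 2) (Complex.I * (k : ℂ) * (ξ : ℂ) ^ 2) *
    kummerF (1 / 4 - sepParam k β) (1 / 2) (Complex.I * (k : ℂ) * (η : ℂ) ^ 2)

/-- The odd parabolic wave function `Ψ⁽⁻⁾_{kβ}(ξ, η)`. -/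
noncomputable def parabolicWaveMinus (k β ξ η : ℝ) : ℂ :=
  (normConstMinus k β : ℂ) * ((ξ : ℂ) * (η : ℂ)) *
    Complex.exp (-(Complex.I * (k : ℂ) * (((ξ : ℂ) ^ 2 + (η : ℂ) ^ 2) / 2))) *
    kummerF (3 / 4 + sepParam k β) (3 / 2) (Complex.I * (k : ℂ) * (ξ : ℂ) ^ 2) *
    kummerF (3 / 4 - sepParam k β) (3 / 2) (Complex.I * (k : ℂ) * (η : ℂ) ^ 2)

/-- `w` is the family of coefficients of an expansion `Ψ(ξ, η) = ∑_{m ∈ ℤ} w m Ψ_{km}(r, φ)`,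
at every point with parabolic coordinates `(ξ, η)` and polar coordinates `(r, φ)`:
`x = r cos φ = (ξ² - η²) / 2`, `y = r sin φ = ξ η`. -/
def IsPolarExpansion (k : ℝ) (Ψ : ℝ → ℝ → ℂ) (w : ℤ → ℂ) : Prop :=
  ∀ ξ η r φ : ℝ, 0 ≤ ξ → 0 < r → φ ∈ Set.Ico 0 (2 * Real.pi) →
    r * Real.cos φ = (ξ ^ 2 - η ^ 2) / 2 → r * Real.sin φ = ξ * η →
    HasSum (fun m : ℤ => w m * polarWave k m r φ) (Ψ ξ η)

/-- The interbasis coefficients `𝒲⁽⁺⁾_{kβm}`: the coefficients of the polar expansion of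
`Ψ⁽⁺⁾_{kβ}`. (That this expansion exists and is unique is not built into the definition.) -/
noncomputable def coeffPlus (k β : ℝ) : ℤ → ℂ :=
  Classical.epsilon (IsPolarExpansion k (parabolicWavePlus k β))

/-- The interbasis coefficients `𝒲⁽⁻⁾_{kβm}`: the coefficients of the polar expansion of
`Ψ⁽⁻⁾_{kβ}`. -/
noncomputable def coeffMinus (k β : ℝ) : ℤ → ℂ :=
  Classical.epsilon (IsPolarExpansion k (parabolicWaveMinus k β))

/-- The weight `(1 + cos φ)^{-1/4 - iβ/(2k)} (1 - cos φ)^{-1/4 + iβ/(2k)}` on `(0, π)`. -/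
noncomputable def angularWeight (k β φ : ℝ) : ℂ :=
  ((1 + Real.cos φ : ℝ) : ℂ) ^ (-(1 / 4) - sepParam k β) *
    ((1 - Real.cos φ : ℝ) : ℂ) ^ (-(1 / 4) + sepParam k β)

/-- `∑_{m ∈ ℤ} U_{βm} V*_{β'm} = c δ(β - β')` in the sense of distributions in `β`, for every
fixed `β'`: tested against any Schwartz function `f`, the sum converges to `c f(β')`. -/
def SumEqDelta (U V : ℝ → ℤ → ℂ) (c : ℂ) : Prop :=
  ∀ (f : SchwartzMap ℝ ℂ) (β' : ℝ),
    (∀ m : ℤ, MeasureTheory.Integrable (fun β : ℝ => f β * (U β m * star (V β' m)))) ∧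
    HasSum (fun m : ℤ => ∫ β : ℝ, f β * (U β m * star (V β' m))) (c * f β')

section

open MeasureTheory Set Filter Topology FourierTransform

/-! The substitution `θ = 2 arctan (e^v)` has `cos θ = -tanh v`, `sin θ = sech v`, `dθ = sech v dv`,
and turns the angular weight times `dθ` into `(cosh v)^{-1/2} e^{iβv/k} dv`. The proposed
coefficients are therefore Fourier transforms in `β` of `(cosh v)^{-1/2} cos (mθ(v))` and `(cosh
v)^{-1/2} sin (mθ(v))`, and the two orthogonality statements become Plancherel on the line and
Parseval on the circle.

Expansion. In parabolic coordinates the plane wave `e^{-ikr cos(φ+θ)}` is a phase depending on `r`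
alone times the exponential of `ik (ξ sin(θ/2) + η cos(θ/2))²`. Half the sum (or difference) of the
waves at `φ + θ` and `φ - θ` is integrated over `θ` against the angular weight in two ways. A power
series expansion gives Beta integrals that assemble into a Cauchy product of two Kummer series, that
is, the parabolic wave (`integral_planeKernel_one`, `integral_planeKernel_neg_one`). The
Jacobi–Anger expansion gives the polar series with the integral coefficients
(`hasSum_angularCoeff_mul_polarWave`). Uniqueness is read off on the circle `r = 1/k`, where the
expansion is an absolutely convergent trigonometric series and `J_n(1) > 0` for every `n`.

Orthogonality in `β`. The modes `(cosh v)^{-1/2} e^{imθ(v)}` are closed under differentiation up to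
shifts of `m`, so their Fourier transforms are `O(w^{-2})` and Plancherel holds in its elementary
form. It leaves the integrals of `cos · cos` or `sin · sin` over `(0, π)`.

Completeness. Testing against `f` replaces one coefficient by the half-range Fourier coefficient of
the Fourier transform `F` of `f`; the other is that of `e^{icv}` with `c = β'/k`. Parseval on the
circle (`hasSum_halfRange_mul_star`) would give the result if `e^{icv}` were square integrable. It
is damped by `e^{-εv²}` and `ε → 0` is taken by dominated convergence in `m`. Integration by parts
(`norm_integral_angularMode_mul_le`) bounds the coefficients by integrals against `K_n = (cosh
v)^{-1/2} / (1 + n / cosh v)`. Two properties of this kernel suffice: `∫ K_n = O(n^{-1/2})` bounds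
the damped characters uniformly in `ε`, and `∑ n^{-1/2} K_n(v) ≤ π` for all `v` makes the
coefficients of `F` summable against `n^{-1/2}`. The cross terms vanish because `𝒲⁽⁺⁾` is even and
`𝒲⁽⁻⁾` odd in `m`. -/

/-! ### The substitution `θ = 2 arctan (e^v)` and the angular weight. -/

/-- The Gudermannian-type angle `θ = 2 arctan (e^v)`, i.e. `tan (θ / 2) = e^v`. -/
noncomputable def gdAngle (v : ℝ) : ℝ := 2 * Real.arctan (Real.exp v)

/-- The function `(cosh v)^{-1/2}`. -/
noncomputable def sechSqrt (v : ℝ) : ℝ := (Real.sqrt (Real.cosh v))⁻¹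

lemma hasDerivAt_gdAngle (v : ℝ) : HasDerivAt gdAngle (Real.cosh v)⁻¹ v := by
  have h := ((Real.hasDerivAt_exp v).arctan).const_mul 2
  refine h.congr_deriv ?_
  rw [Real.cosh_eq, Real.exp_neg]
  have := Real.exp_pos v
  field_simp
  ring

lemma continuous_gdAngle : Continuous gdAngle :=
  continuous_iff_continuousAt.2 fun v => (hasDerivAt_gdAngle v).continuousAt

lemma strictMono_gdAngle : StrictMono gdAngle := fun a b h => by
  have := Real.arctan_strictMono (Real.exp_strictMono h)
  simp only [gdAngle]; linarith

lemma gdAngle_pos (v : ℝ) : 0 < gdAngle v := by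
  have : 0 < Real.arctan (Real.exp v) := by
    rw [← Real.arctan_zero]; exact Real.arctan_strictMono (Real.exp_pos v)
  simp only [gdAngle]; linarith

lemma gdAngle_lt_pi (v : ℝ) : gdAngle v < Real.pi := by
  have := Real.arctan_lt_pi_div_two (Real.exp v)
  simp only [gdAngle]; linarith

lemma image_gdAngle : gdAngle '' univ = Ioo 0 Real.pi := by
  ext θ
  constructor
  · rintro ⟨v, -, rfl⟩; exact ⟨gdAngle_pos v, gdAngle_lt_pi v⟩
  · rintro ⟨h0, h1⟩
    refine ⟨Real.log (Real.tan (θ / 2)), mem_univ _, ?_⟩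
    have : 0 < Real.tan (θ / 2) := Real.tan_pos_of_pos_of_lt_pi_div_two (by linarith) (by linarith)
    rw [gdAngle, Real.exp_log this, Real.arctan_tan (by linarith) (by linarith)]
    ring

lemma cos_gdAngle (v : ℝ) : Real.cos (gdAngle v) = -(Real.sinh v / Real.cosh v) := by
  have := Real.exp_pos v
  rw [gdAngle, Real.cos_two_mul, Real.cos_sq_arctan, Real.cosh_eq, Real.sinh_eq, Real.exp_neg]
  field_simp
  ring

lemma sin_gdAngle (v : ℝ) : Real.sin (gdAngle v) = (Real.cosh v)⁻¹ := by
  have := Real.exp_pos v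
  rw [gdAngle, Real.sin_two_mul, Real.sin_arctan, Real.cos_arctan, Real.cosh_eq, Real.exp_neg]
  have h : 0 < 1 + Real.exp v ^ 2 := by positivity
  have h2 := Real.sq_sqrt h.le
  have h3 := Real.sqrt_pos.2 h
  field_simp
  rw [h2]; ring

lemma integral_Ioo_eq_integral_gdAngle (f : ℝ → ℂ) :
    ∫ θ in Ioo 0 Real.pi, f θ = ∫ v, (((Real.cosh v)⁻¹ : ℝ) : ℂ) * f (gdAngle v) := by
  rw [← image_gdAngle, integral_image_eq_integral_abs_deriv_smul MeasurableSet.univ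
    (fun v _ => (hasDerivAt_gdAngle v).hasDerivWithinAt) strictMono_gdAngle.injective.injOn]
  simp [abs_of_pos, Real.cosh_pos]

lemma integrableOn_Ioo_iff_integrable_gdAngle (f : ℝ → ℂ) :
    IntegrableOn f (Ioo 0 Real.pi) ↔
      Integrable fun v => (((Real.cosh v)⁻¹ : ℝ) : ℂ) * f (gdAngle v) := by
  rw [← image_gdAngle, integrableOn_image_iff_integrableOn_abs_deriv_smul MeasurableSet.univ
    (fun v _ => (hasDerivAt_gdAngle v).hasDerivWithinAt) strictMono_gdAngle.injective.injOn]
  simp [abs_of_pos, Real.cosh_pos]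

lemma integral_zero_pi_eq_integral_gdAngle (f : ℝ → ℂ) :
    ∫ θ in (0 : ℝ)..Real.pi, f θ = ∫ v, (((Real.cosh v)⁻¹ : ℝ) : ℂ) * f (gdAngle v) := by
  rw [intervalIntegral.integral_of_le Real.pi_pos.le, integral_Ioc_eq_integral_Ioo,
    integral_Ioo_eq_integral_gdAngle]

lemma intervalIntegrable_zero_pi_iff (f : ℝ → ℂ) :
    IntervalIntegrable f volume 0 Real.pi ↔
      Integrable fun v => (((Real.cosh v)⁻¹ : ℝ) : ℂ) * f (gdAngle v) := by
  rw [intervalIntegrable_iff_integrableOn_Ioo_of_le Real.pi_pos.le,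
    integrableOn_Ioo_iff_integrable_gdAngle]

lemma sechSqrt_pos (v : ℝ) : 0 < sechSqrt v :=
  inv_pos.2 (Real.sqrt_pos.2 (Real.cosh_pos v))

lemma sechSqrt_sq (v : ℝ) : sechSqrt v ^ 2 = (Real.cosh v)⁻¹ := by
  rw [sechSqrt, inv_pow, Real.sq_sqrt (Real.cosh_pos v).le]

lemma exp_abs_le_two_mul_cosh (v : ℝ) : Real.exp |v| ≤ 2 * Real.cosh v := by
  rw [← Real.cosh_abs, Real.cosh_eq]
  have := Real.exp_pos (-|v|)
  linarith

lemma sechSqrt_le_exp (v : ℝ) : sechSqrt v ≤ Real.sqrt 2 * Real.exp (-(|v| / 2)) := by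
  refine le_of_sq_le_sq ?_ (by positivity)
  rw [sechSqrt_sq, mul_pow, Real.sq_sqrt (by norm_num), ← Real.exp_nat_mul]
  have h := exp_abs_le_two_mul_cosh v
  have h1 : Real.exp ((2 : ℕ) * -(|v| / 2)) = (Real.exp |v|)⁻¹ := by
    rw [← Real.exp_neg]; congr 1; push_cast; ring
  rw [h1, inv_le_iff_one_le_mul₀ (Real.cosh_pos v)]
  have := Real.exp_pos |v|
  rw [mul_assoc, ← div_eq_inv_mul, ← mul_div_assoc, le_div_iff₀ this]
  linarith

lemma continuous_sechSqrt : Continuous sechSqrt := by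
  unfold sechSqrt
  refine Continuous.inv₀ (by fun_prop) fun v => (Real.sqrt_pos.2 (Real.cosh_pos v)).ne'

lemma integrable_exp_neg_abs_div_two : Integrable fun v : ℝ => Real.exp (-(|v| / 2)) := by
  have h1 : IntegrableOn (fun v : ℝ => Real.exp (-(|v| / 2))) (Ioi 0) := by
    refine (integrableOn_exp_mul_Ioi (a := -(1 / 2)) (by norm_num) 0).congr_fun ?_
      measurableSet_Ioi
    intro v hv
    simp only [abs_of_pos (mem_Ioi.1 hv)]
    congr 1; ring
  have h2 : IntegrableOn (fun v : ℝ => Real.exp (-(|v| / 2))) (Iic 0) := by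
    refine (integrableOn_exp_mul_Iic (a := 1 / 2) (by norm_num) 0).congr_fun ?_
      measurableSet_Iic
    intro v hv
    simp only [abs_of_nonpos (mem_Iic.1 hv)]
    congr 1; ring
  rw [← integrableOn_univ, ← Iic_union_Ioi (a := (0 : ℝ))]
  exact h2.union h1

lemma integrable_sechSqrt : Integrable sechSqrt :=
  (integrable_exp_neg_abs_div_two.const_mul (Real.sqrt 2)).mono'
    continuous_sechSqrt.aestronglyMeasurable
    (Eventually.of_forall fun v => by
      rw [Real.norm_of_nonneg (sechSqrt_pos v).le]; exact sechSqrt_le_exp v)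

lemma hasDerivAt_sechSqrt (v : ℝ) :
    HasDerivAt sechSqrt (-(1 / 2) * (Real.sinh v / Real.cosh v) * sechSqrt v) v := by
  have h := ((Real.hasDerivAt_cosh v).sqrt (Real.cosh_pos v).ne').inv
    (Real.sqrt_pos.2 (Real.cosh_pos v)).ne'
  refine h.congr_deriv ?_
  have h1 := Real.sq_sqrt (Real.cosh_pos v).le
  have h2 := Real.sqrt_pos.2 (Real.cosh_pos v)
  have h3 := Real.cosh_pos v
  rw [sechSqrt, h1]
  field_simp

lemma one_add_cos_gdAngle (v : ℝ) :
    1 + Real.cos (gdAngle v) = Real.exp (-v) * (Real.cosh v)⁻¹ := by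
  rw [cos_gdAngle]
  have := Real.cosh_pos v
  field_simp
  rw [← Real.cosh_sub_sinh]; ring

lemma one_sub_cos_gdAngle (v : ℝ) :
    1 - Real.cos (gdAngle v) = Real.exp v * (Real.cosh v)⁻¹ := by
  rw [cos_gdAngle]
  have := Real.cosh_pos v
  field_simp
  rw [← Real.cosh_add_sinh]; ring

/-- The substitution `θ = gdAngle v` turns the angular weight into `(cosh v)^{-1/2} e^{iβv/k}`. -/
lemma inv_cosh_mul_angularWeight {k : ℝ} (hk : 0 < k) (β v : ℝ) :
    (((Real.cosh v)⁻¹ : ℝ) : ℂ) * angularWeight k β (gdAngle v) =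
      (sechSqrt v : ℂ) * Complex.exp (Complex.I * ((β / k * v : ℝ) : ℂ)) := by
  have hc := Real.cosh_pos v
  have hexp : ∀ x : ℝ, 0 < x → ∀ s : ℂ, (x : ℂ) ^ s = Complex.exp (Real.log x * s) := by
    intro x hx s
    rw [Complex.cpow_def_of_ne_zero (by exact_mod_cast hx.ne'), Complex.ofReal_log hx.le]
  have hs : sechSqrt v = Real.exp (-(1 / 2) * Real.log (Real.cosh v)) := by
    rw [sechSqrt, Real.sqrt_eq_rpow, ← Real.rpow_neg hc.le, Real.rpow_def_of_pos hc]
    congr 1; ring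
  have hi : (Real.cosh v)⁻¹ = Real.exp (-Real.log (Real.cosh v)) := by
    rw [Real.exp_neg, Real.exp_log hc]
  rw [angularWeight, one_add_cos_gdAngle, one_sub_cos_gdAngle, hexp _ (by positivity),
    hexp _ (by positivity), Real.log_mul (Real.exp_pos _).ne' (by positivity),
    Real.log_mul (Real.exp_pos _).ne' (by positivity), Real.log_exp, Real.log_exp, Real.log_inv,
    hs, hi, sepParam, Complex.ofReal_exp, Complex.ofReal_exp, ← Complex.exp_add,
    ← Complex.exp_add, ← Complex.exp_add]
  congr 1
  have hk' : (k : ℂ) ≠ 0 := by exact_mod_cast hk.ne'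
  push_cast
  field_simp
  ring

lemma integral_angularWeight_mul {k : ℝ} (hk : 0 < k) (β : ℝ) (Φ : ℝ → ℂ) :
    ∫ θ in (0 : ℝ)..Real.pi, angularWeight k β θ * Φ θ =
      ∫ v, (sechSqrt v : ℂ) * Complex.exp (Complex.I * ((β / k * v : ℝ) : ℂ)) * Φ (gdAngle v) := by
  rw [integral_zero_pi_eq_integral_gdAngle]
  simp_rw [← mul_assoc, inv_cosh_mul_angularWeight hk]

lemma norm_exp_I_mul_ofReal' (x : ℝ) : ‖Complex.exp (Complex.I * (x : ℂ))‖ = 1 := by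
  rw [mul_comm, Complex.norm_exp_ofReal_mul_I]

lemma intervalIntegrable_angularWeight {k : ℝ} (hk : 0 < k) (β : ℝ) :
    IntervalIntegrable (angularWeight k β) volume 0 Real.pi := by
  rw [intervalIntegrable_zero_pi_iff]
  simp_rw [inv_cosh_mul_angularWeight hk]
  refine integrable_sechSqrt.mono' ?_ (Eventually.of_forall fun v => ?_)
  · have := continuous_sechSqrt
    exact (by fun_prop : Continuous _).aestronglyMeasurable
  · rw [norm_mul, norm_exp_I_mul_ofReal', mul_one, Complex.norm_real,
      Real.norm_of_nonneg (sechSqrt_pos v).le]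

lemma intervalIntegrable_angularWeight_mul {k : ℝ} (hk : 0 < k) (β : ℝ) {Φ : ℝ → ℂ}
    (hΦ : Continuous Φ) :
    IntervalIntegrable (fun θ => angularWeight k β θ * Φ θ) volume 0 Real.pi :=
  (intervalIntegrable_angularWeight hk β).mul_continuousOn hΦ.continuousOn

/-! ### Bessel series and the Jacobi–Anger expansion. -/

lemma summable_besselJ (n : ℕ) (x : ℝ) :
    Summable fun j : ℕ =>
      (-1 : ℝ) ^ j / ((j.factorial : ℝ) * ((j + n).factorial : ℝ)) * (x / 2) ^ (2 * j + n) := by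
  refine Summable.of_norm_bounded
    ((Real.summable_pow_div_factorial ((x / 2) ^ 2)).mul_left (|x / 2| ^ n)) fun j => ?_
  have h1 : (1 : ℝ) ≤ ((j + n).factorial : ℝ) := by exact_mod_cast Nat.succ_le_of_lt (Nat.factorial_pos _)
  have h2 : (0 : ℝ) < (j.factorial : ℝ) := by exact_mod_cast Nat.factorial_pos _
  rw [norm_mul, norm_div, norm_pow, norm_neg, norm_one, one_pow, norm_mul, norm_pow,
    Real.norm_of_nonneg h2.le, Real.norm_of_nonneg (by linarith : (0 : ℝ) ≤ ((j + n).factorial : ℝ)),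
    Real.norm_eq_abs, pow_add, pow_mul, sq_abs]
  have h3 : 1 / ((j.factorial : ℝ) * ((j + n).factorial : ℝ)) ≤ 1 / (j.factorial : ℝ) :=
    one_div_le_one_div_of_le h2 (le_mul_of_one_le_right h2.le h1)
  calc _ ≤ 1 / (j.factorial : ℝ) * (((x / 2) ^ 2) ^ j * |x / 2| ^ n) := by gcongr
    _ = _ := by ring

/-- Pairs of naturals are parametrized by their difference and their minimum. -/
def intProdNatEquiv : ℤ × ℕ ≃ ℕ × ℕ where
  toFun p := (p.2 + p.1.toNat, p.2 + (-p.1).toNat)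
  invFun q := ((q.1 : ℤ) - q.2, min q.1 q.2)
  left_inv p := by
    ext
    · simp only; omega
    · simp only; omega
  right_inv q := by
    ext
    · simp only; omega
    · simp only; omega

/-- Exponents `p = j + m⁺` and `q = j + m⁻` have difference `m`, sum `2j + |m|`, and `{p, q} = {j, j
+ |m|}`, which produces the factorials of the Bessel series. -/
lemma jacobiAnger_term {u : ℂ} (hu : u ≠ 0) (z : ℂ) (m : ℤ) (j : ℕ) :
    (-Complex.I * (z / 2) * u) ^ (j + m.toNat) / ((j + m.toNat).factorial : ℂ) *
      ((-Complex.I * (z / 2) * u⁻¹) ^ (j + (-m).toNat) / ((j + (-m).toNat).factorial : ℂ)) =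
    (-Complex.I) ^ m.natAbs * u ^ m * ((-1) ^ j / ((j.factorial : ℂ) *
        ((j + m.natAbs).factorial : ℂ)) * (z / 2) ^ (2 * j + m.natAbs)) := by
  have hI : (-Complex.I) ^ (2 * j) = (-1 : ℂ) ^ j := by
    rw [pow_mul, neg_sq, Complex.I_sq]
  obtain ⟨n, rfl | rfl⟩ := m.eq_nat_or_neg
  · rw [Int.toNat_natCast, Int.toNat_neg_natCast, Int.natAbs_natCast, add_zero, zpow_natCast, ← hI]
    have : u ^ (j + n) * u⁻¹ ^ j = u ^ n := by
      rw [pow_add, inv_pow]; field_simp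
    rw [← this]
    generalize -Complex.I = i, z / 2 = y
    ring
  · rw [neg_neg, Int.toNat_natCast, Int.toNat_neg_natCast, Int.natAbs_neg, Int.natAbs_natCast,
      add_zero, zpow_neg, zpow_natCast, ← inv_pow, ← hI]
    have : u⁻¹ ^ (j + n) * u ^ j = u⁻¹ ^ n := by
      rw [pow_add, inv_pow, inv_pow]; field_simp
    rw [← this]
    generalize -Complex.I = i, z / 2 = y
    ring

/-- The generating function of the Bessel functions: the product of two absolutely convergent
exponential series, reindexed by the difference and the minimum of the two exponents. -/
lemma hasSum_jacobiAnger_aux {u : ℂ} (hu : u ≠ 0) (z : ℂ) :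
    HasSum (fun p : ℤ × ℕ => (-Complex.I) ^ p.1.natAbs * u ^ p.1 *
      ((-1) ^ p.2 / ((p.2.factorial : ℂ) * ((p.2 + p.1.natAbs).factorial : ℂ)) *
        (z / 2) ^ (2 * p.2 + p.1.natAbs)))
      (Complex.exp (-Complex.I * (z / 2) * u + -Complex.I * (z / 2) * u⁻¹)) := by
  have hexp : ∀ x : ℂ, HasSum (fun n : ℕ => x ^ n / (n.factorial : ℂ)) (Complex.exp x) := by
    intro x
    rw [Complex.exp_eq_exp_ℂ]
    exact NormedSpace.expSeries_div_hasSum_exp x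
  have hn : ∀ x : ℂ, Summable fun n : ℕ => ‖x ^ n / (n.factorial : ℂ)‖ := fun x =>
    (NormedSpace.norm_expSeries_div_summable x)
  rw [Complex.exp_add]
  set x := -Complex.I * (z / 2) * u with hx
  set y := -Complex.I * (z / 2) * u⁻¹ with hy
  have hsum := summable_mul_of_summable_norm (f := fun n : ℕ => x ^ n / (n.factorial : ℂ))
    (g := fun n : ℕ => y ^ n / (n.factorial : ℂ)) (hn x) (hn y)
  have h0 := HasSum.mul (f := fun n : ℕ => x ^ n / (n.factorial : ℂ))
    (g := fun n : ℕ => y ^ n / (n.factorial : ℂ)) (hexp x) (hexp y) hsum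
  have h := intProdNatEquiv.hasSum_iff.2 h0
  refine h.congr_fun fun p => ?_
  exact (jacobiAnger_term hu z p.1 p.2).symm

lemma exp_mul_add_exp_mul_inv (z α : ℝ) :
    -Complex.I * (z / 2) * Complex.exp (Complex.I * α) +
      -Complex.I * (z / 2) * (Complex.exp (Complex.I * α))⁻¹ =
      -(Complex.I * ((z * Real.cos α : ℝ) : ℂ)) := by
  rw [← Complex.exp_neg]
  push_cast
  rw [Complex.cos, neg_mul (α : ℂ), mul_comm (α : ℂ) Complex.I]
  ring

/-- The Jacobi–Anger expansion of a plane wave. -/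
lemma hasSum_jacobiAnger (z α : ℝ) :
    HasSum (fun m : ℤ => (-Complex.I) ^ m.natAbs * (besselJ m.natAbs z : ℂ) *
      Complex.exp (Complex.I * (m : ℂ) * (α : ℂ)))
      (Complex.exp (-(Complex.I * ((z * Real.cos α : ℝ) : ℂ)))) := by
  have h2 := hasSum_jacobiAnger_aux (Complex.exp_ne_zero (Complex.I * α)) z
  rw [exp_mul_add_exp_mul_inv] at h2
  refine h2.prod_fiberwise fun m => ?_
  have hb := (Complex.hasSum_ofReal.2 (summable_besselJ m.natAbs z).hasSum).mul_left
    ((-Complex.I) ^ m.natAbs * Complex.exp (Complex.I * α) ^ m)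
  have he : Complex.exp (Complex.I * (m : ℂ) * (α : ℂ)) = Complex.exp (Complex.I * α) ^ m := by
    rw [← Complex.exp_int_mul]; congr 1; ring
  rw [he, mul_right_comm]
  refine hb.congr_fun fun j => ?_
  push_cast
  rfl

/-- The Jacobi–Anger terms at `α = 0` have modulus `|J_{|m|}(z)|`, and unconditional convergence in
`ℂ` is absolute. This is the dominating series when the expansion is integrated termwise. -/
lemma summable_abs_besselJ (z : ℝ) : Summable fun m : ℤ => |besselJ m.natAbs z| := by
  have h := (hasSum_jacobiAnger z 0).summable.norm
  refine h.congr fun m => ?_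
  simp

/-! ### Uniqueness of polar expansions. -/

/-- The leading term `2^{-n} / n!` dominates: the remaining terms are bounded by a geometric series
of ratio `1/4`, whose sum is one third of it. -/
lemma besselJ_one_pos (n : ℕ) : 0 < besselJ n 1 := by
  have hs := summable_besselJ n 1
  have hn : (0 : ℝ) < (n.factorial : ℝ) := by exact_mod_cast Nat.factorial_pos _
  rw [besselJ, hs.tsum_eq_zero_add]
  have hg : HasSum (fun j : ℕ => (1 / (n.factorial : ℝ)) * (1 / 2) ^ n * (1 / 4) * (1 / 4 : ℝ) ^ j)
      ((1 / (n.factorial : ℝ)) * (1 / 2) ^ n * (1 / 4) * (1 - 1 / 4)⁻¹) :=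
    (hasSum_geometric_of_lt_one (by norm_num) (by norm_num)).mul_left _
  have hb := tsum_of_norm_bounded hg (f := fun j : ℕ => (-1 : ℝ) ^ (j + 1) /
    (((j + 1).factorial : ℝ) * ((j + 1 + n).factorial : ℝ)) * (1 / 2) ^ (2 * (j + 1) + n)) (by
    intro j
    have h1 : (1 : ℝ) ≤ ((j + 1).factorial : ℝ) := by
      exact_mod_cast Nat.succ_le_of_lt (Nat.factorial_pos _)
    have h2 : (n.factorial : ℝ) ≤ ((j + 1 + n).factorial : ℝ) := by
      exact_mod_cast Nat.factorial_le (by omega)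
    rw [norm_mul, norm_div, norm_pow, norm_neg, norm_one, one_pow, norm_mul, norm_pow,
      Real.norm_of_nonneg (by linarith), Real.norm_of_nonneg (by linarith),
      Real.norm_of_nonneg (by norm_num)]
    have h3 : 1 / (((j + 1).factorial : ℝ) * ((j + 1 + n).factorial : ℝ)) ≤ 1 / (n.factorial : ℝ) :=
      one_div_le_one_div_of_le hn (by nlinarith)
    calc _ ≤ 1 / (n.factorial : ℝ) * (1 / 2) ^ (2 * (j + 1) + n) := by gcongr
      _ = _ := by
        have : (1 / 4 : ℝ) = (1 / 2) ^ 2 := by norm_num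
        rw [this, ← pow_mul]; ring)
  rw [Real.norm_eq_abs, abs_le] at hb
  have hp : 0 < (1 / (n.factorial : ℝ)) * (1 / 2) ^ n := by positivity
  have h0 : (-1 : ℝ) ^ 0 / (((0 : ℕ).factorial : ℝ) * ((0 + n).factorial : ℝ)) *
      (1 / 2) ^ (2 * 0 + n) = (1 / (n.factorial : ℝ)) * (1 / 2) ^ n := by simp
  rw [h0]
  linarith [hb.1]

/-- A trigonometric series that converges to zero at every point has zero coefficients. -/
lemma eq_zero_of_hasSum_exp_eq_zero {d : ℤ → ℂ}
    (h : ∀ φ ∈ Ico 0 (2 * Real.pi),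
      HasSum (fun m : ℤ => d m * Complex.exp (Complex.I * (m : ℂ) * (φ : ℂ))) 0) (n : ℤ) :
    d n = 0 := by
  -- At `φ = 0` all exponentials equal `1`, so the hypothesis there already gives absolute
  -- summability of the coefficients and permits termwise integration against `e^{-inφ}`.
  have hd : Summable fun m => ‖d m‖ := by
    have := (h 0 ⟨le_rfl, by positivity⟩).summable.norm
    simpa using this
  have hI : ∀ m : ℤ, ∫ φ in (0 : ℝ)..(2 * Real.pi),
      d m * Complex.exp (Complex.I * ((m - n : ℤ) : ℂ) * (φ : ℂ)) =
      if m = n then 2 * Real.pi * d n else 0 := by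
    intro m
    rw [intervalIntegral.integral_const_mul]
    split_ifs with hmn
    · subst hmn; simp; ring
    · have hne : Complex.I * ((m - n : ℤ) : ℂ) ≠ 0 :=
        mul_ne_zero Complex.I_ne_zero (by exact_mod_cast sub_ne_zero.2 hmn)
      rw [integral_exp_mul_complex hne]
      have : Complex.exp (Complex.I * ((m - n : ℤ) : ℂ) * ((2 * Real.pi : ℝ) : ℂ)) = 1 := by
        rw [Complex.exp_eq_one_iff]; exact ⟨m - n, by push_cast; ring⟩
      rw [this]; simp
  have hs := intervalIntegral.hasSum_integral_of_dominated_convergence (μ := volume)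
    (a := 0) (b := 2 * Real.pi) (F := fun (m : ℤ) (φ : ℝ) =>
      d m * Complex.exp (Complex.I * ((m - n : ℤ) : ℂ) * (φ : ℂ))) (f := fun _ => 0)
    (fun m _ => ‖d m‖) (fun m => (by fun_prop : Continuous _).aestronglyMeasurable)
    (fun m => Eventually.of_forall fun φ _ => by
      rw [norm_mul]
      have : Complex.I * ((m - n : ℤ) : ℂ) * (φ : ℂ) = Complex.I * (((m - n : ℤ) * φ : ℝ) : ℂ) := by
        push_cast; ring
      rw [this, norm_exp_I_mul_ofReal', mul_one])
    (Eventually.of_forall fun _ _ => hd) (by simp)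
    (by
      -- The interval integral lives on `(0, 2π]` while the hypothesis covers `[0, 2π)`; the
      -- endpoint is a null set.
      have : ∀ᵐ φ : ℝ, φ ≠ 2 * Real.pi := by
        simp [ae_iff, measure_singleton]
      filter_upwards [this] with φ hφ hmem
      rw [uIoc_of_le (by positivity)] at hmem
      have := (h φ ⟨hmem.1.le, lt_of_le_of_ne hmem.2 hφ⟩).mul_right
        (Complex.exp (-(Complex.I * (n : ℂ) * (φ : ℂ))))
      rw [zero_mul] at this
      refine this.congr_fun fun m => ?_
      rw [mul_assoc (d m), ← Complex.exp_add]
      congr 2; push_cast; ring)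
  simp_rw [hI] at hs
  have h2 := hasSum_ite_eq n (2 * (Real.pi : ℂ) * d n)
  have := h2.unique (by simpa using hs)
  simpa [Real.pi_ne_zero] using this

lemma exists_parabolic_of_polar {r φ : ℝ} (hr : 0 < r) :
    ∃ ξ η : ℝ, 0 ≤ ξ ∧ r * Real.cos φ = (ξ ^ 2 - η ^ 2) / 2 ∧ r * Real.sin φ = ξ * η := by
  have key : ∃ ξ η : ℝ, r * Real.cos φ = (ξ ^ 2 - η ^ 2) / 2 ∧ r * Real.sin φ = ξ * η := by
    -- Parabolic coordinates are the square root `ξ + iη = √(2(x + iy))`, determined up to a common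
    -- sign, which is then used to arrange `0 ≤ ξ`.
    refine ⟨Real.sqrt (2 * r) * Real.cos (φ / 2), Real.sqrt (2 * r) * Real.sin (φ / 2), ?_, ?_⟩
    · have h : Real.cos φ = Real.cos (φ / 2) ^ 2 - Real.sin (φ / 2) ^ 2 := by
        rw [← Real.cos_two_mul']; congr 1; ring
      rw [h, mul_pow, mul_pow, Real.sq_sqrt (by positivity)]; ring
    · have h : Real.sin φ = 2 * Real.sin (φ / 2) * Real.cos (φ / 2) := by
        rw [← Real.sin_two_mul]; congr 1; ring
      rw [h, mul_mul_mul_comm, Real.mul_self_sqrt (by positivity)]; ring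
  obtain ⟨ξ, η, h1, h2⟩ := key
  rcases le_total 0 ξ with h | h
  · exact ⟨ξ, η, h, h1, h2⟩
  · exact ⟨-ξ, -η, by linarith, by rw [h1]; ring, by rw [h2]; ring⟩

/-- On the circle `r = 1/k` the difference of two expansions is a vanishing trigonometric series
whose coefficients are `w m - w' m` times a nonzero multiple of `J_{|m|}(1)`. -/
lemma IsPolarExpansion.eq {k : ℝ} (hk : 0 < k) {Ψ : ℝ → ℝ → ℂ} {w w' : ℤ → ℂ}
    (h : IsPolarExpansion k Ψ w) (h' : IsPolarExpansion k Ψ w') : w = w' := by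
  have key := eq_zero_of_hasSum_exp_eq_zero (d := fun m => (w m - w' m) *
      ((Real.sqrt k : ℂ) * (besselJ m.natAbs 1 : ℂ) / (Real.sqrt (2 * Real.pi) : ℂ))) (by
    intro φ hφ
    obtain ⟨ξ, η, hξ, h1, h2⟩ := exists_parabolic_of_polar (φ := φ) (inv_pos.2 hk)
    have := (h ξ η k⁻¹ φ hξ (inv_pos.2 hk) hφ h1 h2).sub (h' ξ η k⁻¹ φ hξ (inv_pos.2 hk) hφ h1 h2)
    rw [sub_self] at this
    refine this.congr_fun fun m => ?_
    rw [polarWave, mul_inv_cancel₀ hk.ne']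
    ring)
  ext m
  have hm := key m
  have h1 : (besselJ m.natAbs 1 : ℂ) ≠ 0 := by exact_mod_cast (besselJ_one_pos _).ne'
  have h2 : (Real.sqrt k : ℂ) ≠ 0 := by exact_mod_cast (Real.sqrt_pos.2 hk).ne'
  have h3 : (Real.sqrt (2 * Real.pi) : ℂ) ≠ 0 := by
    exact_mod_cast (Real.sqrt_pos.2 (by positivity)).ne'
  have := (mul_eq_zero.1 hm).resolve_right (div_ne_zero (mul_ne_zero h2 h1) h3)
  exact sub_eq_zero.1 this

/-! ### Binomial and Pochhammer identities, Kummer series, Beta moments of the weight. -/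

lemma sum_range_two_mul_add_one (f : ℕ → ℂ) (N : ℕ) :
    ∑ m ∈ Finset.range (2 * N + 1), f m =
      ∑ p ∈ Finset.range (N + 1), f (2 * p) + ∑ p ∈ Finset.range N, f (2 * p + 1) := by
  induction N with
  | zero => simp
  | succ N ih =>
    rw [show 2 * (N + 1) + 1 = (2 * N + 1) + 1 + 1 by ring, Finset.sum_range_succ,
      Finset.sum_range_succ, ih, Finset.sum_range_succ _ (N + 1), Finset.sum_range_succ _ N,
      Finset.sum_range_succ _ N]
    rw [show 2 * (N + 1) = 2 * N + 1 + 1 by ring]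
    ring

/-- Symmetrising leaves only even powers of both variables, so the sum runs over `p + q = N`, the
shape of a Cauchy product. -/
lemma add_pow_add_sub_pow (x y : ℂ) (N : ℕ) :
    (x + y) ^ (2 * N) + (x - y) ^ (2 * N) = 2 * ∑ q ∈ Finset.HasAntidiagonal.antidiagonal N,
      ((2 * N).choose (2 * q.1) : ℂ) * x ^ (2 * q.1) * y ^ (2 * q.2) := by
  rw [sub_eq_add_neg, add_pow, add_pow, sum_range_two_mul_add_one, sum_range_two_mul_add_one,
    Finset.Nat.sum_antidiagonal_eq_sum_range_succ
      (fun p q => ((2 * N).choose (2 * p) : ℂ) * x ^ (2 * p) * y ^ (2 * q))]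
  have h1 : ∑ p ∈ Finset.range N, x ^ (2 * p + 1) * (-y) ^ (2 * N - (2 * p + 1)) *
      ((2 * N).choose (2 * p + 1) : ℂ) = -∑ p ∈ Finset.range N, x ^ (2 * p + 1) *
        y ^ (2 * N - (2 * p + 1)) * ((2 * N).choose (2 * p + 1) : ℂ) := by
    rw [← Finset.sum_neg_distrib]
    refine Finset.sum_congr rfl fun p hp => ?_
    have := Finset.mem_range.1 hp
    have ho : Odd (2 * N - (2 * p + 1)) := ⟨N - p - 1, by omega⟩
    rw [ho.neg_pow]; ring
  have h2 : ∀ z : ℂ, (∀ n : ℕ, z ^ (2 * n) = y ^ (2 * n)) →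
      ∑ p ∈ Finset.range (N + 1), x ^ (2 * p) * z ^ (2 * N - 2 * p) *
      ((2 * N).choose (2 * p) : ℂ) = ∑ p ∈ Finset.range (N + 1),
        ((2 * N).choose (2 * p) : ℂ) * x ^ (2 * p) * y ^ (2 * (N - p)) := by
    intro z hz
    refine Finset.sum_congr rfl fun p _ => ?_
    rw [← Nat.mul_sub, hz]; ring
  rw [h1, h2 y (fun _ => rfl), h2 (-y) (fun n => (even_two_mul n).neg_pow y)]
  ring

/-- The surviving exponents `2p + 1` and `2q + 1` with `p + q = N` add up to `2(N + 1)`, whence the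
shift in the exponent. -/
lemma add_pow_sub_sub_pow (x y : ℂ) (N : ℕ) :
    (x + y) ^ (2 * (N + 1)) - (x - y) ^ (2 * (N + 1)) = 2 * ∑ q ∈ Finset.HasAntidiagonal.antidiagonal N,
      ((2 * (N + 1)).choose (2 * q.1 + 1) : ℂ) * x ^ (2 * q.1 + 1) * y ^ (2 * q.2 + 1) := by
  rw [sub_eq_add_neg x, add_pow, add_pow, sum_range_two_mul_add_one, sum_range_two_mul_add_one,
    Finset.Nat.sum_antidiagonal_eq_sum_range_succ
      (fun p q => ((2 * (N + 1)).choose (2 * p + 1) : ℂ) * x ^ (2 * p + 1) * y ^ (2 * q + 1))]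
  have h1 : ∀ z c : ℂ, (∀ n : ℕ, z ^ (2 * n + 1) = c * y ^ (2 * n + 1)) →
      ∑ p ∈ Finset.range (N + 1), x ^ (2 * p + 1) * z ^ (2 * (N + 1) - (2 * p + 1)) *
      ((2 * (N + 1)).choose (2 * p + 1) : ℂ) = c * ∑ p ∈ Finset.range (N + 1),
        ((2 * (N + 1)).choose (2 * p + 1) : ℂ) * x ^ (2 * p + 1) * y ^ (2 * (N - p) + 1) := by
    intro z c hz
    rw [Finset.mul_sum]
    refine Finset.sum_congr rfl fun p hp => ?_
    have := Finset.mem_range.1 hp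
    rw [show 2 * (N + 1) - (2 * p + 1) = 2 * (N - p) + 1 by omega, hz]; ring
  have h2 : ∑ p ∈ Finset.range (N + 1 + 1), x ^ (2 * p) * (-y) ^ (2 * (N + 1) - 2 * p) *
      ((2 * (N + 1)).choose (2 * p) : ℂ) = ∑ p ∈ Finset.range (N + 1 + 1), x ^ (2 * p) *
        y ^ (2 * (N + 1) - 2 * p) * ((2 * (N + 1)).choose (2 * p) : ℂ) := by
    refine Finset.sum_congr rfl fun p _ => ?_
    rw [← Nat.mul_sub, (even_two_mul _).neg_pow]
  rw [h2, h1 y 1 (fun _ => (one_mul _).symm),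
    h1 (-y) (-1) (fun n => by rw [(odd_two_mul_add_one n).neg_pow]; ring)]
  ring

lemma four_pow_mul_ascPochhammer_half (n : ℕ) :
    (4 : ℂ) ^ n * (n.factorial : ℂ) * (ascPochhammer ℂ n).eval (1 / 2) =
      ((2 * n).factorial : ℂ) := by
  induction n with
  | zero => simp
  | succ n ih =>
    rw [ascPochhammer_succ_eval, Nat.factorial_succ, show 2 * (n + 1) = 2 * n + 1 + 1 by ring,
      Nat.factorial_succ, Nat.factorial_succ]
    push_cast
    rw [← ih]; ring

lemma four_pow_mul_ascPochhammer_three_half (n : ℕ) :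
    (4 : ℂ) ^ n * (n.factorial : ℂ) * (ascPochhammer ℂ n).eval (3 / 2) =
      ((2 * n + 1).factorial : ℂ) := by
  induction n with
  | zero => simp
  | succ n ih =>
    rw [ascPochhammer_succ_eval, Nat.factorial_succ, show 2 * (n + 1) + 1 = 2 * n + 1 + 1 + 1 by ring,
      Nat.factorial_succ, Nat.factorial_succ]
    push_cast
    rw [← ih]; ring

lemma Gamma_add_natCast_eq {z : ℂ} (hz : 0 < z.re) (n : ℕ) :
    Complex.Gamma (z + n) = (ascPochhammer ℂ n).eval z * Complex.Gamma z := by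
  induction n with
  | zero => simp
  | succ n ih =>
    have hne : z + n ≠ 0 := fun h => by
      have := congrArg Complex.re h
      simp at this
      have h2 : (0 : ℝ) ≤ n := Nat.cast_nonneg n
      linarith
    rw [ascPochhammer_succ_eval, Nat.cast_succ, ← add_assoc, Complex.Gamma_add_one _ hne, ih]
    ring

lemma betaIntegral_add_nat {a b : ℂ} (ha : 0 < a.re) (hb : 0 < b.re) (p q : ℕ) :
    Complex.betaIntegral (a + p) (b + q) =
      Complex.Gamma a * Complex.Gamma b / Complex.Gamma (a + b) *
        ((ascPochhammer ℂ p).eval a * (ascPochhammer ℂ q).eval b /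
          (ascPochhammer ℂ (p + q)).eval (a + b)) := by
  have h1 : (0 : ℝ) ≤ p := Nat.cast_nonneg p
  have h2 : (0 : ℝ) ≤ q := Nat.cast_nonneg q
  rw [Complex.betaIntegral_eq_Gamma_mul_div _ _ (by simp; linarith) (by simp; linarith),
    Gamma_add_natCast_eq ha, Gamma_add_natCast_eq hb,
    show a + p + (b + q) = (a + b) + ((p + q : ℕ) : ℂ) by push_cast; ring,
    Gamma_add_natCast_eq (by simp; linarith)]
  ring

/-- Factor by factor, `|a + n| ≤ |a| + n ≤ (2|a| + 1)(b + n)`, because `b + n ≥ 1/2`. It lets the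
Kummer series be compared with an exponential series. -/
lemma norm_ascPochhammer_eval_le {a : ℂ} {b : ℝ} (hb : 1 / 2 ≤ b) (n : ℕ) :
    ‖(ascPochhammer ℂ n).eval a‖ ≤ (2 * ‖a‖ + 1) ^ n * ‖(ascPochhammer ℂ n).eval (b : ℂ)‖ := by
  induction n with
  | zero => simp
  | succ n ih =>
    rw [ascPochhammer_succ_eval, ascPochhammer_succ_eval, norm_mul, norm_mul, pow_succ,
      mul_mul_mul_comm]
    have h1 : (0 : ℝ) ≤ n := Nat.cast_nonneg n
    have h2 : ‖(b : ℂ) + n‖ = b + n := by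
      rw [show (b : ℂ) + n = ((b + n : ℝ) : ℂ) by push_cast; rfl, Complex.norm_real,
        Real.norm_of_nonneg (by linarith)]
    have h3 : ‖a + n‖ ≤ (2 * ‖a‖ + 1) * ‖(b : ℂ) + n‖ := by
      rw [h2]
      refine (norm_add_le _ _).trans ?_
      rw [Complex.norm_natCast]
      nlinarith [norm_nonneg a]
    gcongr

lemma ascPochhammer_eval_ofReal_ne_zero {b : ℝ} (hb : 0 < b) (n : ℕ) :
    (ascPochhammer ℂ n).eval (b : ℂ) ≠ 0 := by
  induction n with
  | zero => simp
  | succ n ih =>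
    rw [ascPochhammer_succ_eval]
    refine mul_ne_zero ih ?_
    have : (b : ℝ) + n ≠ 0 := by positivity
    exact_mod_cast this

lemma summable_norm_kummerF {a : ℂ} {b : ℝ} (hb : 1 / 2 ≤ b) (z : ℂ) :
    Summable fun n : ℕ => ‖(ascPochhammer ℂ n).eval a /
      ((ascPochhammer ℂ n).eval (b : ℂ) * (n.factorial : ℂ)) * z ^ n‖ := by
  refine Summable.of_nonneg_of_le (fun _ => norm_nonneg _) (fun n => ?_)
    (Real.summable_pow_div_factorial ((2 * ‖a‖ + 1) * ‖z‖))
  have h1 := norm_ascPochhammer_eval_le (a := a) hb n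
  have h2 : 0 < ‖(ascPochhammer ℂ n).eval (b : ℂ)‖ :=
    norm_pos_iff.2 (ascPochhammer_eval_ofReal_ne_zero (by linarith) n)
  have h3 : (0 : ℝ) < n.factorial := by exact_mod_cast Nat.factorial_pos n
  rw [norm_mul, norm_div, norm_mul, norm_pow, Complex.norm_natCast, mul_pow, div_mul_eq_mul_div,
    div_le_div_iff₀ (by positivity) h3]
  have h4 : 0 ≤ ‖z‖ ^ n * (n.factorial : ℝ) := by positivity
  nlinarith [mul_le_mul_of_nonneg_right h1 h4]

/-- Cauchy product of two Kummer series. -/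
lemma hasSum_kummerF_mul_kummerF {a a' : ℂ} {b : ℝ} (hb : 1 / 2 ≤ b) (z z' : ℂ) :
    HasSum (fun N : ℕ => ∑ q ∈ Finset.HasAntidiagonal.antidiagonal N,
      ((ascPochhammer ℂ q.1).eval a /
        ((ascPochhammer ℂ q.1).eval (b : ℂ) * (q.1.factorial : ℂ)) * z ^ q.1) *
      ((ascPochhammer ℂ q.2).eval a' /
        ((ascPochhammer ℂ q.2).eval (b : ℂ) * (q.2.factorial : ℂ)) * z' ^ q.2))
      (kummerF a b z * kummerF a' b z') := by
  have h1 := summable_norm_kummerF (a := a) hb z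
  have h2 := summable_norm_kummerF (a := a') hb z'
  rw [kummerF, kummerF, tsum_mul_tsum_eq_tsum_sum_antidiagonal_of_summable_norm h1 h2]
  exact (summable_norm_sum_mul_antidiagonal_of_summable_norm h1 h2).of_norm.hasSum

lemma image_sin_sq_half : (fun θ : ℝ => Real.sin (θ / 2) ^ 2) '' Ioo 0 Real.pi = Ioo 0 1 := by
  ext u
  constructor
  · rintro ⟨θ, ⟨h0, h1⟩, rfl⟩
    have hs : 0 < Real.sin (θ / 2) := Real.sin_pos_of_pos_of_lt_pi (by linarith) (by linarith)
    have hc : 0 < Real.cos (θ / 2) := Real.cos_pos_of_mem_Ioo ⟨by linarith, by linarith⟩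
    have := Real.sin_sq_add_cos_sq (θ / 2)
    constructor
    · show 0 < Real.sin (θ / 2) ^ 2
      positivity
    · show Real.sin (θ / 2) ^ 2 < 1
      nlinarith
  · rintro ⟨h0, h1⟩
    have hs : 0 < Real.sqrt u := Real.sqrt_pos.2 h0
    have hs1 : Real.sqrt u < 1 := by
      rw [Real.sqrt_lt' one_pos]; simpa using h1
    refine ⟨2 * Real.arcsin (Real.sqrt u), ⟨?_, ?_⟩, ?_⟩
    · have := Real.arcsin_pos.2 hs; linarith
    · have := Real.arcsin_lt_pi_div_two.2 hs1; linarith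
    · show Real.sin (2 * Real.arcsin (Real.sqrt u) / 2) ^ 2 = u
      rw [mul_div_cancel_left₀ _ two_ne_zero, Real.sin_arcsin (by linarith) hs1.le,
        Real.sq_sqrt h0.le]

lemma injOn_sin_sq_half : InjOn (fun θ : ℝ => Real.sin (θ / 2) ^ 2) (Ioo 0 Real.pi) := by
  intro a ha b hb hab
  have h1 : 0 < Real.sin (a / 2) :=
    Real.sin_pos_of_pos_of_lt_pi (by linarith [ha.1]) (by linarith [ha.1, ha.2])
  have h2 : 0 < Real.sin (b / 2) :=
    Real.sin_pos_of_pos_of_lt_pi (by linarith [hb.1]) (by linarith [hb.1, hb.2])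
  have h3 : Real.sin (a / 2) = Real.sin (b / 2) :=
    (pow_left_inj₀ h1.le h2.le two_ne_zero).1 hab
  have := Real.injOn_sin ⟨by linarith [ha.1, Real.pi_pos], by linarith [ha.2]⟩
    ⟨by linarith [hb.1, Real.pi_pos], by linarith [hb.2]⟩ h3
  linarith

/-- The moments of the angular weight are Beta integrals. -/
lemma integral_angularWeight_mul_sin_pow_mul_cos_pow (k β : ℝ) (j l : ℕ) :
    ∫ θ in (0 : ℝ)..Real.pi, angularWeight k β θ *
      (((Real.sin (θ / 2) : ℝ) : ℂ) ^ j * ((Real.cos (θ / 2) : ℝ) : ℂ) ^ l) =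
    ((Real.sqrt 2 : ℝ) : ℂ)⁻¹ * Complex.betaIntegral (1 / 4 + sepParam k β + (j / 2 : ℝ))
      (1 / 4 - sepParam k β + (l / 2 : ℝ)) := by
  -- With `u = sin²(θ/2)` one has `1 - cos θ = 2u`, `1 + cos θ = 2(1 - u)` and `du = sin(θ/2)
  -- cos(θ/2) dθ`. The powers of `2` have exponents adding to `-1/2`, which gives the factor `1/√2`.
  rw [Complex.betaIntegral, intervalIntegral.integral_of_le zero_le_one,
    intervalIntegral.integral_of_le Real.pi_pos.le, integral_Ioc_eq_integral_Ioo,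
    integral_Ioc_eq_integral_Ioo, ← image_sin_sq_half,
    integral_image_eq_integral_abs_deriv_smul measurableSet_Ioo
      (f' := fun θ => Real.sin (θ / 2) * Real.cos (θ / 2)) (fun θ _ => ?_) injOn_sin_sq_half,
    ← integral_const_mul]
  · refine setIntegral_congr_fun measurableSet_Ioo fun θ hθ => ?_
    obtain ⟨h0, h1⟩ := hθ
    have hs : 0 < Real.sin (θ / 2) := Real.sin_pos_of_pos_of_lt_pi (by linarith) (by linarith)
    have hc : 0 < Real.cos (θ / 2) := Real.cos_pos_of_mem_Ioo ⟨by linarith, by linarith⟩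
    have hcos : Real.cos θ = 2 * Real.cos (θ / 2) ^ 2 - 1 := by
      rw [← Real.cos_two_mul]; congr 1; ring
    have hsc := Real.sin_sq_add_cos_sq (θ / 2)
    have e1 : 1 + Real.cos θ = 2 * Real.cos (θ / 2) ^ 2 := by rw [hcos]; ring
    have e2 : 1 - Real.cos θ = 2 * Real.sin (θ / 2) ^ 2 := by rw [hcos]; linarith
    have e3 : (1 : ℂ) - ((Real.sin (θ / 2) ^ 2 : ℝ) : ℂ) = ((Real.cos (θ / 2) ^ 2 : ℝ) : ℂ) := by
      have := congrArg Complex.ofReal hsc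
      push_cast at this ⊢
      linear_combination -this
    simp only [angularWeight, e1, e2, e3, Complex.real_smul, abs_of_pos (mul_pos hs hc)]
    generalize Real.sin (θ / 2) = s at hs
    generalize Real.cos (θ / 2) = c at hc
    have hexp : ∀ x : ℝ, 0 < x → ∀ s : ℂ, (x : ℂ) ^ s = Complex.exp (Real.log x * s) := by
      intro x hx s
      rw [Complex.cpow_def_of_ne_zero (by exact_mod_cast hx.ne'), Complex.ofReal_log hx.le]
    have hpow : ∀ x : ℝ, 0 < x → ∀ n : ℕ, (x : ℂ) ^ n = Complex.exp (Real.log x * n) := by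
      intro x hx n; rw [← hexp x hx, Complex.cpow_natCast]
    have h2 : ((Real.sqrt 2 : ℝ) : ℂ)⁻¹ = Complex.exp (-(1 / 2) * Real.log 2) := by
      rw [Real.sqrt_eq_rpow, Real.rpow_def_of_pos two_pos, Complex.ofReal_exp, ← Complex.exp_neg]
      congr 1; push_cast; ring
    have h3 : ((s * c : ℝ) : ℂ) = Complex.exp (Real.log s + Real.log c) := by
      rw [← Complex.ofReal_add, ← Real.log_mul hs.ne' hc.ne', ← Complex.ofReal_exp,
        Real.exp_log (mul_pos hs hc)]
    rw [hexp _ (by positivity), hexp _ (by positivity), hexp _ (by positivity),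
      hexp _ (by positivity), hpow s hs, hpow c hc, h2, h3, Real.log_mul two_ne_zero (by positivity),
      Real.log_mul two_ne_zero (by positivity), Real.log_pow, Real.log_pow]
    simp only [← Complex.exp_add]
    congr 1
    push_cast
    ring
  · have h := ((Real.hasDerivAt_sin (θ / 2)).comp θ ((hasDerivAt_id θ).div_const 2)).pow 2
    refine (h.congr_deriv ?_).hasDerivWithinAt
    simp; ring

/-- By `(2n)! = 4^n n! (1/2)_n` the even binomial coefficient is a quotient of Pochhammer symbols.
Its numerator `(1/2)_{p+q}` cancels the denominator of the Beta integral, so that the dependence on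
`p` and `q` separates. -/
lemma choose_two_mul_mul (p q : ℕ) :
    ((2 * (p + q)).choose (2 * p) : ℂ) * ((ascPochhammer ℂ p).eval (1 / 2) * (p.factorial : ℂ)) *
      ((ascPochhammer ℂ q).eval (1 / 2) * (q.factorial : ℂ)) =
      (ascPochhammer ℂ (p + q)).eval (1 / 2) * ((p + q).factorial : ℂ) := by
  have h := Nat.add_choose_mul_factorial_mul_factorial (2 * q) (2 * p)
  rw [← mul_add, add_comm q p, mul_right_comm] at h
  have h' : ((2 * (p + q)).choose (2 * p) : ℂ) * ((2 * p).factorial : ℂ) *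
      ((2 * q).factorial : ℂ) = ((2 * (p + q)).factorial : ℂ) := by exact_mod_cast h
  rw [← four_pow_mul_ascPochhammer_half, ← four_pow_mul_ascPochhammer_half,
    ← four_pow_mul_ascPochhammer_half, pow_add] at h'
  have h4 : (4 : ℂ) ^ p * 4 ^ q ≠ 0 := mul_ne_zero (pow_ne_zero _ (by norm_num)) (pow_ne_zero _ (by norm_num))
  apply mul_left_cancel₀ h4
  linear_combination h'

/-- The odd counterpart, from `(2n+1)! = 4^n n! (3/2)_n`; the factor `2` comes from `(2(p+q+1))! =
2(p+q+1) · (2(p+q)+1)!`. -/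
lemma choose_two_mul_add_one_mul (p q : ℕ) :
    ((2 * (p + q + 1)).choose (2 * p + 1) : ℂ) *
      ((ascPochhammer ℂ p).eval (3 / 2) * (p.factorial : ℂ)) *
      ((ascPochhammer ℂ q).eval (3 / 2) * (q.factorial : ℂ)) =
      2 * ((ascPochhammer ℂ (p + q)).eval (3 / 2) * ((p + q + 1).factorial : ℂ)) := by
  have h := Nat.add_choose_mul_factorial_mul_factorial (2 * q + 1) (2 * p + 1)
  rw [mul_right_comm, show 2 * q + 1 + (2 * p + 1) = 2 * (p + q) + 1 + 1 by ring,
    Nat.factorial_succ (2 * (p + q) + 1),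
    show 2 * (p + q) + 1 + 1 = 2 * (p + q + 1) by ring] at h
  have h' : ((2 * (p + q + 1)).choose (2 * p + 1) : ℂ) * ((2 * p + 1).factorial : ℂ) *
      ((2 * q + 1).factorial : ℂ) = (2 * ((p : ℂ) + q + 1)) * ((2 * (p + q) + 1).factorial : ℂ) := by
    exact_mod_cast h
  rw [← four_pow_mul_ascPochhammer_three_half, ← four_pow_mul_ascPochhammer_three_half,
    ← four_pow_mul_ascPochhammer_three_half, pow_add] at h'
  have h4 : (4 : ℂ) ^ p * 4 ^ q ≠ 0 := mul_ne_zero (pow_ne_zero _ (by norm_num)) (pow_ne_zero _ (by norm_num))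
  apply mul_left_cancel₀ h4
  rw [Nat.factorial_succ]
  push_cast
  linear_combination h'

/-! ### Parabolic waves as weighted integrals of plane waves. -/

/-- Half the sum (for `σ = 1`) or difference (for `σ = -1`) of the two plane waves, in parabolic
coordinates and up to the phase `exp (-ikr)`. -/
noncomputable def planeKernel (k ξ η : ℝ) (σ : ℂ) (θ : ℝ) : ℂ :=
  (Complex.exp (Complex.I * k *
      ((ξ : ℂ) * (Real.sin (θ / 2) : ℝ) + (η : ℂ) * (Real.cos (θ / 2) : ℝ)) ^ 2) +
    σ * Complex.exp (Complex.I * k *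
      ((ξ : ℂ) * (Real.sin (θ / 2) : ℝ) - (η : ℂ) * (Real.cos (θ / 2) : ℝ)) ^ 2)) / 2

/-- The terms of the power series of `planeKernel`. -/
noncomputable def planeKernelTerm (k ξ η : ℝ) (σ : ℂ) (N : ℕ) (θ : ℝ) : ℂ :=
  (Complex.I * k) ^ N / (N.factorial : ℂ) *
    ((((ξ : ℂ) * (Real.sin (θ / 2) : ℝ) + (η : ℂ) * (Real.cos (θ / 2) : ℝ)) ^ (2 * N) +
    σ * ((ξ : ℂ) * (Real.sin (θ / 2) : ℝ) - (η : ℂ) * (Real.cos (θ / 2) : ℝ)) ^ (2 * N)) / 2)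

lemma hasSum_planeKernelTerm (k ξ η : ℝ) (σ : ℂ) (θ : ℝ) :
    HasSum (fun N => planeKernelTerm k ξ η σ N θ) (planeKernel k ξ η σ θ) := by
  have hexp : ∀ x : ℂ, HasSum (fun n : ℕ => x ^ n / (n.factorial : ℂ)) (Complex.exp x) := by
    intro x
    rw [Complex.exp_eq_exp_ℂ]
    exact NormedSpace.expSeries_div_hasSum_exp x
  unfold planeKernelTerm planeKernel
  refine (((hexp _).add ((hexp _).mul_left σ)).div_const 2).congr_fun fun N => ?_
  generalize (ξ : ℂ) * (Real.sin (θ / 2) : ℝ) + (η : ℂ) * (Real.cos (θ / 2) : ℝ) = X,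
    (ξ : ℂ) * (Real.sin (θ / 2) : ℝ) - (η : ℂ) * (Real.cos (θ / 2) : ℝ) = Y
  ring

lemma norm_planeKernelTerm_le {k : ℝ} (hk : 0 < k) (ξ η : ℝ) {σ : ℂ} (hσ : ‖σ‖ ≤ 1) (N : ℕ)
    (θ : ℝ) :
    ‖planeKernelTerm k ξ η σ N θ‖ ≤ (k * (|ξ| + |η|) ^ 2) ^ N / (N.factorial : ℝ) := by
  have hs : |Real.sin (θ / 2)| ≤ 1 := Real.abs_sin_le_one _
  have hc : |Real.cos (θ / 2)| ≤ 1 := Real.abs_cos_le_one _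
  have h0 : ∀ x y : ℂ, ‖x‖ ≤ |ξ| → ‖y‖ ≤ |η| → ‖x + y‖ ≤ |ξ| + |η| := fun x y hx hy =>
    (norm_add_le _ _).trans (add_le_add hx hy)
  have hx : ‖(ξ : ℂ) * (Real.sin (θ / 2) : ℝ)‖ ≤ |ξ| := by
    rw [norm_mul, Complex.norm_real, Complex.norm_real]
    exact mul_le_of_le_one_right (norm_nonneg _) hs
  have hy : ‖(η : ℂ) * (Real.cos (θ / 2) : ℝ)‖ ≤ |η| := by
    rw [norm_mul, Complex.norm_real, Complex.norm_real]
    exact mul_le_of_le_one_right (norm_nonneg _) hc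
  have h1 := h0 _ _ hx hy
  have h2 := h0 _ (-((η : ℂ) * (Real.cos (θ / 2) : ℝ))) hx (by rwa [norm_neg])
  rw [← sub_eq_add_neg] at h2
  rw [planeKernelTerm, norm_mul, norm_div, norm_pow, norm_mul, Complex.norm_I, one_mul,
    Complex.norm_real, Real.norm_of_nonneg hk.le, Complex.norm_natCast, norm_div, mul_pow,
    ← pow_mul, div_mul_eq_mul_div]
  gcongr
  rw [Complex.norm_two, div_le_iff₀ two_pos]
  refine (norm_add_le _ _).trans ?_
  rw [norm_mul, norm_pow, norm_pow]
  have h3 := pow_le_pow_left₀ (norm_nonneg _) h1 (2 * N)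
  have h4 := pow_le_pow_left₀ (norm_nonneg _) h2 (2 * N)
  have h5 := mul_le_mul hσ h4 (by positivity) zero_le_one
  linarith

lemma continuous_planeKernelTerm (k ξ η : ℝ) (σ : ℂ) (N : ℕ) :
    Continuous (planeKernelTerm k ξ η σ N) := by
  unfold planeKernelTerm; fun_prop

/-- Termwise integration is dominated by the weight, which is integrable on `(0, π)`, times the
exponential series of `k(|ξ| + |η|)²`. -/
lemma hasSum_integral_planeKernelTerm {k : ℝ} (hk : 0 < k) (β ξ η : ℝ) {σ : ℂ} (hσ : ‖σ‖ ≤ 1) :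
    HasSum (fun N => ∫ θ in (0 : ℝ)..Real.pi, angularWeight k β θ * planeKernelTerm k ξ η σ N θ)
      (∫ θ in (0 : ℝ)..Real.pi, angularWeight k β θ * planeKernel k ξ η σ θ) := by
  refine intervalIntegral.hasSum_integral_of_dominated_convergence
    (fun N θ => ‖angularWeight k β θ‖ * ((k * (|ξ| + |η|) ^ 2) ^ N / (N.factorial : ℝ)))
    (fun N => ?_) (fun N => ?_) ?_ ?_ ?_
  · have := intervalIntegrable_angularWeight_mul hk β (continuous_planeKernelTerm k ξ η σ N)
    rw [intervalIntegrable_iff] at this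
    exact this.aestronglyMeasurable
  · refine Eventually.of_forall fun θ _ => ?_
    rw [norm_mul]
    gcongr
    exact norm_planeKernelTerm_le hk ξ η hσ N θ
  · exact Eventually.of_forall fun θ _ => (Real.summable_pow_div_factorial _).mul_left _
  · simp_rw [tsum_mul_left]
    exact (intervalIntegrable_angularWeight hk β).norm.mul_const _
  · exact Eventually.of_forall fun θ _ => (hasSum_planeKernelTerm k ξ η σ θ).mul_left _

lemma integral_angularWeight_mul_sum {k : ℝ} (hk : 0 < k) (β ξ η : ℝ) (N : ℕ)
    (c : ℕ × ℕ → ℂ) (j l : ℕ × ℕ → ℕ) :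
    ∫ θ in (0 : ℝ)..Real.pi, angularWeight k β θ * ∑ q ∈ Finset.HasAntidiagonal.antidiagonal N,
      c q * ((ξ : ℂ) * (Real.sin (θ / 2) : ℝ)) ^ j q * ((η : ℂ) * (Real.cos (θ / 2) : ℝ)) ^ l q =
    ∑ q ∈ Finset.HasAntidiagonal.antidiagonal N, c q * (ξ : ℂ) ^ j q * (η : ℂ) ^ l q *
      (((Real.sqrt 2 : ℝ) : ℂ)⁻¹ * Complex.betaIntegral (1 / 4 + sepParam k β + (j q / 2 : ℝ))
      (1 / 4 - sepParam k β + (l q / 2 : ℝ))) := by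
  simp_rw [Finset.mul_sum]
  rw [intervalIntegral.integral_finsetSum fun q _ =>
    intervalIntegrable_angularWeight_mul hk β (by fun_prop)]
  refine Finset.sum_congr rfl fun q _ => ?_
  rw [← integral_angularWeight_mul_sin_pow_mul_cos_pow, ← intervalIntegral.integral_const_mul]
  congr 1; ext θ
  ring

lemma sepParam_eq (k β : ℝ) : sepParam k β = Complex.I * ((β / (2 * k) : ℝ) : ℂ) := by
  rw [sepParam]; push_cast; ring

lemma re_sepParam (k β : ℝ) : (sepParam k β).re = 0 := by
  rw [sepParam_eq, Complex.I_mul_re, Complex.ofReal_im, neg_zero]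

lemma conj_sepParam (k β : ℝ) : (starRingEnd ℂ) (sepParam k β) = -sepParam k β := by
  rw [sepParam_eq, map_mul, Complex.conj_I, Complex.conj_ofReal, neg_mul]

lemma Gamma_mul_Gamma_conj (k β x : ℝ) :
    Complex.Gamma (x + sepParam k β) * Complex.Gamma (x - sepParam k β) =
      ((‖Complex.Gamma (x + sepParam k β)‖ ^ 2 : ℝ) : ℂ) := by
  have : (x : ℂ) - sepParam k β = (starRingEnd ℂ) (x + sepParam k β) := by
    rw [map_add, conj_sepParam, Complex.conj_ofReal]; ring
  rw [this, Complex.Gamma_conj, Complex.mul_conj, Complex.normSq_eq_norm_sq]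

lemma Gamma_three_half : Complex.Gamma (3 / 2) = (Real.sqrt Real.pi : ℂ) / 2 := by
  have h := Complex.Gamma_add_one (1 / 2) (by norm_num)
  rw [Complex.Gamma_one_half_eq] at h
  rw [show (3 / 2 : ℂ) = 1 / 2 + 1 by norm_num, h, Real.sqrt_eq_rpow,
    Complex.ofReal_cpow Real.pi_pos.le]
  push_cast; ring

lemma Gamma_half : Complex.Gamma (1 / 2) = (Real.sqrt Real.pi : ℂ) := by
  rw [Complex.Gamma_one_half_eq, Real.sqrt_eq_rpow, Complex.ofReal_cpow Real.pi_pos.le]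
  push_cast; rfl

lemma ascPochhammer_half_ne_zero (n : ℕ) : (ascPochhammer ℂ n).eval (1 / 2 : ℂ) ≠ 0 := by
  have := ascPochhammer_eval_ofReal_ne_zero (b := 1 / 2) (by norm_num) n
  push_cast at this; exact this

lemma ascPochhammer_three_half_ne_zero (n : ℕ) : (ascPochhammer ℂ n).eval (3 / 2 : ℂ) ≠ 0 := by
  have := ascPochhammer_eval_ofReal_ne_zero (b := 3 / 2) (by norm_num) n
  push_cast at this; exact this

/-- The `N`-th integrated term is a sum over `p + q = N` of a binomial coefficient times a Beta
integral at `(1/4 + iβ/2k + p, 1/4 - iβ/2k + q)`. After `choose_two_mul_mul` it is the `N`-th term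
of the Cauchy product of the two Kummer series. -/
lemma integral_planeKernel_one {k : ℝ} (hk : 0 < k) (β ξ η : ℝ) :
    ∫ θ in (0 : ℝ)..Real.pi, angularWeight k β θ * planeKernel k ξ η 1 θ =
      ((‖Complex.Gamma (1 / 4 + sepParam k β)‖ ^ 2 : ℝ) : ℂ) /
        ((Real.sqrt 2 : ℂ) * (Real.sqrt Real.pi : ℂ)) *
      (kummerF (1 / 4 + sepParam k β) (1 / 2) (Complex.I * (k : ℂ) * (ξ : ℂ) ^ 2) *
        kummerF (1 / 4 - sepParam k β) (1 / 2) (Complex.I * (k : ℂ) * (η : ℂ) ^ 2)) := by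
  have h1 := hasSum_integral_planeKernelTerm hk β ξ η (σ := 1) (by simp)
  have h2 := (hasSum_kummerF_mul_kummerF (a := 1 / 4 + sepParam k β) (a' := 1 / 4 - sepParam k β)
    (b := 1 / 2) le_rfl (Complex.I * (k : ℂ) * (ξ : ℂ) ^ 2)
    (Complex.I * (k : ℂ) * (η : ℂ) ^ 2)).mul_left
    (((‖Complex.Gamma (1 / 4 + sepParam k β)‖ ^ 2 : ℝ) : ℂ) /
        ((Real.sqrt 2 : ℂ) * (Real.sqrt Real.pi : ℂ)))
  rw [show ((1 / 2 : ℝ) : ℂ) = 1 / 2 by push_cast; rfl] at h2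
  refine h1.unique (h2.congr_fun fun N => ?_)
  have hterm : ∀ θ, planeKernelTerm k ξ η 1 N θ = ∑ q ∈ Finset.HasAntidiagonal.antidiagonal N,
      ((Complex.I * k) ^ N / (N.factorial : ℂ) * ((2 * N).choose (2 * q.1) : ℂ)) *
      ((ξ : ℂ) * (Real.sin (θ / 2) : ℝ)) ^ (2 * q.1) *
      ((η : ℂ) * (Real.cos (θ / 2) : ℝ)) ^ (2 * q.2) := by
    intro θ
    rw [planeKernelTerm, one_mul, add_pow_add_sub_pow, mul_div_cancel_left₀ _ two_ne_zero,
      Finset.mul_sum]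
    exact Finset.sum_congr rfl fun q _ => by ring
  simp_rw [hterm]
  rw [integral_angularWeight_mul_sum hk β ξ η N _ (fun q => 2 * q.1) (fun q => 2 * q.2),
    Finset.mul_sum]
  refine Finset.sum_congr rfl fun q hq => ?_
  obtain ⟨p, q⟩ := q
  obtain rfl : p + q = N := Finset.HasAntidiagonal.mem_antidiagonal.1 hq
  have hc := choose_two_mul_mul p q
  have hΓ := Gamma_mul_Gamma_conj k β (1 / 4)
  rw [show ((1 / 4 : ℝ) : ℂ) = 1 / 4 by push_cast; rfl] at hΓ
  have e : ∀ n : ℕ, (((2 * n : ℕ) : ℝ) / 2 : ℝ) = (n : ℝ) := fun n => by push_cast; ring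
  simp only [e, Complex.ofReal_natCast]
  rw [betaIntegral_add_nat (by simp [re_sepParam]) (by simp [re_sepParam]), hΓ,
    show (1 / 4 + sepParam k β + (1 / 4 - sepParam k β) : ℂ) = 1 / 2 by ring, Gamma_half]
  have hp := ascPochhammer_half_ne_zero p
  have hq' := ascPochhammer_half_ne_zero q
  have hpq := ascPochhammer_half_ne_zero (p + q)
  have hfp : (p.factorial : ℂ) ≠ 0 := by exact_mod_cast Nat.factorial_ne_zero _
  have hfq : (q.factorial : ℂ) ≠ 0 := by exact_mod_cast Nat.factorial_ne_zero _
  have hfpq : ((p + q).factorial : ℂ) ≠ 0 := by exact_mod_cast Nat.factorial_ne_zero _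
  have hs : (Real.sqrt Real.pi : ℂ) ≠ 0 := by exact_mod_cast (Real.sqrt_pos.2 Real.pi_pos).ne'
  have hs2 : (Real.sqrt 2 : ℂ) ≠ 0 := by exact_mod_cast (Real.sqrt_pos.2 two_pos).ne'
  have hcc : ((2 * (p + q)).choose (2 * p) : ℂ) =
      (ascPochhammer ℂ (p + q)).eval (1 / 2) * ((p + q).factorial : ℂ) /
      (((ascPochhammer ℂ p).eval (1 / 2) * (p.factorial : ℂ)) *
      ((ascPochhammer ℂ q).eval (1 / 2) * (q.factorial : ℂ))) := by
    rw [← hc]; field_simp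
  rw [hcc]
  generalize (ascPochhammer ℂ p).eval (1 / 2 : ℂ) = A at *
  generalize (ascPochhammer ℂ q).eval (1 / 2 : ℂ) = B at *
  generalize (ascPochhammer ℂ (p + q)).eval (1 / 2 : ℂ) = D at *
  field_simp
  ring

/-- The half-integer powers shift the Beta parameters from `1/4` to `3/4`. The factor `4` is the `2`
of `choose_two_mul_add_one_mul` times the `2` from `1/Γ(3/2) = 2/√π`; `ik ξη` is the lowest odd term
factored out. -/
lemma integral_planeKernel_neg_one {k : ℝ} (hk : 0 < k) (β ξ η : ℝ) :
    ∫ θ in (0 : ℝ)..Real.pi, angularWeight k β θ * planeKernel k ξ η (-1) θ =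
      Complex.I * k * (ξ * η) * 4 * ((‖Complex.Gamma (3 / 4 + sepParam k β)‖ ^ 2 : ℝ) : ℂ) /
        ((Real.sqrt 2 : ℂ) * (Real.sqrt Real.pi : ℂ)) *
      (kummerF (3 / 4 + sepParam k β) (3 / 2) (Complex.I * (k : ℂ) * (ξ : ℂ) ^ 2) *
        kummerF (3 / 4 - sepParam k β) (3 / 2) (Complex.I * (k : ℂ) * (η : ℂ) ^ 2)) := by
  have h1 := hasSum_integral_planeKernelTerm hk β ξ η (σ := -1) (by simp)
  have h2 := (hasSum_kummerF_mul_kummerF (a := 3 / 4 + sepParam k β) (a' := 3 / 4 - sepParam k β)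
    (b := 3 / 2) (by norm_num) (Complex.I * (k : ℂ) * (ξ : ℂ) ^ 2)
    (Complex.I * (k : ℂ) * (η : ℂ) ^ 2)).mul_left
    (Complex.I * k * (ξ * η) * 4 * ((‖Complex.Gamma (3 / 4 + sepParam k β)‖ ^ 2 : ℝ) : ℂ) /
        ((Real.sqrt 2 : ℂ) * (Real.sqrt Real.pi : ℂ)))
  rw [show ((3 / 2 : ℝ) : ℂ) = 3 / 2 by push_cast; rfl] at h2
  -- The constant terms of the two exponentials cancel, so the series starts at `N = 1` and is
  -- shifted by one to match the Cauchy product.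
  have h0 : ∫ θ in (0 : ℝ)..Real.pi, angularWeight k β θ * planeKernelTerm k ξ η (-1) 0 θ = 0 := by
    simp [planeKernelTerm]
  rw [← hasSum_nat_add_iff' 1, Finset.sum_range_one, h0, sub_zero] at h1
  refine h1.unique (h2.congr_fun fun N => ?_)
  have hterm : ∀ θ, planeKernelTerm k ξ η (-1) (N + 1) θ =
      ∑ q ∈ Finset.HasAntidiagonal.antidiagonal N,
      ((Complex.I * k) ^ (N + 1) / ((N + 1).factorial : ℂ) *
        ((2 * (N + 1)).choose (2 * q.1 + 1) : ℂ)) *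
      ((ξ : ℂ) * (Real.sin (θ / 2) : ℝ)) ^ (2 * q.1 + 1) *
      ((η : ℂ) * (Real.cos (θ / 2) : ℝ)) ^ (2 * q.2 + 1) := by
    intro θ
    rw [planeKernelTerm, neg_one_mul, ← sub_eq_add_neg, add_pow_sub_sub_pow,
      mul_div_cancel_left₀ _ two_ne_zero, Finset.mul_sum]
    exact Finset.sum_congr rfl fun q _ => by ring
  simp_rw [hterm]
  rw [integral_angularWeight_mul_sum hk β ξ η N _ (fun q => 2 * q.1 + 1) (fun q => 2 * q.2 + 1),
    Finset.mul_sum]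
  refine Finset.sum_congr rfl fun q hq => ?_
  obtain ⟨p, q⟩ := q
  obtain rfl : p + q = N := Finset.HasAntidiagonal.mem_antidiagonal.1 hq
  have hc := choose_two_mul_add_one_mul p q
  have hΓ := Gamma_mul_Gamma_conj k β (3 / 4)
  rw [show ((3 / 4 : ℝ) : ℂ) = 3 / 4 by push_cast; rfl] at hΓ
  have e1 : ∀ n : ℕ, 1 / 4 + sepParam k β + ((((2 * n + 1 : ℕ) : ℝ) / 2 : ℝ) : ℂ) =
      3 / 4 + sepParam k β + n := fun n => by push_cast; ring
  have e2 : ∀ n : ℕ, 1 / 4 - sepParam k β + ((((2 * n + 1 : ℕ) : ℝ) / 2 : ℝ) : ℂ) =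
      3 / 4 - sepParam k β + n := fun n => by push_cast; ring
  simp only [e1, e2]
  rw [betaIntegral_add_nat (by simp [re_sepParam]) (by simp [re_sepParam]), hΓ,
    show (3 / 4 + sepParam k β + (3 / 4 - sepParam k β) : ℂ) = 3 / 2 by ring, Gamma_three_half]
  have hp := ascPochhammer_three_half_ne_zero p
  have hq' := ascPochhammer_three_half_ne_zero q
  have hpq := ascPochhammer_three_half_ne_zero (p + q)
  have hfp : (p.factorial : ℂ) ≠ 0 := by exact_mod_cast Nat.factorial_ne_zero _
  have hfq : (q.factorial : ℂ) ≠ 0 := by exact_mod_cast Nat.factorial_ne_zero _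
  have hfpq : ((p + q + 1).factorial : ℂ) ≠ 0 := by exact_mod_cast Nat.factorial_ne_zero _
  have hs : (Real.sqrt Real.pi : ℂ) ≠ 0 := by exact_mod_cast (Real.sqrt_pos.2 Real.pi_pos).ne'
  have hs2 : (Real.sqrt 2 : ℂ) ≠ 0 := by exact_mod_cast (Real.sqrt_pos.2 two_pos).ne'
  have hcc : ((2 * (p + q + 1)).choose (2 * p + 1) : ℂ) =
      2 * ((ascPochhammer ℂ (p + q)).eval (3 / 2) * ((p + q + 1).factorial : ℂ)) /
      (((ascPochhammer ℂ p).eval (3 / 2) * (p.factorial : ℂ)) *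
      ((ascPochhammer ℂ q).eval (3 / 2) * (q.factorial : ℂ))) := by
    rw [← hc]; field_simp
  rw [hcc]
  generalize (ascPochhammer ℂ p).eval (3 / 2 : ℂ) = A at *
  generalize (ascPochhammer ℂ q).eval (3 / 2 : ℂ) = B at *
  generalize (ascPochhammer ℂ (p + q)).eval (3 / 2 : ℂ) = D at *
  field_simp
  ring

lemma parabolicWavePlus_eq_integral {k : ℝ} (hk : 0 < k) (β ξ η : ℝ) :
    parabolicWavePlus k β ξ η = (1 / (2 * Real.pi * Real.sqrt Real.pi) : ℂ) *
      (Complex.exp (-(Complex.I * (k : ℂ) * (((ξ : ℂ) ^ 2 + (η : ℂ) ^ 2) / 2))) *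
      ∫ θ in (0 : ℝ)..Real.pi, angularWeight k β θ * planeKernel k ξ η 1 θ) := by
  rw [integral_planeKernel_one hk, parabolicWavePlus, normConstPlus]
  have hs : (Real.sqrt Real.pi : ℂ) ^ 2 = Real.pi := by
    rw [← Complex.ofReal_pow, Real.sq_sqrt Real.pi_pos.le]
  have hs0 : (Real.sqrt Real.pi : ℂ) ≠ 0 := by exact_mod_cast (Real.sqrt_pos.2 Real.pi_pos).ne'
  push_cast
  rw [← hs]
  field_simp

lemma parabolicWaveMinus_eq_integral {k : ℝ} (hk : 0 < k) (β ξ η : ℝ) :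
    parabolicWaveMinus k β ξ η = (1 / (2 * Real.pi * Real.sqrt Real.pi) : ℂ) *
      (Complex.exp (-(Complex.I * (k : ℂ) * (((ξ : ℂ) ^ 2 + (η : ℂ) ^ 2) / 2))) *
      (-Complex.I * ∫ θ in (0 : ℝ)..Real.pi, angularWeight k β θ * planeKernel k ξ η (-1) θ)) := by
  rw [integral_planeKernel_neg_one hk, parabolicWaveMinus, normConstMinus]
  have hs : (Real.sqrt Real.pi : ℂ) ^ 2 = Real.pi := by
    rw [← Complex.ofReal_pow, Real.sq_sqrt Real.pi_pos.le]
  have hs0 : (Real.sqrt Real.pi : ℂ) ≠ 0 := by exact_mod_cast (Real.sqrt_pos.2 Real.pi_pos).ne'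
  have hs2 : (Real.sqrt 2 : ℂ) ^ 2 = 2 := by
    rw [← Complex.ofReal_pow, Real.sq_sqrt two_pos.le]; simp
  have hs20 : (Real.sqrt 2 : ℂ) ≠ 0 := by exact_mod_cast (Real.sqrt_pos.2 two_pos).ne'
  push_cast
  rw [← hs]
  field_simp
  rw [hs2, Complex.I_sq]
  ring

/-! ### Existence of the polar expansions and the integral formulas. -/

/-- The integral `(-i)^{|m|} / (π √(2k)) ∫_0^π w(θ) Φ_m(θ) dθ` against the angular weight. -/
noncomputable def angularCoeff (k β : ℝ) (Φ : ℤ → ℝ → ℝ) (m : ℤ) : ℂ :=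
  (-Complex.I) ^ m.natAbs / (Real.pi * Real.sqrt (2 * k) : ℂ) *
    ∫ θ in (0 : ℝ)..Real.pi, angularWeight k β θ * (Φ m θ : ℂ)

/-- A Jacobi–Anger type expansion of `K θ` is integrated termwise against the weight, dominated by
the weight times `∑ |J_{|m|}(kr)|`. The prefactor is `√k / (π √(2k) √(2π)) = 1/(2π√π)`. -/
lemma hasSum_angularCoeff_mul_polarWave {k : ℝ} (hk : 0 < k) (β r φ : ℝ) {Φ : ℤ → ℝ → ℝ}
    (hc : ∀ m, Continuous (Φ m)) (hb : ∀ m θ, |Φ m θ| ≤ 1) {K : ℝ → ℂ}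
    (hK : ∀ θ, HasSum (fun m : ℤ => (-Complex.I) ^ m.natAbs * (besselJ m.natAbs (k * r) : ℂ) *
      Complex.exp (Complex.I * (m : ℂ) * (φ : ℂ)) * (Φ m θ : ℂ)) (K θ)) :
    HasSum (fun m : ℤ => angularCoeff k β Φ m * polarWave k m r φ)
      ((1 / (2 * Real.pi * Real.sqrt Real.pi) : ℂ) *
        ∫ θ in (0 : ℝ)..Real.pi, angularWeight k β θ * K θ) := by
  have hn : ∀ m : ℤ, ‖Complex.exp (Complex.I * (m : ℂ) * (φ : ℂ))‖ = 1 := fun m => by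
    rw [show Complex.I * (m : ℂ) * (φ : ℂ) = Complex.I * ((m * φ : ℝ) : ℂ) by push_cast; ring]
    exact norm_exp_I_mul_ofReal' _
  have h := intervalIntegral.hasSum_integral_of_dominated_convergence (μ := volume) (a := 0)
    (b := Real.pi) (F := fun (m : ℤ) θ => angularWeight k β θ *
      ((-Complex.I) ^ m.natAbs * (besselJ m.natAbs (k * r) : ℂ) *
      Complex.exp (Complex.I * (m : ℂ) * (φ : ℂ)) * (Φ m θ : ℂ)))
    (f := fun θ => angularWeight k β θ * K θ)
    (fun m θ => ‖angularWeight k β θ‖ * |besselJ m.natAbs (k * r)|)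
    (fun m => by
      have hcm := hc m
      have := intervalIntegrable_angularWeight_mul hk β
        (Φ := fun θ => (-Complex.I) ^ m.natAbs * (besselJ m.natAbs (k * r) : ℂ) *
          Complex.exp (Complex.I * (m : ℂ) * (φ : ℂ)) * (Φ m θ : ℂ)) (by fun_prop)
      rw [intervalIntegrable_iff] at this
      exact this.aestronglyMeasurable)
    (fun m => Eventually.of_forall fun θ _ => by
      rw [norm_mul, norm_mul, norm_mul, norm_mul, hn, norm_pow, norm_neg, Complex.norm_I, one_pow,
        one_mul, mul_one, Complex.norm_real, Complex.norm_real, Real.norm_eq_abs, Real.norm_eq_abs]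
      gcongr
      exact mul_le_of_le_one_right (abs_nonneg _) (hb m θ))
    (Eventually.of_forall fun θ _ => (summable_abs_besselJ _).mul_left _)
    (by
      simp_rw [tsum_mul_left]
      exact (intervalIntegrable_angularWeight hk β).norm.mul_const _)
    (Eventually.of_forall fun θ _ => (hK θ).mul_left _)
  refine (h.mul_left (1 / (2 * Real.pi * Real.sqrt Real.pi) : ℂ)).congr_fun fun m => ?_
  have hI : ∫ θ in (0 : ℝ)..Real.pi, angularWeight k β θ *
      ((-Complex.I) ^ m.natAbs * (besselJ m.natAbs (k * r) : ℂ) *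
      Complex.exp (Complex.I * (m : ℂ) * (φ : ℂ)) * (Φ m θ : ℂ)) =
      ((-Complex.I) ^ m.natAbs * (besselJ m.natAbs (k * r) : ℂ) *
      Complex.exp (Complex.I * (m : ℂ) * (φ : ℂ))) *
      ∫ θ in (0 : ℝ)..Real.pi, angularWeight k β θ * (Φ m θ : ℂ) := by
    rw [← intervalIntegral.integral_const_mul]
    congr 1; ext θ; ring
  rw [hI, angularCoeff, polarWave]
  have h2 : (Real.sqrt 2 : ℂ) ^ 2 = 2 := by
    rw [← Complex.ofReal_pow, Real.sq_sqrt two_pos.le]; simp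
  have h20 : (Real.sqrt 2 : ℂ) ≠ 0 := by exact_mod_cast (Real.sqrt_pos.2 two_pos).ne'
  have hk0 : (Real.sqrt k : ℂ) ≠ 0 := by exact_mod_cast (Real.sqrt_pos.2 hk).ne'
  have hπ0 : (Real.sqrt Real.pi : ℂ) ≠ 0 := by exact_mod_cast (Real.sqrt_pos.2 Real.pi_pos).ne'
  have hπ : (Real.pi : ℂ) ≠ 0 := by exact_mod_cast Real.pi_ne_zero
  rw [Real.sqrt_mul two_pos.le, Real.sqrt_mul two_pos.le]
  push_cast
  field_simp
  rw [h2]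
  ring

lemma exp_mul_cos_eq (m : ℤ) (φ θ : ℝ) :
    Complex.exp (Complex.I * (m : ℂ) * (φ : ℂ)) * (Real.cos (m * θ) : ℂ) =
      (Complex.exp (Complex.I * (m : ℂ) * ((φ + θ : ℝ) : ℂ)) +
        Complex.exp (Complex.I * (m : ℂ) * ((φ - θ : ℝ) : ℂ))) / 2 := by
  push_cast
  rw [Complex.cos, mul_add, mul_sub, sub_eq_add_neg (Complex.I * (m : ℂ) * (φ : ℂ)),
    Complex.exp_add, Complex.exp_add,
    show (m : ℂ) * θ * Complex.I = Complex.I * m * θ by ring,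
    show -((m : ℂ) * θ) * Complex.I = -(Complex.I * m * θ) by ring]
  ring

lemma exp_mul_sin_eq (m : ℤ) (φ θ : ℝ) :
    Complex.exp (Complex.I * (m : ℂ) * (φ : ℂ)) * (Real.sin (m * θ) : ℂ) =
      -Complex.I * ((Complex.exp (Complex.I * (m : ℂ) * ((φ + θ : ℝ) : ℂ)) -
        Complex.exp (Complex.I * (m : ℂ) * ((φ - θ : ℝ) : ℂ))) / 2) := by
  push_cast
  rw [Complex.sin, mul_add, mul_sub, sub_eq_add_neg (Complex.I * (m : ℂ) * (φ : ℂ)),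
    Complex.exp_add, Complex.exp_add,
    show (m : ℂ) * θ * Complex.I = Complex.I * m * θ by ring,
    show -((m : ℂ) * θ) * Complex.I = -(Complex.I * m * θ) by ring]
  ring

/-- Half-angle formulas for `cos θ` and `sin θ` make `r cos(φ + θ)` a quadratic form in `sin(θ/2)`,
`cos(θ/2)`; subtracted from `(ξ² + η²)/2 = r` it is a perfect square. This is what separates the
plane wave in parabolic coordinates. -/
lemma planeWave_parabolic {ξ η r φ : ℝ}
    (h1 : r * Real.cos φ = (ξ ^ 2 - η ^ 2) / 2) (h2 : r * Real.sin φ = ξ * η) (θ : ℝ) :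
    r * Real.cos (φ + θ) = (ξ ^ 2 + η ^ 2) / 2 -
      (ξ * Real.sin (θ / 2) + η * Real.cos (θ / 2)) ^ 2 := by
  have hc : Real.cos θ = Real.cos (θ / 2) ^ 2 - Real.sin (θ / 2) ^ 2 := by
    rw [← Real.cos_two_mul']; congr 1; ring
  have hs : Real.sin θ = 2 * Real.sin (θ / 2) * Real.cos (θ / 2) := by
    rw [← Real.sin_two_mul]; congr 1; ring
  have h := Real.sin_sq_add_cos_sq (θ / 2)
  rw [Real.cos_add, mul_sub, ← mul_assoc, ← mul_assoc, h1, h2, hc, hs]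
  linear_combination ((ξ ^ 2 + η ^ 2) / 2) * h

lemma exp_planeWave_parabolic {ξ η r φ : ℝ} (k : ℝ)
    (h1 : r * Real.cos φ = (ξ ^ 2 - η ^ 2) / 2) (h2 : r * Real.sin φ = ξ * η) (θ : ℝ) :
    Complex.exp (-(Complex.I * ((k * r * Real.cos (φ + θ) : ℝ) : ℂ))) =
      Complex.exp (-(Complex.I * (k : ℂ) * (((ξ : ℂ) ^ 2 + (η : ℂ) ^ 2) / 2))) *
      Complex.exp (Complex.I * k *
        ((ξ : ℂ) * (Real.sin (θ / 2) : ℝ) + (η : ℂ) * (Real.cos (θ / 2) : ℝ)) ^ 2) := by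
  rw [mul_assoc k, planeWave_parabolic h1 h2, ← Complex.exp_add]
  congr 1
  push_cast
  ring

/-- Averaging Jacobi–Anger over `φ + θ` and `φ - θ` turns `e^{imφ}` into `e^{imφ} cos(mθ)`, while
the averaged plane wave is the phase times `planeKernel` with `σ = 1`. -/
lemma isPolarExpansion_plus {k : ℝ} (hk : 0 < k) (β : ℝ) :
    IsPolarExpansion k (parabolicWavePlus k β)
      (angularCoeff k β fun m θ => Real.cos (m * θ)) := by
  intro ξ η r φ _ _ _ h1 h2
  rw [parabolicWavePlus_eq_integral hk, ← intervalIntegral.integral_const_mul]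
  have hJ := fun θ : ℝ => (((hasSum_jacobiAnger (k * r) (φ + θ)).add
    (hasSum_jacobiAnger (k * r) (φ - θ))).div_const 2)
  convert! hasSum_angularCoeff_mul_polarWave hk β r φ (Φ := fun m θ => Real.cos (m * θ))
    (K := fun θ => (Complex.exp (-(Complex.I * ((k * r * Real.cos (φ + θ) : ℝ) : ℂ))) +
      Complex.exp (-(Complex.I * ((k * r * Real.cos (φ - θ) : ℝ) : ℂ)))) / 2)
    (fun m => by fun_prop) (fun m θ => Real.abs_cos_le_one _) (fun θ => ?_) using 4 with θ
  · rw [sub_eq_add_neg φ, exp_planeWave_parabolic k h1 h2, exp_planeWave_parabolic k h1 h2,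
      planeKernel, neg_div, Real.sin_neg, Real.cos_neg]
    push_cast
    -- Replacing `θ` by `-θ` flips only the sign of `sin(θ/2)`, and the square of `-ξ sin(θ/2) + η
    -- cos(θ/2)` is the second square in `planeKernel`.
    rw [← neg_sq (_ * -_ + _)]
    ring_nf
  · refine (hJ θ).congr_fun fun m => ?_
    rw [mul_assoc, exp_mul_cos_eq]
    ring

/-- Half the difference gives `i sin(mθ) e^{imφ}`; the factor `-i` carried along removes the `i`. -/
lemma isPolarExpansion_minus {k : ℝ} (hk : 0 < k) (β : ℝ) :
    IsPolarExpansion k (parabolicWaveMinus k β)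
      (angularCoeff k β fun m θ => Real.sin (m * θ)) := by
  intro ξ η r φ _ _ _ h1 h2
  rw [parabolicWaveMinus_eq_integral hk, ← mul_assoc (Complex.exp _),
    ← intervalIntegral.integral_const_mul]
  have hJ := fun θ : ℝ => (((hasSum_jacobiAnger (k * r) (φ + θ)).sub
    (hasSum_jacobiAnger (k * r) (φ - θ))).div_const 2).mul_left (-Complex.I)
  convert! hasSum_angularCoeff_mul_polarWave hk β r φ (Φ := fun m θ => Real.sin (m * θ))
    (K := fun θ => -Complex.I * ((Complex.exp (-(Complex.I * ((k * r * Real.cos (φ + θ) : ℝ) : ℂ))) -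
      Complex.exp (-(Complex.I * ((k * r * Real.cos (φ - θ) : ℝ) : ℂ)))) / 2))
    (fun m => by fun_prop) (fun m θ => Real.abs_sin_le_one _) (fun θ => ?_) using 4 with θ
  · rw [sub_eq_add_neg φ, exp_planeWave_parabolic k h1 h2, exp_planeWave_parabolic k h1 h2,
      planeKernel, neg_div, Real.sin_neg, Real.cos_neg]
    push_cast
    rw [← neg_sq (_ * -_ + _)]
    ring_nf
  · refine (hJ θ).congr_fun fun m => ?_
    rw [mul_assoc, exp_mul_sin_eq]
    ring

lemma existsUnique_isPolarExpansion_plus {k : ℝ} (hk : 0 < k) (β : ℝ) :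
    ∃! w : ℤ → ℂ, IsPolarExpansion k (parabolicWavePlus k β) w :=
  ⟨_, isPolarExpansion_plus hk β, fun _ h => h.eq hk (isPolarExpansion_plus hk β)⟩

lemma existsUnique_isPolarExpansion_minus {k : ℝ} (hk : 0 < k) (β : ℝ) :
    ∃! w : ℤ → ℂ, IsPolarExpansion k (parabolicWaveMinus k β) w :=
  ⟨_, isPolarExpansion_minus hk β, fun _ h => h.eq hk (isPolarExpansion_minus hk β)⟩

/-- Existence makes the epsilon choice an actual expansion, and uniqueness identifies it with the
integral formula. -/
lemma coeffPlus_eq {k : ℝ} (hk : 0 < k) (β : ℝ) :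
    coeffPlus k β = angularCoeff k β fun m θ => Real.cos (m * θ) :=
  (Classical.epsilon_spec (existsUnique_isPolarExpansion_plus hk β).exists).eq hk
    (isPolarExpansion_plus hk β)

lemma coeffMinus_eq {k : ℝ} (hk : 0 < k) (β : ℝ) :
    coeffMinus k β = angularCoeff k β fun m θ => Real.sin (m * θ) :=
  (Classical.epsilon_spec (existsUnique_isPolarExpansion_minus hk β).exists).eq hk
    (isPolarExpansion_minus hk β)

/-! ### The modes on the line and the decay of their Fourier transforms. -/

/-- The functions `(cosh v)^{-1/2} e^{imθ(v)}`. -/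
noncomputable def angularMode (m : ℤ) (v : ℝ) : ℂ :=
  (sechSqrt v : ℂ) * Complex.exp (Complex.I * ((m * gdAngle v : ℝ) : ℂ))

lemma continuous_angularMode (m : ℤ) : Continuous (angularMode m) := by
  have := continuous_sechSqrt
  have := continuous_gdAngle
  unfold angularMode; fun_prop

lemma norm_angularMode (m : ℤ) (v : ℝ) : ‖angularMode m v‖ = sechSqrt v := by
  rw [angularMode, norm_mul, norm_exp_I_mul_ofReal', mul_one, Complex.norm_real,
    Real.norm_of_nonneg (sechSqrt_pos v).le]

lemma integrable_angularMode (m : ℤ) : Integrable (angularMode m) :=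
  integrable_sechSqrt.mono' (continuous_angularMode m).aestronglyMeasurable
    (Eventually.of_forall fun v => (norm_angularMode m v).le)

lemma angularMode_add_one (m : ℤ) (v : ℝ) :
    angularMode (m + 1) v = angularMode m v *
      ((Real.cos (gdAngle v) : ℂ) + Real.sin (gdAngle v) * Complex.I) := by
  rw [angularMode, angularMode, Complex.ofReal_cos, Complex.ofReal_sin, ← Complex.exp_mul_I,
    mul_assoc, ← Complex.exp_add]
  congr 2; push_cast; ring

lemma angularMode_sub_one (m : ℤ) (v : ℝ) :
    angularMode (m - 1) v = angularMode m v *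
      ((Real.cos (gdAngle v) : ℂ) - Real.sin (gdAngle v) * Complex.I) := by
  have h : (Real.cos (gdAngle v) : ℂ) - Real.sin (gdAngle v) * Complex.I =
      Complex.exp (-(gdAngle v : ℂ) * Complex.I) := by
    rw [Complex.exp_mul_I, Complex.cos_neg, Complex.sin_neg]; push_cast; ring
  rw [h, angularMode, angularMode, mul_assoc, ← Complex.exp_add]
  congr 2; push_cast; ring

/-- The logarithmic derivative `-tanh v / 2 + im sech v` equals `cos θ / 2 + im sin θ`, a
combination of `e^{iθ}` and `e^{-iθ}`, and these shift `m` by one. -/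
lemma hasDerivAt_angularMode (m : ℤ) (v : ℝ) :
    HasDerivAt (angularMode m) ((1 / 4 + m / 2) * angularMode (m + 1) v +
      (1 / 4 - m / 2) * angularMode (m - 1) v) v := by
  have h1 := (hasDerivAt_sechSqrt v).ofReal_comp
  have h2 := ((((hasDerivAt_gdAngle v).const_mul (m : ℝ)).ofReal_comp).const_mul
    Complex.I).cexp
  refine (h1.mul h2).congr_deriv ?_
  rw [angularMode_add_one, angularMode_sub_one, cos_gdAngle, sin_gdAngle, angularMode]
  push_cast
  ring

lemma integrable_of_norm_mul_sq_le {F : ℝ → ℂ} (hF : Continuous F) {A B : ℝ}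
    (h0 : ∀ w, ‖F w‖ ≤ A) (h2 : ∀ w, w ^ 2 * ‖F w‖ ≤ B) : Integrable F := by
  refine (integrable_inv_one_add_sq.const_mul (A + B)).mono' hF.aestronglyMeasurable
    (Eventually.of_forall fun w => ?_)
  rw [← div_eq_mul_inv, le_div_iff₀ (by positivity)]
  have := h0 w; have := h2 w
  linarith

lemma norm_fourier_le {f : ℝ → ℂ} (w : ℝ) : ‖𝓕 f w‖ ≤ ∫ v, ‖f v‖ := by
  rw [Real.fourier_eq]
  refine (norm_integral_le_integral_norm _).trans (le_of_eq ?_)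
  simp_rw [Circle.norm_smul]

lemma fourier_add_mul {f g : ℝ → ℂ} (hf : Integrable f) (hg : Integrable g) (a b : ℂ) (w : ℝ) :
    𝓕 (fun v => a * f v + b * g v) w = a * 𝓕 f w + b * 𝓕 g w := by
  have hi : ∀ {u : ℝ → ℂ}, Integrable u →
      Integrable fun v : ℝ => Complex.exp (((-2 * Real.pi * v * w : ℝ) : ℂ) * Complex.I) * u v :=
    fun {u} hu => hu.bdd_mul (c := 1) (by fun_prop : Continuous _).aestronglyMeasurable
      (Eventually.of_forall fun v => by rw [Complex.norm_exp_ofReal_mul_I])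
  simp only [Real.fourier_real_eq_integral_exp_smul, smul_eq_mul]
  rw [← integral_const_mul, ← integral_const_mul,
    ← integral_add ((hi hf).const_mul a) ((hi hg).const_mul b)]
  congr 1; ext v; ring

/-- Each use trades a factor `w` for neighbouring modes, whose transforms are bounded; one use gives
decay `1/|w|`. -/
lemma fourier_angularMode_recurrence (m : ℤ) (w : ℝ) :
    (2 * Real.pi * Complex.I * w) * 𝓕 (angularMode m) w =
      (1 / 4 + m / 2) * 𝓕 (angularMode (m + 1)) w +
        (1 / 4 - m / 2) * 𝓕 (angularMode (m - 1)) w := by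
  have hd : deriv (angularMode m) = fun v => (1 / 4 + m / 2) * angularMode (m + 1) v +
      (1 / 4 - m / 2) * angularMode (m - 1) v := by
    ext v; exact (hasDerivAt_angularMode m v).deriv
  have h := Real.fourier_deriv (integrable_angularMode m)
    (fun v => (hasDerivAt_angularMode m v).differentiableAt) (by
      rw [hd]
      exact ((integrable_angularMode _).const_mul _).add ((integrable_angularMode _).const_mul _))
  rw [hd] at h
  have h2 := congrFun h w
  rw [fourier_add_mul (integrable_angularMode _) (integrable_angularMode _), smul_eq_mul] at h2
  rw [h2]

lemma continuous_fourier_of_integrable {f : ℝ → ℂ} (hf : Integrable f) : Continuous (𝓕 f) :=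
  VectorFourier.fourierIntegral_continuous Real.continuous_fourierChar
    (by exact continuous_inner) hf

lemma exists_abs_mul_norm_fourier_angularMode_le (m : ℤ) :
    ∃ B, ∀ w : ℝ, |w| * ‖𝓕 (angularMode m) w‖ ≤ B := by
  refine ⟨‖(1 / 4 + m / 2 : ℂ)‖ * (∫ v, ‖angularMode (m + 1) v‖) +
    ‖(1 / 4 - m / 2 : ℂ)‖ * (∫ v, ‖angularMode (m - 1) v‖), fun w => ?_⟩
  have h := congrArg norm (fourier_angularMode_recurrence m w)
  rw [norm_mul, norm_mul, norm_mul, norm_mul, Complex.norm_I, Complex.norm_two, Complex.norm_real,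
    Complex.norm_real, Real.norm_of_nonneg Real.pi_pos.le, Real.norm_eq_abs, mul_one] at h
  have h2 : |w| * ‖𝓕 (angularMode m) w‖ ≤ 2 * Real.pi * |w| * ‖𝓕 (angularMode m) w‖ := by
    rw [mul_assoc]
    exact le_mul_of_one_le_left (by positivity) (by linarith [Real.pi_gt_three])
  refine h2.trans (h.le.trans ((norm_add_le _ _).trans ?_))
  rw [norm_mul, norm_mul]
  gcongr <;> exact norm_fourier_le w

/-- The recurrence at `m` combined with the `1/|w|` bounds at `m + 1` and `m - 1` gives decay
`1/w²`. -/
lemma integrable_fourier_angularMode (m : ℤ) : Integrable (𝓕 (angularMode m)) := by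
  obtain ⟨B1, h1⟩ := exists_abs_mul_norm_fourier_angularMode_le (m + 1)
  obtain ⟨B2, h2⟩ := exists_abs_mul_norm_fourier_angularMode_le (m - 1)
  refine integrable_of_norm_mul_sq_le (continuous_fourier_of_integrable (integrable_angularMode m))
    (fun w => norm_fourier_le w)
    (B := ‖(1 / 4 + m / 2 : ℂ)‖ * B1 + ‖(1 / 4 - m / 2 : ℂ)‖ * B2) fun w => ?_
  have h := congrArg norm (fourier_angularMode_recurrence m w)
  rw [norm_mul, norm_mul, norm_mul, norm_mul, Complex.norm_I, Complex.norm_two, Complex.norm_real,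
    Complex.norm_real, Real.norm_of_nonneg Real.pi_pos.le, Real.norm_eq_abs, mul_one] at h
  have h3 : |w| * ‖𝓕 (angularMode m) w‖ ≤ 2 * Real.pi * |w| * ‖𝓕 (angularMode m) w‖ := by
    rw [mul_assoc]
    exact le_mul_of_one_le_left (by positivity) (by linarith [Real.pi_gt_three])
  have h4 := h3.trans (h.le.trans (norm_add_le _ _))
  rw [norm_mul, norm_mul] at h4
  calc w ^ 2 * ‖𝓕 (angularMode m) w‖ = |w| * (|w| * ‖𝓕 (angularMode m) w‖) := by
        rw [← sq_abs]; ring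
    _ ≤ |w| * (‖(1 / 4 + m / 2 : ℂ)‖ * ‖𝓕 (angularMode (m + 1)) w‖ +
          ‖(1 / 4 - m / 2 : ℂ)‖ * ‖𝓕 (angularMode (m - 1)) w‖) := by gcongr
    _ = ‖(1 / 4 + m / 2 : ℂ)‖ * (|w| * ‖𝓕 (angularMode (m + 1)) w‖) +
          ‖(1 / 4 - m / 2 : ℂ)‖ * (|w| * ‖𝓕 (angularMode (m - 1)) w‖) := by ring
    _ ≤ _ := by
      gcongr
      · exact h1 w
      · exact h2 w

/-! ### Plancherel and orthogonality in `β`. -/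

/-- Plancherel's identity for continuous integrable functions with integrable transforms. -/
lemma integral_fourierInv_mul_conj {f g : ℝ → ℂ} (hf : Integrable f)
    (hgc : Continuous g) (hg : Integrable g) (hg' : Integrable (𝓕⁻ g)) :
    ∫ w, 𝓕⁻ f w * star (𝓕⁻ g w) = ∫ v, f v * star (g v) := by
  -- Only `g` is reconstructed by Fourier inversion; substituting the inversion integral for `star
  -- (g v)` reduces the identity to Fubini.
  have hinv : ∀ v, 𝓕 (𝓕⁻ g) v = g v := fun v => by
    have h : 𝓕 g = fun w => 𝓕⁻ g (-w) := by
      ext w; rw [Real.fourierInv_eq_fourier_neg, neg_neg]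
    exact hg.fourier_fourierInv_eq (by rw [h]; exact hg'.comp_neg) hgc.continuousAt
  have hinv' : ∀ v, ∫ w, Complex.exp (((2 * Real.pi * (w * v) : ℝ) : ℂ) * Complex.I) *
      star (𝓕⁻ g w) = star (g v) := by
    intro v
    rw [← hinv v, Real.fourier_real_eq_integral_exp_smul]
    have : ∀ u : ℝ → ℂ, star (∫ w, u w) = ∫ w, star (u w) := fun u => integral_conj.symm
    rw [this]
    congr 1; ext w
    rw [smul_eq_mul, star_mul', Complex.star_def, ← Complex.exp_conj, map_mul, Complex.conj_I,
      Complex.conj_ofReal]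
    congr 2
    push_cast; ring
  simp_rw [← hinv']
  simp_rw [Real.fourierInv_eq' f, ← integral_mul_const, ← integral_const_mul]
  rw [integral_integral_swap]
  · congr 1; ext v; congr 1; ext w
    simp only [smul_eq_mul, RCLike.inner_apply, conj_trivial]
    ring
  · have hs : Integrable fun w => star (𝓕⁻ g w) := by
      refine hg'.mono (continuous_star.comp_aestronglyMeasurable hg'.1) (by simp)
    have := (hs.mul_prod hf)
    have h2 := this.bdd_mul (c := 1) (f := fun p : ℝ × ℝ =>
      Complex.exp (((2 * Real.pi * (inner ℝ p.2 p.1) : ℝ) : ℂ) * Complex.I))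
      (by fun_prop : Continuous _).aestronglyMeasurable
      (Eventually.of_forall fun v => by rw [Complex.norm_exp_ofReal_mul_I])
    refine h2.congr (Eventually.of_forall fun p => ?_)
    simp only [Function.uncurry, smul_eq_mul]
    ring

/-- A family `Φ_m(θ)` of the form `a e^{imθ} + b e^{-imθ}`. -/
def IsModeCombination (a b : ℂ) (Φ : ℤ → ℝ → ℝ) : Prop :=
  ∀ (m : ℤ) (θ : ℝ), (Φ m θ : ℂ) = a * Complex.exp (Complex.I * ((m * θ : ℝ) : ℂ)) +
    b * Complex.exp (Complex.I * (((-m : ℤ) * θ : ℝ) : ℂ))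

lemma isModeCombination_cos :
    IsModeCombination (1 / 2) (1 / 2) fun m θ => Real.cos (m * θ) := by
  intro m θ
  push_cast
  rw [Complex.cos, show (m : ℂ) * θ * Complex.I = Complex.I * (m * θ) by ring,
    show -((m : ℂ) * θ) * Complex.I = Complex.I * (-m * θ) by ring]
  ring

lemma isModeCombination_sin :
    IsModeCombination (-Complex.I / 2) (Complex.I / 2) fun m θ => Real.sin (m * θ) := by
  intro m θ
  push_cast
  rw [Complex.sin, show (m : ℂ) * θ * Complex.I = Complex.I * (m * θ) by ring,
    show -((m : ℂ) * θ) * Complex.I = Complex.I * (-m * θ) by ring]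
  ring

/-- The amplitude `(cosh v)^{-1/2} Φ(θ(v))`. -/
noncomputable def modeAmplitude (Φ : ℝ → ℝ) (v : ℝ) : ℂ :=
  (sechSqrt v : ℂ) * (Φ (gdAngle v) : ℂ)

section
variable {a b : ℂ} {Φ : ℤ → ℝ → ℝ}

lemma IsModeCombination.modeAmplitude_eq (h : IsModeCombination a b Φ) (m : ℤ) :
    modeAmplitude (Φ m) = fun v => a * angularMode m v + b * angularMode (-m) v := by
  ext v
  rw [modeAmplitude, h m, angularMode, angularMode]
  ring

lemma IsModeCombination.continuous_modeAmplitude (h : IsModeCombination a b Φ) (m : ℤ) :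
    Continuous (modeAmplitude (Φ m)) := by
  rw [h.modeAmplitude_eq]
  have := continuous_angularMode m
  have := continuous_angularMode (-m)
  fun_prop

lemma IsModeCombination.integrable_modeAmplitude (h : IsModeCombination a b Φ) (m : ℤ) :
    Integrable (modeAmplitude (Φ m)) := by
  rw [h.modeAmplitude_eq]
  exact ((integrable_angularMode m).const_mul a).add ((integrable_angularMode (-m)).const_mul b)

lemma IsModeCombination.integrable_fourierInv (h : IsModeCombination a b Φ) (m : ℤ) :
    Integrable (𝓕⁻ (modeAmplitude (Φ m))) := by
  have h1 : Integrable (𝓕 (modeAmplitude (Φ m))) := by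
    refine (((integrable_fourier_angularMode m).const_mul a).add
      ((integrable_fourier_angularMode (-m)).const_mul b)).congr (Eventually.of_forall fun w => ?_)
    rw [h.modeAmplitude_eq, fourier_add_mul (integrable_angularMode _) (integrable_angularMode _)]
    rfl
  have h2 : 𝓕⁻ (modeAmplitude (Φ m)) = fun w => 𝓕 (modeAmplitude (Φ m)) (-w) := by
    ext w; rw [Real.fourierInv_eq_fourier_neg]
  rw [h2]; exact h1.comp_neg

lemma angularCoeff_eq_integral {k : ℝ} (hk : 0 < k) (β : ℝ) (m : ℤ) :
    angularCoeff k β Φ m = (-Complex.I) ^ m.natAbs / (Real.pi * Real.sqrt (2 * k) : ℂ) *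
      ∫ v, modeAmplitude (Φ m) v * Complex.exp (Complex.I * ((β / k * v : ℝ) : ℂ)) := by
  rw [angularCoeff, integral_angularWeight_mul hk]
  congr 2; ext v; rw [modeAmplitude]; ring

/-- The frequency is `w = β/(2πk)`, since `e^{2πivw} = e^{iβv/k}`. -/
lemma angularCoeff_eq_fourierInv {k : ℝ} (hk : 0 < k) (β : ℝ) (m : ℤ) :
    angularCoeff k β Φ m = (-Complex.I) ^ m.natAbs / (Real.pi * Real.sqrt (2 * k) : ℂ) *
      𝓕⁻ (modeAmplitude (Φ m)) (β / (2 * Real.pi * k)) := by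
  rw [angularCoeff_eq_integral hk, Real.fourierInv_eq']
  congr 2; ext v
  rw [smul_eq_mul, mul_comm, RCLike.inner_apply, conj_trivial]
  congr 2
  have hk' : (k : ℂ) ≠ 0 := by exact_mod_cast hk.ne'
  have hπ : (Real.pi : ℂ) ≠ 0 := by exact_mod_cast Real.pi_ne_zero
  push_cast
  field_simp

lemma continuous_fourierInv_of_integrable {f : ℝ → ℂ} (hf : Integrable f) : Continuous (𝓕⁻ f) := by
  have h2 : 𝓕⁻ f = fun w => 𝓕 f (-w) := by
    ext w; rw [Real.fourierInv_eq_fourier_neg]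
  rw [h2]
  exact (continuous_fourier_of_integrable hf).comp continuous_neg

lemma norm_fourierInv_le {f : ℝ → ℂ} (w : ℝ) : ‖𝓕⁻ f w‖ ≤ ∫ v, ‖f v‖ := by
  rw [Real.fourierInv_eq_fourier_neg]; exact norm_fourier_le _

lemma integrable_fourierInv_mul_conj {f g : ℝ → ℂ} (hf' : Integrable (𝓕⁻ f))
    (hg : Integrable g) : Integrable fun w => 𝓕⁻ f w * star (𝓕⁻ g w) := by
  refine hf'.mul_bdd (c := ∫ v, ‖g v‖)
    (continuous_star.comp (continuous_fourierInv_of_integrable hg)).aestronglyMeasurable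
    (Eventually.of_forall fun w => ?_)
  rw [norm_star]; exact norm_fourierInv_le w

lemma neg_I_pow_mul_star (m n : ℕ) (h : m = n) :
    (-Complex.I) ^ m * star ((-Complex.I) ^ n) = 1 := by
  subst h
  rw [Complex.star_def, map_pow, ← mul_pow, map_neg, Complex.conj_I]
  simp

lemma IsModeCombination.integrable_angularCoeff_mul (h : IsModeCombination a b Φ) {k : ℝ}
    (hk : 0 < k) (m m' : ℤ) :
    Integrable fun β => angularCoeff k β Φ m * star (angularCoeff k β Φ m') := by
  have h1 := (integrable_fourierInv_mul_conj (h.integrable_fourierInv m)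
    (h.integrable_modeAmplitude m')).comp_div
    (R := 2 * Real.pi * k) (by positivity)
  refine (h1.const_mul ((-Complex.I) ^ m.natAbs / (Real.pi * Real.sqrt (2 * k) : ℂ) *
    star ((-Complex.I) ^ m'.natAbs / (Real.pi * Real.sqrt (2 * k) : ℂ)))).congr
    (Eventually.of_forall fun β => ?_)
  simp only [angularCoeff_eq_fourierInv hk, star_mul']
  ring

/-- Plancherel in `w = β/(2πk)`, followed by the return from `v` to `θ`. The Jacobian `2πk` times
the squared normalisation `1/(2kπ²)` leaves `1/π`. -/
lemma IsModeCombination.integral_angularCoeff_mul (h : IsModeCombination a b Φ) {k : ℝ}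
    (hk : 0 < k) (m m' : ℤ) :
    ∫ β, angularCoeff k β Φ m * star (angularCoeff k β Φ m') =
      ((-Complex.I) ^ m.natAbs * star ((-Complex.I) ^ m'.natAbs)) / Real.pi *
        ((∫ θ in (0 : ℝ)..Real.pi, Φ m θ * Φ m' θ : ℝ) : ℂ) := by
  have h1 : ∀ β, angularCoeff k β Φ m * star (angularCoeff k β Φ m') =
      ((-Complex.I) ^ m.natAbs / (Real.pi * Real.sqrt (2 * k) : ℂ) *
      star ((-Complex.I) ^ m'.natAbs / (Real.pi * Real.sqrt (2 * k) : ℂ))) *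
      (fun w => 𝓕⁻ (modeAmplitude (Φ m)) w * star (𝓕⁻ (modeAmplitude (Φ m')) w))
        (β / (2 * Real.pi * k)) := fun β => by
    simp only [angularCoeff_eq_fourierInv hk, star_mul']
    ring
  simp_rw [h1]
  have h3 := Measure.integral_comp_div (fun w => 𝓕⁻ (modeAmplitude (Φ m)) w *
    star (𝓕⁻ (modeAmplitude (Φ m')) w)) (2 * Real.pi * k)
  beta_reduce at h3
  rw [integral_const_mul, h3, integral_fourierInv_mul_conj
    (h.integrable_modeAmplitude m) (h.continuous_modeAmplitude m') (h.integrable_modeAmplitude m')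
    (h.integrable_fourierInv m')]
  have h2 : ∫ v, modeAmplitude (Φ m) v * star (modeAmplitude (Φ m') v) =
      ((∫ θ in (0 : ℝ)..Real.pi, Φ m θ * Φ m' θ : ℝ) : ℂ) := by
    rw [← intervalIntegral.integral_ofReal, integral_zero_pi_eq_integral_gdAngle]
    congr 1; ext v
    simp only [modeAmplitude, star_mul', Complex.star_def, Complex.conj_ofReal]
    rw [← sechSqrt_sq]
    push_cast; ring
  rw [h2, abs_of_pos (by positivity), Complex.real_smul]
  simp only [star_div₀, star_mul', Complex.star_def, Complex.conj_ofReal]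
  have hs : (Real.sqrt (2 * k) : ℂ) ^ 2 = 2 * k := by
    rw [← Complex.ofReal_pow, Real.sq_sqrt (by positivity)]; push_cast; rfl
  have hs0 : (Real.sqrt (2 * k) : ℂ) ≠ 0 := by
    exact_mod_cast (Real.sqrt_pos.2 (by positivity)).ne'
  have hπ : (Real.pi : ℂ) ≠ 0 := by exact_mod_cast Real.pi_ne_zero
  push_cast
  field_simp
  rw [hs]

end

lemma integral_cos_int_mul (j : ℤ) :
    ∫ θ in (0 : ℝ)..Real.pi, Real.cos (j * θ) = if j = 0 then Real.pi else 0 := by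
  split_ifs with h
  · subst h; simp
  · have hj : (j : ℝ) ≠ 0 := by exact_mod_cast h
    rw [intervalIntegral.integral_comp_mul_left _ hj, integral_cos]
    simp [Real.sin_int_mul_pi]

lemma integral_cos_mul_cos (m n : ℤ) :
    ∫ θ in (0 : ℝ)..Real.pi, Real.cos (m * θ) * Real.cos (n * θ) =
      Real.pi / 2 * ((if m = n then 1 else 0) + (if m = -n then 1 else 0)) := by
  have h : ∀ θ : ℝ, Real.cos (m * θ) * Real.cos (n * θ) =
      1 / 2 * (Real.cos ((m - n : ℤ) * θ) + Real.cos ((m + n : ℤ) * θ)) := fun θ => by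
    push_cast
    rw [sub_mul, add_mul, Real.cos_sub, Real.cos_add]; ring
  simp_rw [h]
  rw [intervalIntegral.integral_const_mul, intervalIntegral.integral_add
    (Continuous.intervalIntegrable (by fun_prop) _ _)
    (Continuous.intervalIntegrable (by fun_prop) _ _), integral_cos_int_mul, integral_cos_int_mul]
  simp only [sub_eq_zero, ← eq_neg_iff_add_eq_zero]
  split_ifs <;> ring

lemma integral_sin_mul_sin (m n : ℤ) :
    ∫ θ in (0 : ℝ)..Real.pi, Real.sin (m * θ) * Real.sin (n * θ) =
      Real.pi / 2 * ((if m = n then 1 else 0) - (if m = -n then 1 else 0)) := by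
  have h : ∀ θ : ℝ, Real.sin (m * θ) * Real.sin (n * θ) =
      1 / 2 * (Real.cos ((m - n : ℤ) * θ) - Real.cos ((m + n : ℤ) * θ)) := fun θ => by
    push_cast
    rw [sub_mul, add_mul, Real.cos_sub, Real.cos_add]; ring
  simp_rw [h]
  rw [intervalIntegral.integral_const_mul, intervalIntegral.integral_sub
    (Continuous.intervalIntegrable (by fun_prop) _ _)
    (Continuous.intervalIntegrable (by fun_prop) _ _), integral_cos_int_mul, integral_cos_int_mul]
  simp only [sub_eq_zero, ← eq_neg_iff_add_eq_zero]
  split_ifs <;> ring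

lemma integral_coeffPlus_mul {k : ℝ} (hk : 0 < k) (m m' : ℤ) :
    ∫ β : ℝ, coeffPlus k β m * star (coeffPlus k β m') =
        ((if m = m' then 1 else 0) + (if m = -m' then 1 else 0)) / 2 := by
  simp_rw [coeffPlus_eq hk]
  rw [isModeCombination_cos.integral_angularCoeff_mul hk, integral_cos_mul_cos]
  have hπ : (Real.pi : ℂ) ≠ 0 := by exact_mod_cast Real.pi_ne_zero
  by_cases h : m.natAbs = m'.natAbs
  · rw [neg_I_pow_mul_star _ _ h]
    push_cast
    field_simp
    split_ifs <;> simp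
  -- For `|m| ≠ |m'|` the phases do not cancel, but the angular integral is already zero.
  · have h1 : m ≠ m' := fun e => h (by rw [e])
    have h2 : m ≠ -m' := fun e => h (by rw [e, Int.natAbs_neg])
    simp [h1, h2]

lemma integral_coeffMinus_mul {k : ℝ} (hk : 0 < k) (m m' : ℤ) :
    ∫ β : ℝ, coeffMinus k β m * star (coeffMinus k β m') =
        (Int.sign (m * m') : ℂ) * (if |m| = |m'| then 1 else 0) / 2 := by
  simp_rw [coeffMinus_eq hk]
  rw [isModeCombination_sin.integral_angularCoeff_mul hk, integral_sin_mul_sin]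
  have hπ : (Real.pi : ℂ) ≠ 0 := by exact_mod_cast Real.pi_ne_zero
  by_cases h : |m| = |m'|
  · rw [neg_I_pow_mul_star _ _ (Int.natAbs_eq_natAbs_iff.2 (abs_eq_abs.1 h)), if_pos h]
    -- At `m = m' = 0` the two indicators cancel, matching `sign 0 = 0`; otherwise exactly one of `m
    -- = m'`, `m = -m'` holds and it fixes the sign.
    rcases eq_or_ne m' 0 with rfl | h0
    · obtain rfl : m = 0 := by simpa using h
      simp
    · rcases abs_eq_abs.1 h with rfl | rfl
      · have : ¬ m = -m := by omega
        have h3 : (m * m).sign = 1 := Int.sign_eq_one_of_pos (mul_self_pos.2 h0)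
        rw [h3, if_pos rfl, if_neg this]
        push_cast
        field_simp
        ring
      · have : ¬ -m' = m' := by omega
        have h3 : (-m' * m').sign = -1 :=
          Int.sign_eq_neg_one_of_neg (by have := mul_self_pos.2 h0; linarith)
        rw [h3, if_pos rfl, if_neg this]
        push_cast
        field_simp
        ring
  · have h1 : m ≠ m' := fun e => h (by rw [e])
    have h2 : m ≠ -m' := fun e => h (by rw [e, abs_neg])
    simp [h1, h2, h]

/-! ### Parseval on the circle, transported to the line. -/

/-- Parseval's identity for the Fourier coefficients of two square integrable functions on
`(a, b]`. -/
lemma hasSum_fourierCoeffOn_mul_star {a b : ℝ} {f g : ℝ → ℂ} (hab : a < b)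
    (hf : MemLp f 2 (volume.restrict (Ioc a b))) (hg : MemLp g 2 (volume.restrict (Ioc a b))) :
    HasSum (fun i => fourierCoeffOn hab f i * star (fourierCoeffOn hab g i))
      ((b - a)⁻¹ • ∫ x in a..b, f x * star (g x)) := by
  have := Fact.mk (by linarith : 0 < b - a)
  rw [← add_sub_cancel a b] at hf hg
  have h1 := hf.memLp_liftIoc.haarAddCircle
  have h2 := hg.memLp_liftIoc.haarAddCircle
  have key := (fourierBasis (T := b - a)).hasSum_inner_mul_inner h2.toLp h1.toLp
  convert! key using 1
  · ext i
    rw [← inner_conj_symm, ← HilbertBasis.repr_apply_apply, ← HilbertBasis.repr_apply_apply,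
      fourierBasis_repr, fourierBasis_repr, fourierCoeff_congr_ae h1.coeFn_toLp,
      fourierCoeff_congr_ae h2.coeFn_toLp, fourierCoeff_liftIoc_eq, fourierCoeff_liftIoc_eq,
      mul_comm]
    simp
  · rw [L2.inner_def]
    nth_rw 2 [← add_sub_cancel a b]
    rw [← AddCircle.integral_liftIoc_eq_intervalIntegral, ← AddCircle.integral_haarAddCircle]
    apply integral_congr_ae
    filter_upwards [h1.coeFn_toLp, h2.coeFn_toLp] with x hx1 hx2
    rw [hx1, hx2, RCLike.inner_apply]
    rfl

/-- The function `(sin θ)^{-1/2} F(log tan (θ/2))` on `(0, π)`. -/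
noncomputable def angularLift (F : ℝ → ℂ) (θ : ℝ) : ℂ :=
  ((Real.sqrt (Real.sin θ))⁻¹ : ℝ) * F (Real.log (Real.sin (θ / 2) / Real.cos (θ / 2)))

lemma angularLift_gdAngle (F : ℝ → ℂ) (v : ℝ) :
    angularLift F (gdAngle v) = ((sechSqrt v)⁻¹ : ℝ) * F v := by
  rw [angularLift, sin_gdAngle, Real.sqrt_inv, ← Real.tan_eq_sin_div_cos, gdAngle,
    mul_div_cancel_left₀ _ two_ne_zero, Real.tan_arctan, Real.log_exp]
  rfl

lemma measurable_angularLift {F : ℝ → ℂ} (hF : Continuous F) : Measurable (angularLift F) := by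
  unfold angularLift
  have h1 : Measurable fun θ : ℝ => Real.log (Real.sin (θ / 2) / Real.cos (θ / 2)) := by
    fun_prop
  exact (by fun_prop : Measurable fun θ : ℝ => (((Real.sqrt (Real.sin θ))⁻¹ : ℝ) : ℂ)).mul
    (hF.measurable.comp h1)

lemma inv_cosh_mul_inv_sechSqrt (v : ℝ) : (Real.cosh v)⁻¹ * (sechSqrt v)⁻¹ = sechSqrt v := by
  have := sechSqrt_pos v
  rw [← sechSqrt_sq]; field_simp

/-- The Jacobian `sech v` against `(sin θ)^{-1/2} = (sech v)^{-1/2}` leaves exactly the amplitude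
`(sech v)^{1/2}` of the mode. -/
lemma integral_angularLift_mul_exp (F : ℝ → ℂ) (m : ℤ) :
    ∫ θ in (0 : ℝ)..Real.pi, angularLift F θ * Complex.exp (Complex.I * ((m * θ : ℝ) : ℂ)) =
      ∫ v, angularMode m v * F v := by
  rw [integral_zero_pi_eq_integral_gdAngle]
  congr 1; ext v
  rw [angularLift_gdAngle, angularMode, ← mul_assoc, ← mul_assoc, ← Complex.ofReal_mul,
    inv_cosh_mul_inv_sechSqrt]
  ring

/-- The two factors `(sin θ)^{-1/2}` cancel the Jacobian, so `angularLift` preserves the `L²`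
pairing between `ℝ` and `(0, π)`. -/
lemma inv_cosh_mul_angularLift_mul_star (F G : ℝ → ℂ) (v : ℝ) :
    (((Real.cosh v)⁻¹ : ℝ) : ℂ) * (angularLift F (gdAngle v) * star (angularLift G (gdAngle v))) =
      F v * star (G v) := by
  rw [angularLift_gdAngle, angularLift_gdAngle, ← sechSqrt_sq]
  have : (sechSqrt v : ℂ) ≠ 0 := by exact_mod_cast (sechSqrt_pos v).ne'
  simp only [star_mul', Complex.star_def, Complex.conj_ofReal]
  push_cast
  field_simp

/-- The function on `(-π, π)` equal to `b (sin θ)^{-1/2} F(v)` on `(0, π)` and to its reflection,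
with factor `a`, on `(-π, 0)`. -/
noncomputable def reflectedLift (a b : ℂ) (F : ℝ → ℂ) (θ : ℝ) : ℂ :=
  if θ < 0 then a * angularLift F (-θ) else b * angularLift F θ

lemma intervalIntegrable_neg_pi_pi_iff_of_reflect {u u₁ u₂ : ℝ → ℂ}
    (h1 : ∀ θ ∈ Ioo 0 Real.pi, u (-θ) = u₁ θ) (h2 : ∀ θ ∈ Ioo 0 Real.pi, u θ = u₂ θ)
    (i1 : IntervalIntegrable u₁ volume 0 Real.pi) (i2 : IntervalIntegrable u₂ volume 0 Real.pi) :
    IntervalIntegrable u volume (-Real.pi) 0 ∧ IntervalIntegrable u volume 0 Real.pi := by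
  have e1 : IntervalIntegrable (fun θ => u (-θ)) volume 0 Real.pi := by
    rw [intervalIntegrable_iff_integrableOn_Ioo_of_le Real.pi_pos.le] at i1 ⊢
    exact i1.congr_fun (fun θ hθ => (h1 θ hθ).symm) measurableSet_Ioo
  constructor
  · have := (IntervalIntegrable.iff_comp_neg (by simp)).1 e1
    simp only [neg_neg, neg_zero] at this
    exact this.symm
  · rw [intervalIntegrable_iff_integrableOn_Ioo_of_le Real.pi_pos.le] at i2 ⊢
    exact i2.congr_fun (fun θ hθ => (h2 θ hθ).symm) measurableSet_Ioo

lemma integral_neg_pi_pi_of_reflect {u u₁ u₂ : ℝ → ℂ}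
    (h1 : ∀ θ ∈ Ioo 0 Real.pi, u (-θ) = u₁ θ) (h2 : ∀ θ ∈ Ioo 0 Real.pi, u θ = u₂ θ)
    (i1 : IntervalIntegrable u₁ volume 0 Real.pi) (i2 : IntervalIntegrable u₂ volume 0 Real.pi) :
    ∫ θ in (-Real.pi)..Real.pi, u θ =
      (∫ θ in (0 : ℝ)..Real.pi, u₁ θ) + ∫ θ in (0 : ℝ)..Real.pi, u₂ θ := by
  obtain ⟨j1, j2⟩ := intervalIntegrable_neg_pi_pi_iff_of_reflect h1 h2 i1 i2
  have e1 : ∫ θ in (-Real.pi)..0, u θ = ∫ θ in (0 : ℝ)..Real.pi, u (-θ) := by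
    rw [intervalIntegral.integral_comp_neg, neg_zero]
  rw [← intervalIntegral.integral_add_adjacent_intervals j1 j2, e1]
  congr 1
  · exact intervalIntegral.integral_congr_Ioo_of_le Real.pi_pos.le h1
  · exact intervalIntegral.integral_congr_Ioo_of_le Real.pi_pos.le h2

lemma intervalIntegrable_angularLift_mul_exp {F : ℝ → ℂ} (hF : Continuous F) {M : ℝ}
    (hM : ∀ v, ‖F v‖ ≤ M) (c : ℂ) (m : ℤ) :
    IntervalIntegrable
      (fun θ => c * (angularLift F θ * Complex.exp (Complex.I * ((m * θ : ℝ) : ℂ))))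
      volume 0 Real.pi := by
  refine IntervalIntegrable.const_mul ?_ c
  rw [intervalIntegrable_zero_pi_iff]
  refine ((integrable_angularMode m).mul_bdd hF.aestronglyMeasurable
    (Eventually.of_forall hM)).congr (Eventually.of_forall fun v => ?_)
  simp only
  rw [angularLift_gdAngle, angularMode, ← mul_assoc, ← mul_assoc, ← Complex.ofReal_mul,
    inv_cosh_mul_inv_sechSqrt]
  ring

lemma intervalIntegrable_angularLift_mul_star {F G : ℝ → ℂ}
    (h : Integrable fun v => F v * star (G v)) (c : ℂ) :
    IntervalIntegrable (fun θ => c * (angularLift F θ * star (angularLift G θ)))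
      volume 0 Real.pi := by
  refine IntervalIntegrable.const_mul ?_ c
  rw [intervalIntegrable_zero_pi_iff]
  simp_rw [inv_cosh_mul_angularLift_mul_star]
  exact h

lemma reflectedLift_neg (a b : ℂ) (F : ℝ → ℂ) {θ : ℝ} (hθ : θ ∈ Ioo 0 Real.pi) :
    reflectedLift a b F (-θ) = a * angularLift F θ := by
  rw [reflectedLift, if_pos (by linarith [hθ.1]), neg_neg]

lemma reflectedLift_pos (a b : ℂ) (F : ℝ → ℂ) {θ : ℝ} (hθ : θ ∈ Ioo 0 Real.pi) :
    reflectedLift a b F θ = b * angularLift F θ := by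
  rw [reflectedLift, if_neg (by linarith [hθ.1])]

/-- Reflection turns `e^{-imθ}` on `(-π, 0)` into `e^{imθ}` on `(0, π)`, so one full-circle
coefficient contains both half-range coefficients, weighted by `a` and `b`. -/
lemma fourierCoeffOn_reflectedLift (a b : ℂ) {F : ℝ → ℂ} (hF : Continuous F) {M : ℝ}
    (hM : ∀ v, ‖F v‖ ≤ M) (m : ℤ) (hab : -Real.pi < Real.pi) :
    fourierCoeffOn hab (reflectedLift a b F) m = (1 / (2 * Real.pi) : ℂ) *
      (a * (∫ v, angularMode m v * F v) + b * ∫ v, angularMode (-m) v * F v) := by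
  have hexp : ∀ θ : ℝ, fourier (-m) (θ : AddCircle (Real.pi - -Real.pi)) =
      Complex.exp (Complex.I * (((-m : ℤ) * θ : ℝ) : ℂ)) := by
    intro θ
    rw [fourier_coe_apply]
    congr 1
    have hπ : (Real.pi : ℂ) ≠ 0 := by exact_mod_cast Real.pi_ne_zero
    push_cast
    field_simp
    ring
  rw [fourierCoeffOn_eq_integral, ← integral_angularLift_mul_exp, ← integral_angularLift_mul_exp,
    ← intervalIntegral.integral_const_mul, ← intervalIntegral.integral_const_mul,
    integral_neg_pi_pi_of_reflect
    (u₁ := fun θ => a * (angularLift F θ * Complex.exp (Complex.I * ((m * θ : ℝ) : ℂ))))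
    (u₂ := fun θ => b * (angularLift F θ * Complex.exp (Complex.I * (((-m : ℤ) * θ : ℝ) : ℂ))))
    (fun θ hθ => ?_) (fun θ hθ => ?_) (intervalIntegrable_angularLift_mul_exp hF hM a m)
    (intervalIntegrable_angularLift_mul_exp hF hM b (-m)), Complex.real_smul]
  · push_cast
    ring
  · rw [hexp, reflectedLift_neg a b F hθ, smul_eq_mul, show ((-m : ℤ) * -θ : ℝ) = m * θ by
      push_cast; ring]
    ring
  · rw [hexp, reflectedLift_pos a b F hθ, smul_eq_mul]
    ring

lemma memLp_reflectedLift (a b : ℂ) {F : ℝ → ℂ} (hF : Continuous F)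
    (h2 : Integrable fun v => F v * star (F v)) :
    MemLp (reflectedLift a b F) 2 (volume.restrict (Ioc (-Real.pi) Real.pi)) := by
  have hm : Measurable (reflectedLift a b F) := by
    unfold reflectedLift
    have h1 := measurable_angularLift hF
    exact Measurable.ite measurableSet_Iio ((h1.comp measurable_neg).const_mul a) (h1.const_mul b)
  rw [memLp_two_iff_integrable_sq_norm hm.aestronglyMeasurable]
  have key := intervalIntegrable_neg_pi_pi_iff_of_reflect
    (u := fun θ => reflectedLift a b F θ * star (reflectedLift a b F θ))
    (u₁ := fun θ => a * star a * (angularLift F θ * star (angularLift F θ)))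
    (u₂ := fun θ => b * star b * (angularLift F θ * star (angularLift F θ)))
    (fun θ hθ => by simp only [reflectedLift_neg a b F hθ, star_mul']; ring)
    (fun θ hθ => by simp only [reflectedLift_pos a b F hθ, star_mul']; ring)
    (intervalIntegrable_angularLift_mul_star h2 _) (intervalIntegrable_angularLift_mul_star h2 _)
  have h3 := (key.1.trans key.2).norm
  rw [intervalIntegrable_iff_integrableOn_Ioc_of_le (by linarith [Real.pi_pos])] at h3
  refine h3.congr (Eventually.of_forall fun θ => ?_)
  simp only [norm_mul, norm_star, sq]

/-- Parseval's identity for the combinations `a H_m(F) + b H_{-m}(F)` of half-range Fourier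
coefficients. -/
lemma hasSum_halfRange_mul_star (a b : ℂ) {F G : ℝ → ℂ} (hF : Continuous F) (hG : Continuous G)
    {M N : ℝ} (hM : ∀ v, ‖F v‖ ≤ M) (hN : ∀ v, ‖G v‖ ≤ N)
    (hFF : Integrable fun v => F v * star (F v)) (hGG : Integrable fun v => G v * star (G v))
    (hFG : Integrable fun v => F v * star (G v)) :
    HasSum (fun m : ℤ =>
      (a * (∫ v, angularMode m v * F v) + b * ∫ v, angularMode (-m) v * F v) *
      star (a * (∫ v, angularMode m v * G v) + b * ∫ v, angularMode (-m) v * G v))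
      (2 * Real.pi * (a * star a + b * star b) * ∫ v, F v * star (G v)) := by
  have hab : -Real.pi < Real.pi := by linarith [Real.pi_pos]
  have h := hasSum_fourierCoeffOn_mul_star hab (memLp_reflectedLift a b hF hFF)
    (memLp_reflectedLift a b hG hGG)
  have hπ : (Real.pi : ℂ) ≠ 0 := by exact_mod_cast Real.pi_ne_zero
  have hI : ∫ θ in (0 : ℝ)..Real.pi, angularLift F θ * star (angularLift G θ) =
      ∫ v, F v * star (G v) := by
    rw [integral_zero_pi_eq_integral_gdAngle]
    simp_rw [inv_cosh_mul_angularLift_mul_star]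
  rw [integral_neg_pi_pi_of_reflect
    (u₁ := fun θ => a * star a * (angularLift F θ * star (angularLift G θ)))
    (u₂ := fun θ => b * star b * (angularLift F θ * star (angularLift G θ)))
    (fun θ hθ => by
      simp only [reflectedLift_neg a b F hθ, reflectedLift_neg a b G hθ, star_mul']; ring)
    (fun θ hθ => by
      simp only [reflectedLift_pos a b F hθ, reflectedLift_pos a b G hθ, star_mul']; ring)
    (intervalIntegrable_angularLift_mul_star hFG _) (intervalIntegrable_angularLift_mul_star hFG _),
    intervalIntegral.integral_const_mul, intervalIntegral.integral_const_mul, hI,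
    Complex.real_smul] at h
  -- Removes the normalisation `1/(2π)` from both Fourier coefficients; against the `1/(2π)` on the
  -- integral side one factor `2π` survives.
  have h2 := h.mul_left ((2 * Real.pi) * (2 * Real.pi) : ℂ)
  convert! h2 using 1
  · ext m
    rw [fourierCoeffOn_reflectedLift a b hF hM, fourierCoeffOn_reflectedLift a b hG hN]
    simp only [star_mul', Complex.star_def, map_div₀, map_mul, Complex.conj_ofReal, map_one,
      Complex.conj_ofNat]
    field_simp
  · push_cast
    field_simp
    ring

/-! ### Oscillatory integral bounds. -/

/-- The kernel `(cosh v)^{-1/2} / (1 + n / cosh v)`. -/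
noncomputable def oscKernel (n : ℕ) (v : ℝ) : ℝ := sechSqrt v / (1 + n * (Real.cosh v)⁻¹)

lemma one_add_mul_inv_cosh_pos (n : ℕ) (v : ℝ) : 0 < 1 + n * (Real.cosh v)⁻¹ := by
  have := Real.cosh_pos v
  positivity

lemma oscKernel_nonneg (n : ℕ) (v : ℝ) : 0 ≤ oscKernel n v :=
  div_nonneg (sechSqrt_pos v).le (one_add_mul_inv_cosh_pos n v).le

lemma continuous_oscKernel (n : ℕ) : Continuous (oscKernel n) := by
  have := continuous_sechSqrt
  unfold oscKernel
  refine this.div ?_ fun v => (one_add_mul_inv_cosh_pos n v).ne'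
  exact continuous_const.add (continuous_const.mul
    (Real.continuous_cosh.inv₀ fun v => (Real.cosh_pos v).ne'))

lemma oscKernel_le_sechSqrt (n : ℕ) (v : ℝ) : oscKernel n v ≤ sechSqrt v := by
  refine div_le_self (sechSqrt_pos v).le ?_
  have := Real.cosh_pos v
  have : 0 ≤ (n : ℝ) * (Real.cosh v)⁻¹ := by positivity
  linarith

lemma integrable_oscKernel_mul {n : ℕ} {u : ℝ → ℝ} (hu : Continuous u) {M : ℝ}
    (hM : ∀ v, |u v| ≤ M) : Integrable fun v => oscKernel n v * u v := by
  have h1 : Integrable (oscKernel n) :=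
    integrable_sechSqrt.mono' (continuous_oscKernel n).aestronglyMeasurable
      (Eventually.of_forall fun v => by
        rw [Real.norm_of_nonneg (oscKernel_nonneg n v)]; exact oscKernel_le_sechSqrt n v)
  exact h1.mul_bdd hu.aestronglyMeasurable (Eventually.of_forall hM)

lemma hasDerivAt_angularMode_self (m : ℤ) (v : ℝ) :
    HasDerivAt (angularMode m)
      ((-(1 / 2) * ((Real.sinh v / Real.cosh v : ℝ) : ℂ) +
        Complex.I * m * (((Real.cosh v)⁻¹ : ℝ) : ℂ)) * angularMode m v) v := by
  refine (hasDerivAt_angularMode m v).congr_deriv ?_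
  rw [angularMode_add_one, angularMode_sub_one, cos_gdAngle, sin_gdAngle]
  push_cast
  ring

lemma one_add_I_mul_ne_zero (x : ℝ) : (1 : ℂ) + Complex.I * x ≠ 0 := fun h => by
  have := congrArg Complex.re h
  simp at this

lemma one_add_abs_le_two_mul_norm (x : ℝ) : 1 + |x| ≤ 2 * ‖(1 : ℂ) + Complex.I * x‖ := by
  have h1 := Complex.abs_re_le_norm (1 + Complex.I * x)
  have h2 := Complex.abs_im_le_norm (1 + Complex.I * x)
  simp only [Complex.add_re, Complex.one_re, Complex.I_mul_re, Complex.ofReal_im, neg_zero,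
    add_zero, abs_one, Complex.add_im, Complex.one_im, Complex.I_mul_im, Complex.ofReal_re,
    zero_add] at h1 h2
  linarith

/-- Integration by parts for the oscillating integral of `F` against `angularMode m`. -/
lemma norm_integral_angularMode_mul_le {F F' : ℝ → ℂ} (hF : ∀ v, HasDerivAt F (F' v) v)
    (hF' : Continuous F') {M : ℝ} (hM : ∀ v, ‖F v‖ + ‖F' v‖ ≤ M) (m : ℤ) :
    ‖∫ v, angularMode m v * F v‖ ≤ 5 * ∫ v, oscKernel m.natAbs v * (‖F v‖ + ‖F' v‖) := by
  have hFc : Continuous F := continuous_iff_continuousAt.2 fun v => (hF v).continuousAt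
  have hFM : ∀ v, ‖F v‖ ≤ M := fun v => by linarith [hM v, norm_nonneg (F' v)]
  set s : ℝ → ℝ := fun v => (Real.cosh v)⁻¹ with hs
  set t : ℝ → ℝ := fun v => Real.sinh v / Real.cosh v with ht
  have hsc : Continuous s := Real.continuous_cosh.inv₀ fun v => (Real.cosh_pos v).ne'
  have htc : Continuous t := Real.continuous_sinh.div Real.continuous_cosh
    fun v => (Real.cosh_pos v).ne'
  have hspos : ∀ v, 0 < s v := fun v => inv_pos.2 (Real.cosh_pos v)
  have ht1 : ∀ v, |t v| ≤ 1 := fun v => by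
    show |Real.sinh v / Real.cosh v| ≤ 1
    rw [← Real.tanh_eq_sinh_div_cosh]; exact (Real.abs_tanh_lt_one v).le
  have hsd : ∀ v, HasDerivAt s (-(s v * t v)) v := fun v => by
    refine ((Real.hasDerivAt_cosh v).inv (Real.cosh_pos v).ne').congr_deriv ?_
    have := Real.cosh_pos v
    simp only [hs, ht]; field_simp
  -- Dividing by `1 + im sech v` instead of by the phase derivative `im sech v` keeps the quotient
  -- bounded where `sech v` is small and also covers `m = 0`. The added `1` only contributes to the
  -- remainder `R`.
  set d : ℝ → ℂ := fun v => 1 + Complex.I * ((m * s v : ℝ) : ℂ) with hd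
  have hd0 : ∀ v, d v ≠ 0 := fun v => one_add_I_mul_ne_zero _
  have hdc : Continuous d := by fun_prop
  set R : ℝ → ℂ := fun v => (1 + 1 / 2 * (t v : ℂ)) * F v - F' v -
    F v * t v * (Complex.I * ((m * s v : ℝ) : ℂ) / d v) with hR
  have hRc : Continuous R := by
    have : Continuous fun v => Complex.I * ((m * s v : ℝ) : ℂ) / d v :=
      (by fun_prop : Continuous fun v => Complex.I * ((m * s v : ℝ) : ℂ)).div hdc hd0
    fun_prop
  have hA : ∀ v, HasDerivAt (fun v => angularMode m v * F v / d v)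
      (angularMode m v * F v - angularMode m v / d v * R v) v := by
    intro v
    have h1 := (hasDerivAt_angularMode_self m v).mul (hF v)
    have h2 : HasDerivAt d (Complex.I * ((m * -(s v * t v) : ℝ) : ℂ)) v :=
      ((((hsd v).const_mul (m : ℝ)).ofReal_comp).const_mul Complex.I).const_add 1
    refine (h1.div h2 (hd0 v)).congr_deriv ?_
    have h3 := hd0 v
    have h4 : Complex.I * ((m * s v : ℝ) : ℂ) = d v - 1 := by simp only [hd]; ring
    have h5 : Complex.I * (m : ℂ) * (((Real.cosh v)⁻¹ : ℝ) : ℂ) = d v - 1 := by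
      rw [← h4]; simp only [hs]; push_cast; ring
    have h6 : Complex.I * ((m * -(s v * t v) : ℝ) : ℂ) = -(d v - 1) * t v := by
      rw [← h4]; push_cast; ring
    have h7 : ((Real.sinh v / Real.cosh v : ℝ) : ℂ) = t v := rfl
    simp only [hR, Pi.mul_apply]
    rw [h4, h5, h6, h7]
    field_simp
    ring
  have hdn : ∀ v, 1 + m.natAbs * s v ≤ 2 * ‖d v‖ := fun v => by
    have := one_add_abs_le_two_mul_norm (m * s v)
    rwa [abs_mul, abs_of_pos (hspos v), ← Int.cast_abs, Int.abs_eq_natAbs, Int.cast_natCast] at this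
  have hRn : ∀ v, ‖R v‖ ≤ 5 / 2 * (‖F v‖ + ‖F' v‖) := by
    intro v
    have h1 : ‖(1 : ℂ) + 1 / 2 * (t v : ℂ)‖ ≤ 3 / 2 := by
      refine (norm_add_le _ _).trans ?_
      rw [norm_one, norm_mul, Complex.norm_real, Real.norm_eq_abs]
      have := ht1 v
      norm_num
      linarith
    have h2 : ‖Complex.I * ((m * s v : ℝ) : ℂ) / d v‖ ≤ 1 := by
      rw [norm_div, div_le_one (norm_pos_iff.2 (hd0 v)), norm_mul, Complex.norm_I, one_mul,
        Complex.norm_real, Real.norm_eq_abs]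
      have := Complex.abs_im_le_norm (d v)
      simpa [hd] using this
    have h3 : ‖F v * t v * (Complex.I * ((m * s v : ℝ) : ℂ) / d v)‖ ≤ ‖F v‖ := by
      rw [norm_mul, norm_mul, Complex.norm_real, Real.norm_eq_abs, mul_assoc]
      exact mul_le_of_le_one_right (norm_nonneg _) (mul_le_one₀ (ht1 v) (norm_nonneg _) h2)
    have h4 : ‖(1 + 1 / 2 * (t v : ℂ)) * F v‖ ≤ 3 / 2 * ‖F v‖ := by
      rw [norm_mul]; gcongr
    have h5 := norm_sub_le ((1 + 1 / 2 * (t v : ℂ)) * F v - F' v)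
      (F v * t v * (Complex.I * ((m * s v : ℝ) : ℂ) / d v))
    have h6 := norm_sub_le ((1 + 1 / 2 * (t v : ℂ)) * F v) (F' v)
    have := norm_nonneg (F' v)
    simp only [hR]
    linarith
  -- The constant is `5 = 2 · 5/2`: `2` from `1 + |x| ≤ 2|1 + ix|`, and `5/2 = 3/2 + 1` from the
  -- terms of `R` containing `F`.
  have hbound : ∀ v, ‖angularMode m v / d v * R v‖ ≤
      5 * (oscKernel m.natAbs v * (‖F v‖ + ‖F' v‖)) := by
    intro v
    rw [norm_mul, norm_div, norm_angularMode]
    have h1 : sechSqrt v / ‖d v‖ ≤ 2 * oscKernel m.natAbs v := by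
      rw [oscKernel, ← mul_div_assoc, div_le_div_iff₀ (norm_pos_iff.2 (hd0 v))
        (one_add_mul_inv_cosh_pos _ v)]
      have := hdn v
      have := sechSqrt_pos v
      simp only [hs] at *
      nlinarith
    have h2 : 0 ≤ oscKernel m.natAbs v := oscKernel_nonneg _ v
    calc _ ≤ 2 * oscKernel m.natAbs v * (5 / 2 * (‖F v‖ + ‖F' v‖)) :=
          mul_le_mul h1 (hRn v) (norm_nonneg _) (by positivity)
      _ = _ := by ring
  have hint : Integrable fun v => oscKernel m.natAbs v * (‖F v‖ + ‖F' v‖) :=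
    integrable_oscKernel_mul (by fun_prop) (M := M) fun v => by
      rw [abs_of_nonneg (by positivity)]; exact hM v
  have hc := continuous_angularMode m
  have hi1 : Integrable fun v => angularMode m v * F v :=
    (integrable_angularMode m).mul_bdd hFc.aestronglyMeasurable (Eventually.of_forall hFM)
  have hi2 : Integrable fun v => angularMode m v / d v * R v :=
    (hint.const_mul 5).mono' ((hc.div hdc hd0).mul hRc).aestronglyMeasurable
      (Eventually.of_forall hbound)
  have hi3 : Integrable fun v => angularMode m v * F v / d v := by
    refine hi1.mono ((hc.mul hFc).div hdc hd0).aestronglyMeasurable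
      (Eventually.of_forall fun v => ?_)
    rw [norm_div]
    refine div_le_self (norm_nonneg _) ?_
    have := Complex.abs_re_le_norm (d v)
    simpa [hd] using this
  have h0 := integral_eq_zero_of_hasDerivAt_of_integrable hA (hi1.sub hi2) hi3
  rw [integral_sub hi1 hi2, sub_eq_zero] at h0
  rw [h0, ← integral_const_mul]
  exact norm_integral_le_of_norm_le (hint.const_mul 5) (Eventually.of_forall hbound)

lemma hasDerivAt_arctan_exp_half {n : ℝ} (hn : 0 < n) (v : ℝ) :
    HasDerivAt (fun v => 2 / Real.sqrt n * Real.arctan (Real.exp (v / 2) / Real.sqrt n))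
      (Real.exp (v / 2) / (Real.exp v + n)) v := by
  obtain ⟨r, hr, rfl⟩ : ∃ r : ℝ, 0 < r ∧ n = r ^ 2 :=
    ⟨Real.sqrt n, Real.sqrt_pos.2 hn, (Real.sq_sqrt hn.le).symm⟩
  rw [Real.sqrt_sq hr.le]
  have h1 : HasDerivAt (fun v : ℝ => Real.exp (v / 2) / r)
      (Real.exp (v / 2) * (1 / 2) / r) v :=
    (((hasDerivAt_id v).div_const 2).exp).div_const _
  refine (h1.arctan.const_mul (2 / r)).congr_deriv ?_
  have he : Real.exp v = Real.exp (v / 2) ^ 2 := by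
    rw [← Real.exp_nat_mul]; congr 1; push_cast; ring
  have hp := Real.exp_pos (v / 2)
  rw [he]
  field_simp
  ring

/-- From `e^{|v|}/2 ≤ cosh v ≤ e^{|v|}`; the majorant has an elementary antiderivative on the half
line. -/
lemma oscKernel_le {n : ℕ} (hn : 0 < n) (v : ℝ) :
    oscKernel n v ≤ Real.sqrt 2 * (Real.exp (|v| / 2) / (Real.exp |v| + n)) := by
  have hn' : (0 : ℝ) < n := by exact_mod_cast hn
  have h1 := sechSqrt_le_exp v
  have hc : Real.exp (-|v|) ≤ (Real.cosh v)⁻¹ := by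
    rw [Real.exp_neg]
    refine inv_anti₀ (Real.cosh_pos v) ?_
    rw [← Real.cosh_abs, Real.cosh_eq]
    have : Real.exp (-|v|) ≤ Real.exp |v| := Real.exp_le_exp.2 (by linarith [abs_nonneg v])
    linarith
  have hp := Real.exp_pos (-|v|)
  calc oscKernel n v ≤ Real.sqrt 2 * Real.exp (-(|v| / 2)) / (1 + n * Real.exp (-|v|)) := by
        rw [oscKernel]
        gcongr
    _ = _ := by
        have e1 : Real.exp (-(|v| / 2)) = Real.exp (|v| / 2) * Real.exp (-|v|) := by
          rw [← Real.exp_add]; congr 1; ring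
        have e2 : Real.exp |v| * Real.exp (-|v|) = 1 := by rw [← Real.exp_add]; simp
        have hq := Real.exp_pos |v|
        rw [e1, ← mul_div_assoc, div_eq_div_iff (by positivity) (by positivity)]
        linear_combination (Real.sqrt 2 * Real.exp (|v| / 2)) * e2

/-- On each half line the majorant is at most the limit `π/√n` of the antiderivative `(2/√n)
arctan(e^{v/2}/√n)`. -/
lemma integral_oscKernel_le {n : ℕ} (hn : 0 < n) :
    ∫ v, oscKernel n v ≤ 2 * Real.sqrt 2 * Real.pi / Real.sqrt n := by
  have hn' : (0 : ℝ) < n := by exact_mod_cast hn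
  set l : ℝ := 2 / Real.sqrt n * (Real.pi / 2) with hl
  have hlim : Tendsto (fun v => 2 / Real.sqrt n * Real.arctan (Real.exp (v / 2) / Real.sqrt n))
      atTop (𝓝 l) := by
    refine Tendsto.const_mul _ ?_
    refine (tendsto_nhds_of_tendsto_nhdsWithin Real.tendsto_arctan_atTop).comp ?_
    exact (Real.tendsto_exp_atTop.comp (tendsto_id.atTop_div_const two_pos)).atTop_div_const
      (Real.sqrt_pos.2 hn')
  have hpos : ∀ v ∈ Ioi (0 : ℝ), 0 ≤ Real.exp (v / 2) / (Real.exp v + n) := fun v _ => by positivity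
  have hI := integral_Ioi_of_hasDerivAt_of_nonneg' (a := 0)
    (fun v _ => hasDerivAt_arctan_exp_half hn' v) hpos hlim
  have hint' : Integrable fun v : ℝ => Real.exp (|v| / 2) / (Real.exp |v| + n) := by
    have h0 : ∀ v : ℝ, Real.exp |v| + n ≠ 0 := fun v => by positivity
    have hc : Continuous fun v : ℝ => Real.exp (|v| / 2) / (Real.exp |v| + n) :=
      (by fun_prop : Continuous fun v : ℝ => Real.exp (|v| / 2)).div (by fun_prop) h0
    refine integrable_exp_neg_abs_div_two.mono' hc.aestronglyMeasurable
      (Eventually.of_forall fun v => ?_)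
    rw [Real.norm_of_nonneg (by positivity), div_le_iff₀ (by positivity), mul_add, ← Real.exp_add,
      show -(|v| / 2) + |v| = |v| / 2 by ring]
    have : 0 ≤ Real.exp (-(|v| / 2)) * n := by positivity
    linarith
  have hle : ∫ v in Ioi (0 : ℝ), Real.exp (v / 2) / (Real.exp v + n) ≤ l := by
    rw [hI]
    have : 0 ≤ Real.arctan (Real.exp (0 / 2) / Real.sqrt n) := Real.arctan_nonneg.2 (by positivity)
    have h2 : 0 ≤ 2 / Real.sqrt n * Real.arctan (Real.exp (0 / 2) / Real.sqrt n) := by positivity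
    linarith
  calc ∫ v, oscKernel n v
      ≤ ∫ v, Real.sqrt 2 * (Real.exp (|v| / 2) / (Real.exp |v| + n)) :=
        integral_mono_of_nonneg (Eventually.of_forall fun v => oscKernel_nonneg n v)
          (hint'.const_mul _) (Eventually.of_forall fun v => oscKernel_le hn v)
    _ = Real.sqrt 2 * (2 * ∫ v in Ioi (0 : ℝ), Real.exp (v / 2) / (Real.exp v + n)) := by
        rw [integral_const_mul, ← integral_comp_abs]
    _ ≤ Real.sqrt 2 * (2 * l) := by gcongr
    _ = _ := by rw [hl]; ring

/-- The right side is the increment over `[n, n+1]` of a function with decreasing derivative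
`x^{-1/2}(1 + xs)^{-1}`; by the mean value theorem it is at least the derivative at `n + 1`. -/
lemma inv_sqrt_mul_inv_one_add_le {s : ℝ} (hs : 0 < s) (n : ℕ) :
    (Real.sqrt (n + 1))⁻¹ * (1 + (n + 1) * s)⁻¹ ≤
      2 / Real.sqrt s * Real.arctan (Real.sqrt ((n + 1) * s)) -
        2 / Real.sqrt s * Real.arctan (Real.sqrt (n * s)) := by
  have hn : (0 : ℝ) ≤ n := Nat.cast_nonneg n
  have hsq := Real.sqrt_pos.2 hs
  obtain ⟨c, hc, h⟩ := exists_hasDerivAt_eq_slope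
    (fun x => 2 / Real.sqrt s * Real.arctan (Real.sqrt (x * s)))
    (fun x => (Real.sqrt x)⁻¹ * (1 + x * s)⁻¹) (a := (n : ℝ)) (b := n + 1) (by linarith)
    (by
      have := Real.continuous_arctan
      exact (by fun_prop : Continuous fun x => 2 / Real.sqrt s *
        Real.arctan (Real.sqrt (x * s))).continuousOn)
    (fun x hx => by
      have hx0 : 0 < x := by linarith [hx.1]
      have hxs : 0 < x * s := by positivity
      refine ((((hasDerivAt_id x).mul_const s).sqrt hxs.ne').arctan.const_mul
        (2 / Real.sqrt s)).congr_deriv ?_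
      have h1 := Real.sqrt_pos.2 hx0
      have h2 := Real.sq_sqrt hs.le
      simp only [id]
      rw [Real.sq_sqrt hxs.le, Real.sqrt_mul hx0.le]
      field_simp
      rw [h2])
  rw [add_sub_cancel_left, div_one] at h
  rw [← h]
  have hc0 : 0 < c := by linarith [hc.1]
  have h1 := Real.sqrt_pos.2 hc0
  have h2 : Real.sqrt c ≤ Real.sqrt (n + 1) := Real.sqrt_le_sqrt hc.2.le
  have h3 : 1 + c * s ≤ 1 + (n + 1) * s := by
    have := mul_le_mul_of_nonneg_right hc.2.le hs.le; linarith
  have h4 : 0 < 1 + c * s := by positivity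
  gcongr

lemma sum_inv_sqrt_mul_inv_one_add_le {s : ℝ} (hs : 0 < s) (N : ℕ) :
    ∑ n ∈ Finset.range N, (Real.sqrt n)⁻¹ * (1 + n * s)⁻¹ ≤ Real.pi / Real.sqrt s := by
  have hsq := Real.sqrt_pos.2 hs
  have key : ∀ N : ℕ, ∑ n ∈ Finset.range (N + 1), (Real.sqrt n)⁻¹ * (1 + n * s)⁻¹ ≤
      2 / Real.sqrt s * Real.arctan (Real.sqrt (N * s)) := by
    intro N
    induction N with
    -- The term `n = 0` contributes nothing, since `(√0)⁻¹ = 0`.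
    | zero => simp
    | succ N ih =>
      rw [Finset.sum_range_succ]
      have := inv_sqrt_mul_inv_one_add_le hs N
      push_cast
      linarith
  have h1 : ∑ n ∈ Finset.range N, (Real.sqrt n)⁻¹ * (1 + n * s)⁻¹ ≤
      ∑ n ∈ Finset.range (N + 1), (Real.sqrt n)⁻¹ * (1 + n * s)⁻¹ := by
    rw [Finset.sum_range_succ]
    have : 0 ≤ (Real.sqrt N)⁻¹ * (1 + N * s)⁻¹ := by positivity
    linarith
  refine h1.trans ((key N).trans ?_)
  have := (Real.arctan_lt_pi_div_two (Real.sqrt (N * s))).le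
  calc 2 / Real.sqrt s * Real.arctan (Real.sqrt (N * s)) ≤ 2 / Real.sqrt s * (Real.pi / 2) := by
        gcongr
    _ = _ := by ring

/-- Taking `s = sech v` in `sum_inv_sqrt_mul_inv_one_add_le`, the prefactor `(sech v)^{1/2}` cancels
`1/√s`. The partial sums of `n^{-1/2} K_n(v)` are thus at most `π` for every `v`, and integrability
of `u` suffices. -/
lemma summable_inv_sqrt_mul_integral_oscKernel {u : ℝ → ℝ} (hu : Continuous u)
    (hu0 : ∀ v, 0 ≤ u v) {M : ℝ} (hM : ∀ v, u v ≤ M) (hi : Integrable u) :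
    Summable fun n : ℕ => (Real.sqrt n)⁻¹ * ∫ v, oscKernel n v * u v := by
  have hint : ∀ n : ℕ, Integrable fun v => oscKernel n v * u v := fun n =>
    integrable_oscKernel_mul hu (M := M) fun v => by rw [abs_of_nonneg (hu0 v)]; exact hM v
  refine summable_of_sum_range_le (c := Real.pi * ∫ v, u v) (fun n => ?_) fun N => ?_
  · exact mul_nonneg (by positivity)
      (integral_nonneg fun v => mul_nonneg (oscKernel_nonneg n v) (hu0 v))
  · simp_rw [← integral_const_mul]
    rw [← integral_finsetSum _ fun n _ => (hint n).const_mul _]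
    refine integral_mono (integrable_finsetSum _ fun n _ => (hint n).const_mul _)
      (hi.const_mul _) fun v => ?_
    have hs : 0 < (Real.cosh v)⁻¹ := inv_pos.2 (Real.cosh_pos v)
    have h1 := sum_inv_sqrt_mul_inv_one_add_le hs N
    have h2 : Real.sqrt (Real.cosh v)⁻¹ = sechSqrt v := by rw [Real.sqrt_inv]; rfl
    rw [h2] at h1
    have h3 := sechSqrt_pos v
    have h4 : ∑ n ∈ Finset.range N, (Real.sqrt n)⁻¹ * (oscKernel n v * u v) =
        (sechSqrt v * ∑ n ∈ Finset.range N, (Real.sqrt n)⁻¹ * (1 + n * (Real.cosh v)⁻¹)⁻¹) *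
          u v := by
      rw [Finset.mul_sum, Finset.sum_mul]
      refine Finset.sum_congr rfl fun n _ => ?_
      rw [oscKernel]; ring
    simp only [h4]
    refine mul_le_mul_of_nonneg_right ?_ (hu0 v)
    calc _ ≤ sechSqrt v * (Real.pi / sechSqrt v) := by gcongr
      _ = Real.pi := by field_simp

/-- The combination `a H_m(G) + b H_{-m}(G)` of `H_m(G) = ∫ angularMode m * G`. -/
noncomputable def halfRange (a b : ℂ) (G : ℝ → ℂ) (m : ℤ) : ℂ :=
  a * (∫ v, angularMode m v * G v) + b * ∫ v, angularMode (-m) v * G v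

lemma norm_halfRange_le (a b : ℂ) {F F' : ℝ → ℂ} (hF : ∀ v, HasDerivAt F (F' v) v)
    (hF' : Continuous F') {M : ℝ} (hM : ∀ v, ‖F v‖ + ‖F' v‖ ≤ M) (m : ℤ) :
    ‖halfRange a b F m‖ ≤
      (‖a‖ + ‖b‖) * (5 * ∫ v, oscKernel m.natAbs v * (‖F v‖ + ‖F' v‖)) := by
  have h1 := norm_integral_angularMode_mul_le hF hF' hM m
  have h2 := norm_integral_angularMode_mul_le hF hF' hM (-m)
  rw [Int.natAbs_neg] at h2
  rw [halfRange, add_mul]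
  refine (norm_add_le _ _).trans ?_
  rw [norm_mul, norm_mul]
  gcongr

/-- A weight comparable to `n^{-1/2}`. -/
noncomputable def invSqrtWeight (n : ℕ) : ℝ := if n = 0 then 1 else (Real.sqrt n)⁻¹

lemma invSqrtWeight_pos (n : ℕ) : 0 < invSqrtWeight n := by
  rw [invSqrtWeight]
  split_ifs with h
  · exact one_pos
  · exact inv_pos.2 (Real.sqrt_pos.2 (by exact_mod_cast Nat.pos_of_ne_zero h))

lemma integrable_oscKernel (n : ℕ) : Integrable (oscKernel n) := by
  simpa using integrable_oscKernel_mul (n := n) (u := fun _ => 1) continuous_const (M := 1) (by simp)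

lemma exists_integral_oscKernel_le : ∃ D, 0 ≤ D ∧ ∀ n, ∫ v, oscKernel n v ≤ D * invSqrtWeight n := by
  have h0 : 0 ≤ ∫ v, oscKernel 0 v := integral_nonneg (oscKernel_nonneg 0)
  have h1 : 0 ≤ 2 * Real.sqrt 2 * Real.pi := by positivity
  refine ⟨(∫ v, oscKernel 0 v) + 2 * Real.sqrt 2 * Real.pi, by positivity, fun n => ?_⟩
  rcases Nat.eq_zero_or_pos n with rfl | hn
  · simp only [invSqrtWeight, if_pos]; linarith
  · refine (integral_oscKernel_le hn).trans ?_
    rw [invSqrtWeight, if_neg hn.ne', div_eq_mul_inv]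
    gcongr
    linarith

/-- The constant depends on `F` only through the bound `M`, which makes it uniform along the damped
characters. -/
lemma exists_norm_halfRange_le (a b : ℂ) (M : ℝ) : ∃ D, 0 ≤ D ∧ ∀ F F' : ℝ → ℂ,
    (∀ v, HasDerivAt F (F' v) v) → Continuous F' → (∀ v, ‖F v‖ + ‖F' v‖ ≤ M) →
    ∀ m, ‖halfRange a b F m‖ ≤ D * invSqrtWeight m.natAbs := by
  obtain ⟨D, hD0, hD⟩ := exists_integral_oscKernel_le
  refine ⟨(‖a‖ + ‖b‖) * (5 * (D * |M|)), by positivity, fun F F' hF hF' hM m => ?_⟩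
  have hFc : Continuous F := continuous_iff_continuousAt.2 fun v => (hF v).continuousAt
  have h1 := norm_halfRange_le a b hF hF' hM m
  have h2 : ∫ v, oscKernel m.natAbs v * (‖F v‖ + ‖F' v‖) ≤ (∫ v, oscKernel m.natAbs v) * |M| := by
    rw [← integral_mul_const]
    refine integral_mono (integrable_oscKernel_mul (by fun_prop) (M := M) fun v => ?_)
      ((integrable_oscKernel _).mul_const _) fun v => ?_
    · rw [abs_of_nonneg (by positivity)]; exact hM v
    · exact mul_le_mul_of_nonneg_left ((hM v).trans (le_abs_self M)) (oscKernel_nonneg _ v)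
  have h3 := mul_le_mul_of_nonneg_right (hD m.natAbs) (abs_nonneg M)
  calc _ ≤ _ := h1
    _ ≤ (‖a‖ + ‖b‖) * (5 * (D * invSqrtWeight m.natAbs * |M|)) := by
      gcongr; exact h2.trans h3
    _ = _ := by ring

lemma summable_invSqrtWeight_mul_norm_halfRange (a b : ℂ) {F F' : ℝ → ℂ}
    (hF : ∀ v, HasDerivAt F (F' v) v) (hF' : Continuous F') {M : ℝ}
    (hM : ∀ v, ‖F v‖ + ‖F' v‖ ≤ M) (hi : Integrable F) (hi' : Integrable F') :
    Summable fun m : ℤ => invSqrtWeight m.natAbs * ‖halfRange a b F m‖ := by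
  have hFc : Continuous F := continuous_iff_continuousAt.2 fun v => (hF v).continuousAt
  have h1 := summable_inv_sqrt_mul_integral_oscKernel (u := fun v => ‖F v‖ + ‖F' v‖)
    (by fun_prop) (fun v => by positivity) hM (hi.norm.add hi'.norm)
  have h2 : Summable fun n : ℕ => invSqrtWeight n * ∫ v, oscKernel n v * (‖F v‖ + ‖F' v‖) := by
    -- The two weights differ only at `n = 0`, so the comparison is made after dropping that term.
    rw [← summable_nat_add_iff 1] at h1 ⊢
    refine h1.congr fun n => ?_
    rw [invSqrtWeight, if_neg (Nat.succ_ne_zero n)]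
  have h3 : Summable fun m : ℤ =>
      invSqrtWeight m.natAbs * ∫ v, oscKernel m.natAbs v * (‖F v‖ + ‖F' v‖) :=
    Summable.of_nat_of_neg (by simpa using h2) (by simpa using h2)
  refine Summable.of_nonneg_of_le (fun m => ?_) (fun m => ?_) (h3.mul_left ((‖a‖ + ‖b‖) * 5))
  · exact mul_nonneg (invSqrtWeight_pos _).le (norm_nonneg _)
  · have := mul_le_mul_of_nonneg_left (norm_halfRange_le a b hF hF' hM m)
      (invSqrtWeight_pos m.natAbs).le
    calc _ ≤ _ := this
      _ = _ := by ring

/-! ### Parseval against a character, by Gaussian damping. -/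

/-- The character `e^{icv}` damped by `e^{-εv²}`. -/
noncomputable def dampedExp (c ε v : ℝ) : ℂ :=
  Complex.exp (Complex.I * ((c * v : ℝ) : ℂ)) * (Real.exp (-ε * v ^ 2) : ℝ)

lemma norm_dampedExp (c ε v : ℝ) : ‖dampedExp c ε v‖ = Real.exp (-ε * v ^ 2) := by
  rw [dampedExp, norm_mul, norm_exp_I_mul_ofReal', one_mul, Complex.norm_real,
    Real.norm_of_nonneg (Real.exp_pos _).le]

lemma continuous_dampedExp (c ε : ℝ) : Continuous (dampedExp c ε) := by
  unfold dampedExp; fun_prop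

lemma hasDerivAt_dampedExp (c ε v : ℝ) :
    HasDerivAt (dampedExp c ε)
      ((Complex.I * c - ((2 * ε * v : ℝ) : ℂ)) * dampedExp c ε v) v := by
  have h1 := ((((hasDerivAt_id v).const_mul c).ofReal_comp).const_mul Complex.I).cexp
  have h2 := (((hasDerivAt_pow 2 v).const_mul (-ε)).exp).ofReal_comp
  refine (h1.mul h2).congr_deriv ?_
  simp only [dampedExp, id]
  push_cast
  ring

/-- Uniform in `ε ∈ [0, 1]`: the only new term in the derivative is `2ε|v| e^{-εv²}`, and `2ε|v| ≤
ε(1 + v²) ≤ 1 + εv² ≤ e^{εv²}`. -/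
lemma norm_dampedExp_add_le (c : ℝ) {ε : ℝ} (h0 : 0 ≤ ε) (h1 : ε ≤ 1) (v : ℝ) :
    ‖dampedExp c ε v‖ + ‖(Complex.I * c - ((2 * ε * v : ℝ) : ℂ)) * dampedExp c ε v‖ ≤
      2 + |c| := by
  rw [norm_mul, norm_dampedExp]
  have hE : 0 < Real.exp (-ε * v ^ 2) := Real.exp_pos _
  have hE1 : Real.exp (-ε * v ^ 2) ≤ 1 := Real.exp_le_one_iff.2 (by
    have : 0 ≤ ε * v ^ 2 := by positivity
    linarith)
  have h2 : ‖Complex.I * c - ((2 * ε * v : ℝ) : ℂ)‖ ≤ |c| + 2 * ε * |v| := by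
    refine (norm_sub_le _ _).trans ?_
    rw [norm_mul, Complex.norm_I, one_mul, Complex.norm_real, Complex.norm_real, Real.norm_eq_abs,
      Real.norm_eq_abs, abs_mul, abs_of_nonneg (by positivity : 0 ≤ 2 * ε)]
  have h3 : 2 * ε * |v| * Real.exp (-ε * v ^ 2) ≤ 1 := by
    have h4 : 1 + ε * v ^ 2 ≤ Real.exp (ε * v ^ 2) := by
      rw [add_comm]; exact Real.add_one_le_exp _
    have h5 : 2 * ε * |v| ≤ 1 + ε * v ^ 2 := by
      have := mul_nonneg h0 (sq_nonneg (|v| - 1))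
      rw [← sq_abs v]
      nlinarith
    rw [neg_mul, Real.exp_neg, ← div_eq_mul_inv, div_le_one (Real.exp_pos _)]
    linarith
  have h6 : |c| * Real.exp (-ε * v ^ 2) ≤ |c| := mul_le_of_le_one_right (abs_nonneg c) hE1
  have h7 := mul_le_mul_of_nonneg_right h2 hE.le
  rw [add_mul] at h7
  linarith

lemma integrable_mul_star_of_bounded {F G : ℝ → ℂ} (hF : Integrable F) (hG : Continuous G) {N : ℝ}
    (hN : ∀ v, ‖G v‖ ≤ N) : Integrable fun v => F v * star (G v) :=
  hF.mul_bdd (continuous_star.comp hG).aestronglyMeasurable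
    (Eventually.of_forall fun v => by rw [norm_star]; exact hN v)

lemma tendsto_integral_mul_dampedExp {u : ℝ → ℂ} (hu : Integrable u) (c : ℝ) :
    Tendsto (fun n : ℕ => ∫ v, u v * dampedExp c (1 / ((n : ℝ) + 1)) v) atTop
      (𝓝 (∫ v, u v * dampedExp c 0 v)) := by
  refine tendsto_integral_of_dominated_convergence (fun v => ‖u v‖)
    (fun n => hu.1.mul (continuous_dampedExp _ _).aestronglyMeasurable) hu.norm
    (fun n => Eventually.of_forall fun v => ?_) (Eventually.of_forall fun v => ?_)
  · rw [norm_mul, norm_dampedExp]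
    refine mul_le_of_le_one_right (norm_nonneg _) (Real.exp_le_one_iff.2 ?_)
    have : 0 ≤ 1 / ((n : ℝ) + 1) * v ^ 2 := by positivity
    linarith
  · have hc : Continuous fun ε : ℝ => u v * dampedExp c ε v := by
      unfold dampedExp; fun_prop
    exact (hc.tendsto 0).comp tendsto_one_div_add_atTop_nhds_zero_nat

lemma tendsto_halfRange_dampedExp (a b : ℂ) (c : ℝ) (m : ℤ) :
    Tendsto (fun n : ℕ => halfRange a b (dampedExp c (1 / ((n : ℝ) + 1))) m) atTop
      (𝓝 (halfRange a b (dampedExp c 0) m)) :=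
  ((tendsto_integral_mul_dampedExp (integrable_angularMode m) c).const_mul a).add
    ((tendsto_integral_mul_dampedExp (integrable_angularMode (-m)) c).const_mul b)

/-- The coefficients of the character are `O(|m|^{-1/2})` and those of `F` are summable against this
weight. The two pairs of coefficients may differ, so that the cross terms are covered as well. -/
lemma summable_halfRange_mul_star (a b a' b' : ℂ) {F F' : ℝ → ℂ}
    (hF : ∀ v, HasDerivAt F (F' v) v) (hF' : Continuous F') {M : ℝ}
    (hM : ∀ v, ‖F v‖ + ‖F' v‖ ≤ M) (hi : Integrable F) (hi' : Integrable F') (c : ℝ) :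
    Summable fun m : ℤ => halfRange a b F m * star (halfRange a' b' (dampedExp c 0) m) := by
  obtain ⟨D, hD0, hD⟩ := exists_norm_halfRange_le a' b' (2 + |c|)
  refine Summable.of_norm_bounded
    ((summable_invSqrtWeight_mul_norm_halfRange a b hF hF' hM hi hi').mul_left D) fun m => ?_
  have h := hD _ _ (hasDerivAt_dampedExp c 0)
    (by have := continuous_dampedExp c 0; fun_prop) (norm_dampedExp_add_le c le_rfl zero_le_one) m
  rw [norm_mul, norm_star]
  calc _ ≤ ‖halfRange a b F m‖ * (D * invSqrtWeight m.natAbs) := by gcongr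
    _ = _ := by ring

/-- Parseval's identity for `F` decaying and the character `e^{icv}`. -/
lemma hasSum_halfRange_mul_star_exp (a b : ℂ) {F F' : ℝ → ℂ}
    (hF : ∀ v, HasDerivAt F (F' v) v) (hF' : Continuous F') {M : ℝ}
    (hM : ∀ v, ‖F v‖ + ‖F' v‖ ≤ M) (hi : Integrable F) (hi' : Integrable F') (c : ℝ) :
    HasSum (fun m : ℤ => halfRange a b F m * star (halfRange a b (dampedExp c 0) m))
      (2 * Real.pi * (a * star a + b * star b) * ∫ v, F v * star (dampedExp c 0 v)) := by
  have hFc : Continuous F := continuous_iff_continuousAt.2 fun v => (hF v).continuousAt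
  have hFM : ∀ v, ‖F v‖ ≤ M := fun v => by linarith [hM v, norm_nonneg (F' v)]
  have hsum := summable_halfRange_mul_star a b a b hF hF' hM hi hi' c
  have hε0 : ∀ n : ℕ, 0 < 1 / ((n : ℝ) + 1) := fun n => by positivity
  have hε1 : ∀ n : ℕ, 1 / ((n : ℝ) + 1) ≤ 1 := fun n => by
    rw [div_le_one (by positivity)]
    have : (0 : ℝ) ≤ n := Nat.cast_nonneg n
    linarith
  have hn1 : ∀ (n : ℕ) v, ‖dampedExp c (1 / ((n : ℝ) + 1)) v‖ ≤ 1 := fun n v => by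
    rw [norm_dampedExp]
    refine Real.exp_le_one_iff.2 ?_
    have : 0 ≤ 1 / ((n : ℝ) + 1) * v ^ 2 := by positivity
    linarith
  have hdi : ∀ n : ℕ, Integrable (dampedExp c (1 / ((n : ℝ) + 1))) := fun n =>
    (integrable_exp_neg_mul_sq (hε0 n)).mono' (continuous_dampedExp _ _).aestronglyMeasurable
      (Eventually.of_forall fun v => (norm_dampedExp _ _ _).le)
  -- The undamped character has modulus `1` and is not square integrable, so Parseval is applied at
  -- `ε = 1/(n+1)`.
  have hP : ∀ n : ℕ, HasSum (fun m : ℤ =>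
      halfRange a b F m * star (halfRange a b (dampedExp c (1 / ((n : ℝ) + 1))) m))
      (2 * Real.pi * (a * star a + b * star b) *
        ∫ v, F v * star (dampedExp c (1 / ((n : ℝ) + 1)) v)) := fun n =>
    hasSum_halfRange_mul_star a b hFc (continuous_dampedExp _ _) hFM (hn1 n)
      (integrable_mul_star_of_bounded hi hFc hFM)
      (integrable_mul_star_of_bounded (hdi n) (continuous_dampedExp _ _) (hn1 n))
      (integrable_mul_star_of_bounded hi (continuous_dampedExp _ _) (hn1 n))
  obtain ⟨D, hD0, hD⟩ := exists_norm_halfRange_le a b (2 + |c|)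
  -- The constant `D` serves all `ε ∈ [0, 1]`, so a single summable sequence in `m` dominates every
  -- damped series.
  have hlim1 := tendsto_tsum_of_dominated_convergence
    (f := fun (n : ℕ) (m : ℤ) =>
      halfRange a b F m * star (halfRange a b (dampedExp c (1 / ((n : ℝ) + 1))) m))
    (g := fun m => halfRange a b F m * star (halfRange a b (dampedExp c 0) m))
    ((summable_invSqrtWeight_mul_norm_halfRange a b hF hF' hM hi hi').mul_left D)
    (fun m => ((continuous_star.tendsto _).comp (tendsto_halfRange_dampedExp a b c m)).const_mul _)
    (Eventually.of_forall fun n m => by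
      have h := hD _ _ (hasDerivAt_dampedExp c (1 / ((n : ℝ) + 1)))
        (by have := continuous_dampedExp c (1 / ((n : ℝ) + 1)); fun_prop)
        (norm_dampedExp_add_le c (hε0 n).le (hε1 n)) m
      rw [norm_mul, norm_star]
      calc _ ≤ ‖halfRange a b F m‖ * (D * invSqrtWeight m.natAbs) := by gcongr
        _ = _ := by ring)
  have hP2 := fun n => (hP n).tsum_eq
  simp only [hP2] at hlim1
  -- Conjugation replaces `c` by `-c`, so the integral side converges by the same limit lemma.
  have hstar : ∀ ε : ℝ, ∫ v, F v * star (dampedExp c ε v) = ∫ v, F v * dampedExp (-c) ε v := by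
    intro ε
    congr 1; ext v
    rw [dampedExp, dampedExp, star_mul', Complex.star_def, Complex.conj_ofReal,
      ← Complex.exp_conj, map_mul, Complex.conj_I, Complex.conj_ofReal]
    congr 3
    push_cast; ring
  have hlim2 := (tendsto_integral_mul_dampedExp hi (-c)).const_mul
    (2 * Real.pi * (a * star a + b * star b) : ℂ)
  simp_rw [← hstar] at hlim2
  have := tendsto_nhds_unique hlim1 hlim2
  rw [← this]
  exact hsum.hasSum

/-! ### Schwartz test functions and the distributional identities. -/

/-- The transform `F(v) = ∫ f(β) e^{iβv/k} dβ` of a Schwartz function. -/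
noncomputable def spectralTransform (k : ℝ) (f : SchwartzMap ℝ ℂ) (v : ℝ) : ℂ :=
  (𝓕⁻ f : SchwartzMap ℝ ℂ) (v / (2 * Real.pi * k))

/-- The derivative of `spectralTransform`. -/
noncomputable def spectralTransformDeriv (k : ℝ) (f : SchwartzMap ℝ ℂ) (v : ℝ) : ℂ :=
  SchwartzMap.derivCLM ℂ ℂ (𝓕⁻ f : SchwartzMap ℝ ℂ) (v / (2 * Real.pi * k)) *
    ((1 / (2 * Real.pi * k) : ℝ) : ℂ)

lemma hasDerivAt_spectralTransform (k : ℝ) (f : SchwartzMap ℝ ℂ) (v : ℝ) :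
    HasDerivAt (spectralTransform k f) (spectralTransformDeriv k f v) v := by
  have h1 := (𝓕⁻ f : SchwartzMap ℝ ℂ).hasDerivAt (v / (2 * Real.pi * k))
  have h2 := h1.scomp v ((hasDerivAt_id v).div_const (2 * Real.pi * k))
  refine h2.congr_deriv ?_
  rw [spectralTransformDeriv, SchwartzMap.derivCLM_apply, Complex.real_smul, mul_comm]

lemma continuous_spectralTransformDeriv (k : ℝ) (f : SchwartzMap ℝ ℂ) :
    Continuous (spectralTransformDeriv k f) := by
  have h := (SchwartzMap.derivCLM ℂ ℂ (𝓕⁻ f : SchwartzMap ℝ ℂ)).continuous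
  unfold spectralTransformDeriv
  fun_prop

lemma exists_norm_spectralTransform_le (k : ℝ) (f : SchwartzMap ℝ ℂ) :
    ∃ M, ∀ v, ‖spectralTransform k f v‖ + ‖spectralTransformDeriv k f v‖ ≤ M := by
  refine ⟨SchwartzMap.seminorm ℂ 0 0 (𝓕⁻ f : SchwartzMap ℝ ℂ) +
    SchwartzMap.seminorm ℂ 0 0 (SchwartzMap.derivCLM ℂ ℂ (𝓕⁻ f : SchwartzMap ℝ ℂ)) *
      ‖((1 / (2 * Real.pi * k) : ℝ) : ℂ)‖, fun v =>
    add_le_add (SchwartzMap.norm_le_seminorm ℂ (𝓕⁻ f : SchwartzMap ℝ ℂ) _) ?_⟩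
  rw [spectralTransformDeriv, norm_mul]
  gcongr
  exact SchwartzMap.norm_le_seminorm ℂ _ _

lemma integrable_spectralTransform {k : ℝ} (hk : 0 < k) (f : SchwartzMap ℝ ℂ) :
    Integrable (spectralTransform k f) :=
  (𝓕⁻ f : SchwartzMap ℝ ℂ).integrable.comp_div (by positivity)

lemma integrable_spectralTransformDeriv {k : ℝ} (hk : 0 < k) (f : SchwartzMap ℝ ℂ) :
    Integrable (spectralTransformDeriv k f) :=
  ((SchwartzMap.derivCLM ℂ ℂ (𝓕⁻ f : SchwartzMap ℝ ℂ)).integrable.comp_div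
    (by positivity)).mul_const _

lemma spectralTransform_eq_integral {k : ℝ} (hk : 0 < k) (f : SchwartzMap ℝ ℂ) (v : ℝ) :
    spectralTransform k f v =
      ∫ β, f β * Complex.exp (Complex.I * ((β / k * v : ℝ) : ℂ)) := by
  rw [spectralTransform, SchwartzMap.fourierInv_coe, Real.fourierInv_eq']
  congr 1; ext β
  rw [smul_eq_mul, mul_comm, RCLike.inner_apply, conj_trivial]
  congr 2
  have hk' : (k : ℂ) ≠ 0 := by exact_mod_cast hk.ne'
  have hπ : (Real.pi : ℂ) ≠ 0 := by exact_mod_cast Real.pi_ne_zero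
  push_cast
  field_simp

/-- Fourier inversion for `spectralTransform`. -/
lemma integral_spectralTransform_mul_star {k : ℝ} (hk : 0 < k) (f : SchwartzMap ℝ ℂ) (β : ℝ) :
    ∫ v, spectralTransform k f v * star (dampedExp (β / k) 0 v) = 2 * Real.pi * k * f β := by
  have h1 : ∀ v, spectralTransform k f v * star (dampedExp (β / k) 0 v) =
      (fun w => (𝓕⁻ f : SchwartzMap ℝ ℂ) w *
        Complex.exp (((-2 * Real.pi * w * β : ℝ) : ℂ) * Complex.I)) (v / (2 * Real.pi * k)) := by
    intro v
    have hk' : (k : ℂ) ≠ 0 := by exact_mod_cast hk.ne'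
    have hπ : (Real.pi : ℂ) ≠ 0 := by exact_mod_cast Real.pi_ne_zero
    rw [spectralTransform, dampedExp, star_mul', Complex.star_def, Complex.conj_ofReal,
      ← Complex.exp_conj, map_mul, Complex.conj_I, Complex.conj_ofReal, neg_zero, zero_mul,
      Real.exp_zero, Complex.ofReal_one, mul_one]
    simp only
    congr 2
    push_cast
    field_simp
  have h2 := Measure.integral_comp_div (fun w => (𝓕⁻ f : SchwartzMap ℝ ℂ) w *
        Complex.exp (((-2 * Real.pi * w * β : ℝ) : ℂ) * Complex.I)) (2 * Real.pi * k)
  simp_rw [h1]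
  beta_reduce at h2 ⊢
  rw [h2, abs_of_pos (by positivity), Complex.real_smul]
  have h3 : ∫ w, (𝓕⁻ f : SchwartzMap ℝ ℂ) w *
      Complex.exp (((-2 * Real.pi * w * β : ℝ) : ℂ) * Complex.I) = f β := by
    have h4 : (𝓕 (𝓕⁻ f : SchwartzMap ℝ ℂ) : SchwartzMap ℝ ℂ) β = f β := by simp
    rw [← h4, SchwartzMap.fourier_coe, Real.fourier_real_eq_integral_exp_smul]
    simp_rw [smul_eq_mul, mul_comm]
  rw [h3]
  push_cast; rfl

section
variable {a b : ℂ} {Φ : ℤ → ℝ → ℝ}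

lemma IsModeCombination.integral_modeAmplitude_mul (h : IsModeCombination a b Φ) (m : ℤ)
    {G : ℝ → ℂ} (hG : Continuous G) {N : ℝ} (hN : ∀ v, ‖G v‖ ≤ N) :
    ∫ v, modeAmplitude (Φ m) v * G v = halfRange a b G m := by
  have hi : ∀ n, Integrable fun v => angularMode n v * G v := fun n =>
    (integrable_angularMode n).mul_bdd hG.aestronglyMeasurable (Eventually.of_forall hN)
  rw [halfRange, ← integral_const_mul, ← integral_const_mul,
    ← integral_add ((hi _).const_mul _) ((hi _).const_mul _), h.modeAmplitude_eq]
  congr 1; ext v; ring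

lemma norm_dampedExp_zero (c v : ℝ) : ‖dampedExp c 0 v‖ = 1 := by
  rw [norm_dampedExp]; simp

lemma IsModeCombination.angularCoeff_eq_halfRange (h : IsModeCombination a b Φ) {k : ℝ}
    (hk : 0 < k) (β : ℝ) (m : ℤ) :
    angularCoeff k β Φ m = (-Complex.I) ^ m.natAbs / (Real.pi * Real.sqrt (2 * k) : ℂ) *
      halfRange a b (dampedExp (β / k) 0) m := by
  rw [angularCoeff_eq_integral hk, ← h.integral_modeAmplitude_mul m (continuous_dampedExp _ _)
    (fun v => (norm_dampedExp_zero _ v).le)]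
  congr 2; ext v
  simp [dampedExp]

lemma IsModeCombination.integrable_mul_angularCoeff (h : IsModeCombination a b Φ) {k : ℝ}
    (hk : 0 < k) (f : SchwartzMap ℝ ℂ) (m : ℤ) :
    Integrable fun β => f β * angularCoeff k β Φ m := by
  simp_rw [angularCoeff_eq_fourierInv hk, ← mul_assoc]
  exact (f.integrable.mul_const _).mul_bdd (c := ∫ v, ‖modeAmplitude (Φ m) v‖)
    ((continuous_fourierInv_of_integrable (h.integrable_modeAmplitude m)).comp
      (continuous_id.div_const _)).aestronglyMeasurable
    (Eventually.of_forall fun β => norm_fourierInv_le _)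

/-- Fubini exchanges `β` and `v`: testing in `β` replaces the character by the Fourier transform of
`f`. -/
lemma IsModeCombination.integral_mul_angularCoeff (h : IsModeCombination a b Φ) {k : ℝ}
    (hk : 0 < k) (f : SchwartzMap ℝ ℂ) (m : ℤ) :
    ∫ β, f β * angularCoeff k β Φ m =
      (-Complex.I) ^ m.natAbs / (Real.pi * Real.sqrt (2 * k) : ℂ) *
        halfRange a b (spectralTransform k f) m := by
  obtain ⟨M, hM⟩ := exists_norm_spectralTransform_le k f
  rw [← h.integral_modeAmplitude_mul m (continuous_iff_continuousAt.2 fun v =>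
    (hasDerivAt_spectralTransform k f v).continuousAt)
    (fun v => (le_add_of_nonneg_right (norm_nonneg _)).trans (hM v))]
  have h1 : ∀ β, f β * angularCoeff k β Φ m =
      (-Complex.I) ^ m.natAbs / (Real.pi * Real.sqrt (2 * k) : ℂ) *
      ∫ v, f β * (modeAmplitude (Φ m) v * Complex.exp (Complex.I * ((β / k * v : ℝ) : ℂ))) := by
    intro β
    rw [angularCoeff_eq_integral hk, integral_const_mul]; ring
  simp_rw [h1]
  rw [integral_const_mul, integral_integral_swap]
  · congr 2; ext v
    rw [spectralTransform_eq_integral hk, ← integral_const_mul]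
    congr 1; ext β; ring
  · have h2 := (f.integrable (μ := volume)).mul_prod (h.integrable_modeAmplitude m)
    have h3 := h2.mul_bdd (c := 1) (g := fun p : ℝ × ℝ =>
      Complex.exp (Complex.I * ((p.1 / k * p.2 : ℝ) : ℂ)))
      (by fun_prop : Continuous _).aestronglyMeasurable
      (Eventually.of_forall fun p => (norm_exp_I_mul_ofReal' _).le)
    refine h3.congr (Eventually.of_forall fun p => ?_)
    simp only [Function.uncurry]
    ring

end

lemma phase_mul_star {k : ℝ} (hk : 0 < k) (n : ℕ) :
    (-Complex.I) ^ n / (Real.pi * Real.sqrt (2 * k) : ℂ) *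
      star ((-Complex.I) ^ n / (Real.pi * Real.sqrt (2 * k) : ℂ)) =
      1 / (2 * k * Real.pi ^ 2 : ℂ) := by
  have hs : (Real.sqrt (2 * k) : ℂ) ^ 2 = 2 * k := by
    rw [← Complex.ofReal_pow, Real.sq_sqrt (by positivity)]; push_cast; rfl
  rw [star_div₀, div_mul_div_comm, neg_I_pow_mul_star n n rfl]
  congr 1
  simp only [star_mul', Complex.star_def, Complex.conj_ofReal]
  rw [← hs]; ring

section
variable {a b a' b' : ℂ} {Φ Φ' : ℤ → ℝ → ℝ}

/-- Both coefficients carry the same `m`, so their phases cancel and only the normalisation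
`1/(2kπ²)` remains. -/
lemma integral_mul_angularCoeff_mul_star (h : IsModeCombination a b Φ)
    (h' : IsModeCombination a' b' Φ') {k : ℝ} (hk : 0 < k) (f : SchwartzMap ℝ ℂ) (β' : ℝ) (m : ℤ) :
    ∫ β, f β * (angularCoeff k β Φ m * star (angularCoeff k β' Φ' m)) =
      1 / (2 * k * Real.pi ^ 2 : ℂ) * (halfRange a b (spectralTransform k f) m *
        star (halfRange a' b' (dampedExp (β' / k) 0) m)) := by
  simp_rw [← mul_assoc]
  rw [integral_mul_const, h.integral_mul_angularCoeff hk, h'.angularCoeff_eq_halfRange hk,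
    star_mul', ← phase_mul_star hk m.natAbs]
  ring

lemma integrable_mul_angularCoeff_mul_star (h : IsModeCombination a b Φ) {k : ℝ} (hk : 0 < k)
    (f : SchwartzMap ℝ ℂ) (β' : ℝ) (m : ℤ) :
    Integrable fun β => f β * (angularCoeff k β Φ m * star (angularCoeff k β' Φ' m)) := by
  simp_rw [← mul_assoc]
  exact (h.integrable_mul_angularCoeff hk f m).mul_const _

lemma sumEqDelta_one (h : IsModeCombination a b Φ) (hab : a * star a + b * star b = 1 / 2) {k : ℝ}
    (hk : 0 < k) :
    SumEqDelta (fun β => angularCoeff k β Φ) (fun β => angularCoeff k β Φ) 1 := by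
  intro f β'
  refine ⟨fun m => integrable_mul_angularCoeff_mul_star h hk f β' m, ?_⟩
  obtain ⟨M, hM⟩ := exists_norm_spectralTransform_le k f
  have hs := (hasSum_halfRange_mul_star_exp a b (hasDerivAt_spectralTransform k f)
    (continuous_spectralTransformDeriv k f) hM (integrable_spectralTransform hk f)
    (integrable_spectralTransformDeriv hk f) (β' / k)).mul_left (1 / (2 * k * Real.pi ^ 2 : ℂ))
  rw [integral_spectralTransform_mul_star hk, hab] at hs
  have hk' : (k : ℂ) ≠ 0 := by exact_mod_cast hk.ne'
  have hπ : (Real.pi : ℂ) ≠ 0 := by exact_mod_cast Real.pi_ne_zero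
  -- The constants are the normalisation `1/(2kπ²)`, the Parseval factor `2π · 1/2`, and `2πk` from
  -- Fourier inversion.
  have hval : 1 / (2 * k * Real.pi ^ 2 : ℂ) * (2 * Real.pi * (1 / 2) * (2 * Real.pi * k * f β')) =
      1 * f β' := by
    field_simp
  rw [hval] at hs
  exact hs.congr_fun fun m => integral_mul_angularCoeff_mul_star h h hk f β' m

/-- The summand is odd in `m`; once the series converges absolutely, reflecting `m` shows that its
sum equals its own negative. -/
lemma sumEqDelta_zero (h : IsModeCombination a b Φ) (h' : IsModeCombination a' b' Φ') {k : ℝ}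
    (hk : 0 < k) (hodd : ∀ β β' m, angularCoeff k β Φ (-m) * star (angularCoeff k β' Φ' (-m)) =
      -(angularCoeff k β Φ m * star (angularCoeff k β' Φ' m))) :
    SumEqDelta (fun β => angularCoeff k β Φ) (fun β => angularCoeff k β Φ') 0 := by
  intro f β'
  refine ⟨fun m => integrable_mul_angularCoeff_mul_star h hk f β' m, ?_⟩
  obtain ⟨M, hM⟩ := exists_norm_spectralTransform_le k f
  have hs := (summable_halfRange_mul_star a b a' b' (hasDerivAt_spectralTransform k f)
    (continuous_spectralTransformDeriv k f) hM (integrable_spectralTransform hk f)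
    (integrable_spectralTransformDeriv hk f) (β' / k)).mul_left (1 / (2 * k * Real.pi ^ 2 : ℂ))
  have hs2 : Summable fun m : ℤ =>
      ∫ β, f β * (angularCoeff k β Φ m * star (angularCoeff k β' Φ' m)) :=
    hs.congr fun m => (integral_mul_angularCoeff_mul_star h h' hk f β' m).symm
  have hneg : ∀ m : ℤ, ∫ β, f β * (angularCoeff k β Φ (-m) * star (angularCoeff k β' Φ' (-m))) =
      -∫ β, f β * (angularCoeff k β Φ m * star (angularCoeff k β' Φ' m)) := fun m => by
    rw [← integral_neg]
    congr 1; ext β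
    rw [hodd]; ring
  have h1 := hs2.hasSum
  have h2 := (Equiv.neg ℤ).hasSum_iff.2 h1
  have h3 : HasSum (fun m : ℤ => ∫ β, f β * (angularCoeff k β Φ m * star (angularCoeff k β' Φ' m)))
      (-∑' m : ℤ, ∫ β, f β * (angularCoeff k β Φ m * star (angularCoeff k β' Φ' m))) :=
    h2.neg.congr_fun fun m => by
      simp only [Function.comp, Equiv.neg_apply]
      rw [hneg, neg_neg]
  have h4 := h1.unique h3
  have h5 : ∑' m : ℤ, ∫ β, f β * (angularCoeff k β Φ m * star (angularCoeff k β' Φ' m)) = 0 :=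
    self_eq_neg.1 h4
  rw [zero_mul, ← h5]
  exact h1

end

/-! ### Parity in `m` and the final identities. -/

lemma coeffPlus_neg {k : ℝ} (hk : 0 < k) (β : ℝ) (m : ℤ) :
    coeffPlus k β (-m) = coeffPlus k β m := by
  simp [coeffPlus_eq hk, angularCoeff]

lemma coeffMinus_neg {k : ℝ} (hk : 0 < k) (β : ℝ) (m : ℤ) :
    coeffMinus k β (-m) = -coeffMinus k β m := by
  simp [coeffMinus_eq hk, angularCoeff]

lemma sum_Icc_neg_eq_zero {u : ℤ → ℂ} (hu : ∀ m, u (-m) = -u m) (N : ℕ) :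
    ∑ m ∈ Finset.Icc (-(N : ℤ)) N, u m = 0 := by
  have h : ∑ m ∈ Finset.Icc (-(N : ℤ)) N, u m = ∑ m ∈ Finset.Icc (-(N : ℤ)) N, u (-m) := by
    refine Finset.sum_nbij' (fun m => -m) (fun m => -m) ?_ ?_ ?_ ?_ ?_ <;>
      simp only [Finset.mem_Icc, neg_neg, implies_true] <;> intro m hm <;> constructor <;> omega
  simp_rw [hu, Finset.sum_neg_distrib] at h
  exact self_eq_neg.1 h

lemma sumEqDelta_coeffPlus {k : ℝ} (hk : 0 < k) : SumEqDelta (coeffPlus k) (coeffPlus k) 1 := by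
  rw [show coeffPlus k = _ from funext (coeffPlus_eq hk)]
  exact sumEqDelta_one isModeCombination_cos (by simp; norm_num) hk

lemma sumEqDelta_coeffMinus {k : ℝ} (hk : 0 < k) :
    SumEqDelta (coeffMinus k) (coeffMinus k) 1 := by
  rw [show coeffMinus k = _ from funext (coeffMinus_eq hk)]
  refine sumEqDelta_one isModeCombination_sin ?_ hk
  -- The sine has `a = -i/2` and `b = i/2`, so `|a|² + |b|² = 1/2`, the same value as for the
  -- cosine.
  simp only [star_div₀, star_neg, Complex.star_def, Complex.conj_I, Complex.conj_ofNat]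
  ring_nf
  rw [Complex.I_sq]; norm_num

lemma sumEqDelta_coeffPlus_coeffMinus {k : ℝ} (hk : 0 < k) :
    SumEqDelta (coeffPlus k) (coeffMinus k) 0 := by
  have hp : ∀ β, coeffPlus k β = _ := coeffPlus_eq hk
  have hm : ∀ β, coeffMinus k β = _ := coeffMinus_eq hk
  rw [show coeffPlus k = _ from funext hp, show coeffMinus k = _ from funext hm]
  refine sumEqDelta_zero isModeCombination_cos isModeCombination_sin hk fun β β' m => ?_
  rw [← hp, ← hm, coeffPlus_neg hk, coeffMinus_neg hk, star_neg, mul_neg]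

lemma sumEqDelta_coeffMinus_coeffPlus {k : ℝ} (hk : 0 < k) :
    SumEqDelta (coeffMinus k) (coeffPlus k) 0 := by
  have hp : ∀ β, coeffPlus k β = _ := coeffPlus_eq hk
  have hm : ∀ β, coeffMinus k β = _ := coeffMinus_eq hk
  rw [show coeffPlus k = _ from funext hp, show coeffMinus k = _ from funext hm]
  refine sumEqDelta_zero isModeCombination_sin isModeCombination_cos hk fun β β' m => ?_
  rw [← hp, ← hm, coeffPlus_neg hk, coeffMinus_neg hk, neg_mul]

end

theorem mainTheorem4 (k : ℝ) (hk : 0 < k) :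
    -- the coefficients are well defined: each polar expansion exists and is unique
    (∀ β : ℝ, (∃! w : ℤ → ℂ, IsPolarExpansion k (parabolicWavePlus k β) w) ∧
      (∃! w : ℤ → ℂ, IsPolarExpansion k (parabolicWaveMinus k β) w)) ∧
    -- integral representation
    (∀ (β : ℝ) (m : ℤ),
      IntervalIntegrable (fun φ : ℝ => angularWeight k β φ * (Real.cos (m * φ) : ℂ))
        MeasureTheory.volume 0 Real.pi ∧
      coeffPlus k β m = (-Complex.I) ^ m.natAbs / (Real.pi * Real.sqrt (2 * k) : ℂ) *
        ∫ φ in (0 : ℝ)..Real.pi, angularWeight k β φ * (Real.cos (m * φ) : ℂ)) ∧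
    (∀ (β : ℝ) (m : ℤ),
      IntervalIntegrable (fun φ : ℝ => angularWeight k β φ * (Real.sin (m * φ) : ℂ))
        MeasureTheory.volume 0 Real.pi ∧
      coeffMinus k β m = (-Complex.I) ^ m.natAbs / (Real.pi * Real.sqrt (2 * k) : ℂ) *
        ∫ φ in (0 : ℝ)..Real.pi, angularWeight k β φ * (Real.sin (m * φ) : ℂ)) ∧
    -- orthogonality in `β`
    (∀ m m' : ℤ,
      MeasureTheory.Integrable (fun β : ℝ => coeffPlus k β m * star (coeffPlus k β m')) ∧
      ∫ β : ℝ, coeffPlus k β m * star (coeffPlus k β m') =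
        ((if m = m' then 1 else 0) + (if m = -m' then 1 else 0)) / 2) ∧
    (∀ m m' : ℤ,
      MeasureTheory.Integrable (fun β : ℝ => coeffMinus k β m * star (coeffMinus k β m')) ∧
      ∫ β : ℝ, coeffMinus k β m * star (coeffMinus k β m') =
        (Int.sign (m * m') : ℂ) * (if |m| = |m'| then 1 else 0) / 2) ∧
    -- orthogonality in `m`, in the sense of distributions
    SumEqDelta (coeffPlus k) (coeffPlus k) 1 ∧
    SumEqDelta (coeffMinus k) (coeffMinus k) 1 ∧
    -- vanishing of the cross terms, in the sense of distributions and for symmetric partial sums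
    SumEqDelta (coeffPlus k) (coeffMinus k) 0 ∧
    SumEqDelta (coeffMinus k) (coeffPlus k) 0 ∧
    (∀ (β β' : ℝ) (N : ℕ),
      ∑ m ∈ Finset.Icc (-(N : ℤ)) N, coeffPlus k β m * star (coeffMinus k β' m) = 0 ∧
      ∑ m ∈ Finset.Icc (-(N : ℤ)) N, coeffMinus k β m * star (coeffPlus k β' m) = 0) := by
  refine ⟨fun β => ⟨existsUnique_isPolarExpansion_plus hk β, existsUnique_isPolarExpansion_minus hk β⟩,
    fun β m => ⟨intervalIntegrable_angularWeight_mul hk β (by fun_prop), ?_⟩,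
    fun β m => ⟨intervalIntegrable_angularWeight_mul hk β (by fun_prop), ?_⟩,
    fun m m' => ⟨?_, integral_coeffPlus_mul hk m m'⟩,
    fun m m' => ⟨?_, integral_coeffMinus_mul hk m m'⟩,
    sumEqDelta_coeffPlus hk, sumEqDelta_coeffMinus hk, sumEqDelta_coeffPlus_coeffMinus hk,
    sumEqDelta_coeffMinus_coeffPlus hk, fun β β' N => ⟨?_, ?_⟩⟩
  · rw [coeffPlus_eq hk]; rfl
  · rw [coeffMinus_eq hk]; rfl
  · simp_rw [coeffPlus_eq hk]
    exact isModeCombination_cos.integrable_angularCoeff_mul hk m m'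
  · simp_rw [coeffMinus_eq hk]
    exact isModeCombination_sin.integrable_angularCoeff_mul hk m m'
  · refine sum_Icc_neg_eq_zero (fun m => ?_) N
    rw [coeffPlus_neg hk, coeffMinus_neg hk, star_neg, mul_neg]
  · refine sum_Icc_neg_eq_zero (fun m => ?_) N
    rw [coeffPlus_neg hk, coeffMinus_neg hk, neg_mul]
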